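/- **Notation.** Let $n>1$, $a\in\mathbb Z$, $p\in\{0,\dots,n\}$, $\kappa\in\mathbb Q(q)^\times$, and let indices $i,j$ run over $\{0,\dots,n\}$. Let $a_{ij}=\langle h_i,\alpha_j\rangle$ be the Cartan matrix of type $A_n^{(1)}$ (so $a_{ii}=2$, $a_{ij}=-1$ if $i\equiv j\pm1$ mod $n+1$, and $a_{ij}=0$ otherwise), and let $M=(m_{ij})$ be the skew-symmetric matrix with $m_{i,i+1}=-a$, $m_{i+1,i}=a$ (indices modulo $n+1$) and all other entries $0$. Put $[k]=\frac{q^k-q^{-k}}{q-q^{-1}}$, $[m]!=[1]\cdots[m]$, $\left[{m\atop r}\right]=\frac{[m]!}{[r]!\,[m-r]!}$. **The algebra.** $U_q(\mathfrak{sl}_{n+1,tor})$ is the associative $\mathbb Q(q)$-algebra with generators $E_{i,k},F_{i,k}$ ($k\in\mathbb Z$), $H_{i,l}$ ($l\in\mathbb Z\setminus\{0\}$), $K_i^{\pm}$, $q^{\pm\frac12c}$, $q^{\pm d_1}$, $q^{\pm d_2}$. Define $K^\pm_{i,k}$ by $K_i^\pm(z)=\sum_{k}K^\pm_{i,k}z^{-k}=K_i^\pm\exp\bigl(\pm(q-q^{-1})\sum_{k\ge1}H_{i,\pm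 k}z^{\mp k}\bigr)$. The defining relations are: $q^{\pm\frac12 c}$ are central; $K_i^\pm$ are mutually inverse, as are $q^{\pm\frac12c}$, $q^{\pm d_1}$, $q^{\pm d_2}$; $K_i^\pm$ commute with $K_j^\pm$, $K_j^\mp$, $H_{j,l}$ and $q^{\pm d_1},q^{\pm d_2}$; $q^{\pm d_2}$ commute with $H_{j,l}$; and $$[H_{i,k},H_{j,l}]=\delta_{k+l,0}\tfrac1k[ka_{ij}]\tfrac{q^{kc}-q^{-kc}}{q-q^{-1}}\kappa^{-km_{ij}},$$ $$q^{d_1}X_{j,k}q^{-d_1}=q^kX_{j,k}\ (X=E,F,H),\quad q^{d_2}E_{j,k}q^{-d_2}=q^{\delta_{j0}}E_{j,k},\quad q^{d_2}F_{j,k}q^{-d_2}=q^{-\delta_{j0}}F_{j,k},$$ $$K_i^+E_{j,k}K_i^-=q^{a_{ij}}E_{j,k},\quad K_i^+F_{j,k}K_i^-=q^{-a_{ij}}F_{j,k},$$ $$[H_{i,k},E_{j,l}]=\tfrac1k[ka_{ij}]q^{-\frac12|k|c}\kappa^{-km_{ij}}E_{j,k+l},\quad [H_{i,k},F_{j,l}]=-\tfrac1k[ka_{ij}]q^{\frac12|k|c}\kappa^{-km_{ij}}F_{j,k+l},$$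 $$\kappa^{m_{ij}}E_{i,k+1}E_{j,l}-q^{a_{ij}}\kappa^{m_{ij}}E_{j,l}E_{i,k+1}=q^{a_{ij}}E_{i,k}E_{j,l+1}-E_{j,l+1}E_{i,k},$$ $$\kappa^{m_{ij}}F_{i,k+1}F_{j,l}-q^{-a_{ij}}\kappa^{m_{ij}}F_{j,l}F_{i,k+1}=q^{-a_{ij}}F_{i,k}F_{j,l+1}-F_{j,l+1}F_{i,k},$$ $$[E_{i,k},F_{j,l}]=\delta_{ij}\tfrac1{q-q^{-1}}\bigl(q^{\frac12(k-l)c}K^+_{i,k+l}-q^{\frac12(l-k)c}K^-_{i,k+l}\bigr),$$ and, for $i\ne j$, $m=1-a_{ij}$ and both $X=E$ and $X=F$, $$\sum_{\sigma\in\mathfrak S_m}\sum_{r=0}^m(-1)^r\left[{m\atop r}\right]X_{i,k_{\sigma(1)}}\cdots X_{i,k_{\sigma(r)}}X_{j,l}X_{i,k_{\sigma(r+1)}}\cdots X_{i,k_{\sigma(m)}}=0.$$ Let $U_q^{\phi'}$ be the subalgebra generated by all these generators except $q^{\pm d_2}$. **The space.** Let $L$ be any field extension of $\mathbb Q(q)$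 containing chosen square roots $q^{1/2}$ and $\kappa^{1/2}$; vector spaces below are over $L$. Let $\mathcal F_n$ be the Fock space of the Heisenberg algebra with generators $H_{i,l}$ ($l\neq 0$) and relations $[H_{i,k},H_{j,l}]=\delta_{k+l,0}\frac1k[ka_{ij}][k]\kappa^{-km_{ij}}$: it is generated by $v_0$ with $H_{i,l}v_0=0$ for $l>0$, and has as basis the monomials in the commuting elements $H_{i,-k}$ ($k>0$) applied to $v_0$. Let $\bar\alpha_i,\bar h_i,\bar\Lambda_i$ ($1\le i\le n$) be the simple roots, simple coroots and fundamental weights of $\mathfrak{sl}_{n+1}$, $\bar\alpha_0=-\sum_{i\ge1}\bar\alpha_i$, $\bar h_0=-\sum_{i\ge1}\bar h_i$, $\bar\Lambda_0=0$, and let $\bar Q\subset\bar P$ be the root and weight lattices. Let $L\{\bar P\}$ be the algebra generated by invertible symbols $e^{\bar\alpha_2},\dots,e^{\bar\alpha_n},e^{\bar\Lambda_n}$ with $e^{\bar\alpha_i}e^{\bar\alpha_j}=(-1)^{\langle\bar h_i,\bar\alpha_j\rangle}e^{\bar\alpha_j}e^{\bar\alpha_i}$ and $e^{\bar\alpha_i}e^{\bar\Lambda_n}=(-1)^{\delta_{in}}e^{\bar\Lambda_n}e^{\bar\alpha_i}$;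 for $\beta=\sum_{i=2}^nc_i\bar\alpha_i+c_{n+1}\bar\Lambda_n\in\bar P$ put $e^\beta=(e^{\bar\alpha_2})^{c_2}\cdots(e^{\bar\alpha_n})^{c_n}(e^{\bar\Lambda_n})^{c_{n+1}}$. Let $L\{\bar Q\}$ be the subalgebra generated by the $(e^{\bar\alpha_i})^{\pm1}$, $1\le i\le n$, and $$W(p)_n=\mathcal F_n\otimes L\{\bar Q\}e^{\bar\Lambda_p},$$ with basis the $v\otimes e^\beta$, where $v=H_{i_1,-k_1}\cdots H_{i_N,-k_N}v_0$ and $\beta=\sum_{j=1}^nm_j\bar\alpha_j+\bar\Lambda_p$. On it $H_{i,l}$ acts on the first factor, $e^{\bar\alpha_i}$ acts by left multiplication on the second factor, and $$\partial_{\bar\alpha_i}(v\otimes e^\beta)=\langle\bar h_i,\beta\rangle\,v\otimes e^\beta,\qquad z^{H_{i,0}}(v\otimes e^\beta)=z^{\langle\bar h_i,\beta\rangle}\kappa^{\frac12\sum_{j=1}^n\langle\bar h_i,m_j\bar\alpha_j\rangle m_{ij}}\,v\otimes e^\beta,$$ $$d(v\otimes e^\beta)=\Bigl(-\sum_{s}k_s-\tfrac{(\beta|\beta)}2+\tfrac{(\bar\Lambda_p|\bar\Lambda_p)}2\Bigr)v\otimes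 e^\beta .$$ **Proposition.** There is exactly one $U_q^{\phi'}$-module structure on $W(p)_n$ by $L$-linear operators such that $q^{\frac12c}\mapsto q^{\frac12}$, $q^{d_1}\mapsto q^d$, $H_{i,l}\mapsto H_{i,l}$ and, for $0\le i\le n$, with $E_i(z)=\sum_{k\in\mathbb Z}E_{i,k}z^{-k}$ and $F_i(z)=\sum_{k\in\mathbb Z}F_{i,k}z^{-k}$, $$E_i(z)\mapsto\exp\Bigl(\sum_{k\ge1}\tfrac{H_{i,-k}}{[k]}(q^{-1/2}z)^k\Bigr)\exp\Bigl(-\sum_{k\ge1}\tfrac{H_{i,k}}{[k]}(q^{1/2}z)^{-k}\Bigr)e^{\bar\alpha_i}z^{H_{i,0}+1},$$ $$F_i(z)\mapsto\exp\Bigl(-\sum_{k\ge1}\tfrac{H_{i,-k}}{[k]}(q^{1/2}z)^k\Bigr)\exp\Bigl(\sum_{k\ge1}\tfrac{H_{i,k}}{[k]}(q^{-1/2}z)^{-k}\Bigr)(e^{\bar\alpha_i})^{-1}z^{-H_{i,0}+1},$$ $$K_i^\pm(z)\mapsto\exp\Bigl(\pm(q-q^{-1})\sum_{k\ge1}H_{i,\pm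 k}z^{\mp k}\Bigr)q^{\pm\partial_{\bar\alpha_i}}.$$ This module has level $(1,0)$: the central element $q^c$ acts as $q^1$, and the central element $K_\delta^+=K_0^+K_1^+\cdots K_n^+$ acts as $q^0=1$. -/

import Mathlib

noncomputable section

/-! ### Notation: quantum integers, the affine Cartan matrix, formal exponentials -/

/-- The quantum integer `[k] = (q ^ k - q ^ (-k)) / (q - q⁻¹)`. -/
def qInt {K : Type*} [Field K] (q : K) (k : ℤ) : K := (q ^ k - q ^ (-k)) / (q - q⁻¹)

/-- The quantum factorial `[m]! = [1] [2] ⋯ [m]`. -/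
def qFactorial {K : Type*} [Field K] (q : K) (m : ℕ) : K :=
  ∏ k ∈ Finset.range m, qInt q ((k : ℤ) + 1)

/-- The quantum binomial coefficient `[m]! / ([r]! [m - r]!)`, for `r ≤ m`. -/
def qBinomial {K : Type*} [Field K] (q : K) (m r : ℕ) : K :=
  qFactorial q m / (qFactorial q r * qFactorial q (m - r))

/-- The entries `⟨h_i, α_j⟩` (`0 ≤ i, j ≤ n`) of the Cartan matrix of type `A_n^{(1)}`, `n ≥ 1`.
The addition in `Fin (n + 1)` is modulo `n + 1`. -/
def affCartan (n : ℕ) (i j : Fin (n + 1)) : ℤ :=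
  (if i = j then 2 else 0) - (if j = i + 1 then 1 else 0) - (if i = j + 1 then 1 else 0)

/-- The skew-symmetric matrix `M` with `m_{i,i+1} = -a`, `m_{i+1,i} = a` (indices modulo `n + 1`)
and all other entries `0`, for `n ≥ 2`. -/
def torMatrix (n : ℕ) (a : ℤ) : Matrix (Fin (n + 1)) (Fin (n + 1)) ℤ := fun i j =>
  (if i = j + 1 then a else 0) - (if j = i + 1 then a else 0)

/-- The coefficient of `Z ^ m` in `exp (∑_{k ≥ 1} x_k Z ^ k) ∈ A⟦Z⟧`, where `A` is an associative
algebra over a field of characteristic zero. As the exponent has no constant term, only its powers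
with exponent at most `m` contribute to the coefficient of `Z ^ m`. -/
def expCoeff (K : Type*) {A : Type*} [Field K] [Ring A] [Algebra K A] (x : ℕ → A) (m : ℕ) : A :=
  ∑ N ∈ Finset.range (m + 1), ((N.factorial : K)⁻¹) •
    PowerSeries.coeff m ((PowerSeries.mk fun k => if k = 0 then 0 else x k) ^ N)

/-- The Fourier component `K⁺_k`, the coefficient of `z ^ (-k)` in
`K⁺ exp ((q - q⁻¹) ∑_{k ≥ 1} H_k z ^ (-k))`; here `h k` stands for `H_k`, `k ≥ 1`. -/
def kPlusMode {K A : Type*} [Field K] [Ring A] [Algebra K A] (q : K) (kp : A) (h : ℕ → A)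
    (k : ℤ) : A :=
  if 0 ≤ k then kp * expCoeff K (fun r => (q - q⁻¹) • h r) k.toNat else 0

/-- The Fourier component `K⁻_k`, the coefficient of `z ^ (-k)` in
`K⁻ exp (-(q - q⁻¹) ∑_{k ≥ 1} H_{-k} z ^ k)`; here `h k` stands for `H_{-k}`, `k ≥ 1`. -/
def kMinusMode {K A : Type*} [Field K] [Ring A] [Algebra K A] (q : K) (km : A) (h : ℕ → A)
    (k : ℤ) : A :=
  if k ≤ 0 then km * expCoeff K (fun r => (-(q - q⁻¹)) • h r) (-k).toNat else 0

/-! ### The quantum toroidal algebra -/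

/-- The generators `E_{i,k}`, `F_{i,k}`, `H_{i,l}` (`l ≠ 0`), `K_i^±`, `q^{±c/2}`, `q^{±d₁}`,
`q^{±d₂}` of the quantum toroidal algebra. -/
inductive TorGen (n : ℕ) : Type
  | E (i : Fin (n + 1)) (k : ℤ)
  | F (i : Fin (n + 1)) (k : ℤ)
  | H (i : Fin (n + 1)) (l : ℤ) (hl : l ≠ 0)
  | Kp (i : Fin (n + 1))
  | Km (i : Fin (n + 1))
  | Cp
  | Cm
  | D1p
  | D1m
  | D2p
  | D2m

namespace TorGen

section

variable (K : Type*) [Field K] {n : ℕ}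

/-- A generator as an element of the free algebra. -/
abbrev free (g : TorGen n) : FreeAlgebra K (TorGen n) := FreeAlgebra.ι K g

/-- The power `q^{m c / 2}` of `q^{c/2}`, for `m : ℤ` (one of the two factors is `1`). -/
def cPow (m : ℤ) : FreeAlgebra K (TorGen n) :=
  (free K Cp) ^ m.toNat * (free K Cm) ^ (-m).toNat

/-- The element `K⁺_{i,k}` of the free algebra. -/
def kPlus (q : K) (i : Fin (n + 1)) (k : ℤ) : FreeAlgebra K (TorGen n) :=
  kPlusMode q (free K (Kp i))
    (fun r => if hr : (r : ℤ) ≠ 0 then free K (H i r hr) else 0) k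

/-- The element `K⁻_{i,k}` of the free algebra. -/
def kMinus (q : K) (i : Fin (n + 1)) (k : ℤ) : FreeAlgebra K (TorGen n) :=
  kMinusMode q (free K (Km i))
    (fun r => if hr : -(r : ℤ) ≠ 0 then free K (H i (-r) hr) else 0) k

end

end TorGen

/-- The left hand side
`∑_{σ ∈ S_m} ∑_{r=0}^m (-1)^r [m choose r] x_{k_σ(1)} ⋯ x_{k_σ(r)} y x_{k_σ(r+1)} ⋯ x_{k_σ(m)}`
of a quantum Serre relation. -/
def serreSum {K A : Type*} [Field K] [Ring A] [Algebra K A] (q : K) (m : ℕ) (x : ℤ → A) (y : A)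
    (k : Fin m → ℤ) : A :=
  ∑ σ : Equiv.Perm (Fin m), ∑ r ∈ Finset.range (m + 1), ((-1) ^ r * qBinomial q m r) •
    (((List.ofFn fun t => x (k (σ t))).take r).prod * y *
      ((List.ofFn fun t => x (k (σ t))).drop r).prod)

open TorGen in
/-- The defining relations of the quantum toroidal algebra attached to the matrix `M` and to
the nonzero scalar `κ`. -/
inductive TorRel {K : Type*} [Field K] (q κ : K) (n : ℕ)
    (M : Matrix (Fin (n + 1)) (Fin (n + 1)) ℤ) :
    FreeAlgebra K (TorGen n) → FreeAlgebra K (TorGen n) → Prop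
  -- mutually inverse generators
  | cp_cm : TorRel q κ n M (free K Cp * free K Cm) 1
  | cm_cp : TorRel q κ n M (free K Cm * free K Cp) 1
  | d1p_d1m : TorRel q κ n M (free K D1p * free K D1m) 1
  | d1m_d1p : TorRel q κ n M (free K D1m * free K D1p) 1
  | d2p_d2m : TorRel q κ n M (free K D2p * free K D2m) 1
  | d2m_d2p : TorRel q κ n M (free K D2m * free K D2p) 1
  -- the elements q^{±c/2} are central
  | cp_central (g : TorGen n) : TorRel q κ n M (free K Cp * free K g) (free K g * free K Cp)
  | cm_central (g : TorGen n) : TorRel q κ n M (free K Cm * free K g) (free K g * free K Cm)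
  -- the elements K_i^±
  | kp_km (i) : TorRel q κ n M (free K (Kp i) * free K (Km i)) 1
  | km_kp (i) : TorRel q κ n M (free K (Km i) * free K (Kp i)) 1
  | kp_kp (i j) : TorRel q κ n M (free K (Kp i) * free K (Kp j)) (free K (Kp j) * free K (Kp i))
  | kp_km_comm (i j) :
      TorRel q κ n M (free K (Kp i) * free K (Km j)) (free K (Km j) * free K (Kp i))
  | km_km (i j) : TorRel q κ n M (free K (Km i) * free K (Km j)) (free K (Km j) * free K (Km i))
  | kp_h (i j l) (hl : l ≠ 0) :
      TorRel q κ n M (free K (Kp i) * free K (H j l hl)) (free K (H j l hl) * free K (Kp i))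
  | km_h (i j l) (hl : l ≠ 0) :
      TorRel q κ n M (free K (Km i) * free K (H j l hl)) (free K (H j l hl) * free K (Km i))
  -- the Heisenberg relations
  | h_h (i j k l) (hk : k ≠ 0) (hl : l ≠ 0) :
      TorRel q κ n M
        (free K (H i k hk) * free K (H j l hl) - free K (H j l hl) * free K (H i k hk))
        (if k + l = 0 then
          ((k : K)⁻¹ * qInt q (k * affCartan n i j) * (q - q⁻¹)⁻¹ * κ ^ (-k * M i j)) •
            (cPow K (2 * k) - cPow K (-(2 * k)))
        else 0)
  -- the elements q^{±d₁} and q^{±d₂}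
  | d1p_kp (j) : TorRel q κ n M (free K D1p * free K (Kp j)) (free K (Kp j) * free K D1p)
  | d1p_km (j) : TorRel q κ n M (free K D1p * free K (Km j)) (free K (Km j) * free K D1p)
  | d1m_kp (j) : TorRel q κ n M (free K D1m * free K (Kp j)) (free K (Kp j) * free K D1m)
  | d1m_km (j) : TorRel q κ n M (free K D1m * free K (Km j)) (free K (Km j) * free K D1m)
  | d2p_kp (j) : TorRel q κ n M (free K D2p * free K (Kp j)) (free K (Kp j) * free K D2p)
  | d2p_km (j) : TorRel q κ n M (free K D2p * free K (Km j)) (free K (Km j) * free K D2p)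
  | d2m_kp (j) : TorRel q κ n M (free K D2m * free K (Kp j)) (free K (Kp j) * free K D2m)
  | d2m_km (j) : TorRel q κ n M (free K D2m * free K (Km j)) (free K (Km j) * free K D2m)
  | d1_h (j l) (hl : l ≠ 0) :
      TorRel q κ n M (free K D1p * free K (H j l hl) * free K D1m) (q ^ l • free K (H j l hl))
  | d2p_h (j l) (hl : l ≠ 0) :
      TorRel q κ n M (free K D2p * free K (H j l hl)) (free K (H j l hl) * free K D2p)
  | d2m_h (j l) (hl : l ≠ 0) :
      TorRel q κ n M (free K D2m * free K (H j l hl)) (free K (H j l hl) * free K D2m)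
  | d1_e (j k) : TorRel q κ n M (free K D1p * free K (E j k) * free K D1m) (q ^ k • free K (E j k))
  | d1_f (j k) : TorRel q κ n M (free K D1p * free K (F j k) * free K D1m) (q ^ k • free K (F j k))
  | d2_e (j k) :
      TorRel q κ n M (free K D2p * free K (E j k) * free K D2m)
        (q ^ (if j = 0 then (1 : ℤ) else 0) • free K (E j k))
  | d2_f (j k) :
      TorRel q κ n M (free K D2p * free K (F j k) * free K D2m)
        (q ^ (if j = 0 then (-1 : ℤ) else 0) • free K (F j k))
  -- weights of E and F
  | k_e (i j k) :
      TorRel q κ n M (free K (Kp i) * free K (E j k) * free K (Km i))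
        (q ^ (affCartan n i j) • free K (E j k))
  | k_f (i j k) :
      TorRel q κ n M (free K (Kp i) * free K (F j k) * free K (Km i))
        (q ^ (-affCartan n i j) • free K (F j k))
  | h_e (i j k l) (hk : k ≠ 0) :
      TorRel q κ n M (free K (H i k hk) * free K (E j l) - free K (E j l) * free K (H i k hk))
        (((k : K)⁻¹ * qInt q (k * affCartan n i j) * κ ^ (-k * M i j)) •
          (cPow K (-|k|) * free K (E j (k + l))))
  | h_f (i j k l) (hk : k ≠ 0) :
      TorRel q κ n M (free K (H i k hk) * free K (F j l) - free K (F j l) * free K (H i k hk))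
        ((-((k : K)⁻¹ * qInt q (k * affCartan n i j) * κ ^ (-k * M i j))) •
          (cPow K |k| * free K (F j (k + l))))
  -- quadratic relations
  | e_e (i j k l) :
      TorRel q κ n M
        (κ ^ (M i j) • (free K (E i (k + 1)) * free K (E j l))
          - (q ^ (affCartan n i j) * κ ^ (M i j)) • (free K (E j l) * free K (E i (k + 1))))
        (q ^ (affCartan n i j) • (free K (E i k) * free K (E j (l + 1)))
          - free K (E j (l + 1)) * free K (E i k))
  | f_f (i j k l) :
      TorRel q κ n M
        (κ ^ (M i j) • (free K (F i (k + 1)) * free K (F j l))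
          - (q ^ (-affCartan n i j) * κ ^ (M i j)) • (free K (F j l) * free K (F i (k + 1))))
        (q ^ (-affCartan n i j) • (free K (F i k) * free K (F j (l + 1)))
          - free K (F j (l + 1)) * free K (F i k))
  | e_f (i j k l) :
      TorRel q κ n M (free K (E i k) * free K (F j l) - free K (F j l) * free K (E i k))
        (if i = j then
          (q - q⁻¹)⁻¹ • (cPow K (k - l) * kPlus K q i (k + l)
            - cPow K (l - k) * kMinus K q i (k + l))
        else 0)
  -- Serre relations
  | serre_e (i j) (hij : i ≠ j) (k : Fin (1 - affCartan n i j).toNat → ℤ) (l : ℤ) :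
      TorRel q κ n M
        (serreSum q (1 - affCartan n i j).toNat (fun r => free K (E i r)) (free K (E j l)) k) 0
  | serre_f (i j) (hij : i ≠ j) (k : Fin (1 - affCartan n i j).toNat → ℤ) (l : ℤ) :
      TorRel q κ n M
        (serreSum q (1 - affCartan n i j).toNat (fun r => free K (F i r)) (free K (F j l)) k) 0

/-- The quantum toroidal algebra `U_q(sl_{n+1,tor})` over `K` attached to `M` and `κ`. -/
abbrev QTor {K : Type*} [Field K] (q κ : K) (n : ℕ)
    (M : Matrix (Fin (n + 1)) (Fin (n + 1)) ℤ) : Type _ :=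
  RingQuot (TorRel q κ n M)

/-- The generators other than `q^{±d₂}`. -/
def TorGen.NotD2 {n : ℕ} : TorGen n → Prop
  | .D2p => False
  | .D2m => False
  | _ => True

namespace QTor

section

variable {K : Type*} [Field K] (q κ : K) (n : ℕ) (M : Matrix (Fin (n + 1)) (Fin (n + 1)) ℤ)

/-- A generator as an element of `U_q(sl_{n+1,tor})`. -/
def gen (g : TorGen n) : QTor q κ n M :=
  RingQuot.mkAlgHom K (TorRel q κ n M) (FreeAlgebra.ι K g)

/-- The subalgebra of `U_q(sl_{n+1,tor})` generated by all generators but `q^{±d₂}`. -/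
def phi : Subalgebra K (QTor q κ n M) :=
  Algebra.adjoin K {x | ∃ g : TorGen n, g.NotD2 ∧ x = gen q κ n M g}

variable {n}

/-- A generator other than `q^{±d₂}` as an element of the subalgebra `phi`. -/
def phiGen (g : TorGen n) (hg : g.NotD2) : phi q κ n M :=
  ⟨gen q κ n M g, Algebra.subset_adjoin ⟨g, hg, rfl⟩⟩

/-- The element `E_{i,k}`. -/
def phiE (i : Fin (n + 1)) (k : ℤ) : phi q κ n M := phiGen q κ M (.E i k) trivial

/-- The element `F_{i,k}`. -/
def phiF (i : Fin (n + 1)) (k : ℤ) : phi q κ n M := phiGen q κ M (.F i k) trivial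

/-- The element `H_{i,l}`, `l ≠ 0`. -/
def phiH (i : Fin (n + 1)) (l : ℤ) (hl : l ≠ 0) : phi q κ n M := phiGen q κ M (.H i l hl) trivial

/-- The element `K_i^+`. -/
def phiKp (i : Fin (n + 1)) : phi q κ n M := phiGen q κ M (.Kp i) trivial

/-- The element `K_i^-`. -/
def phiKm (i : Fin (n + 1)) : phi q κ n M := phiGen q κ M (.Km i) trivial

/-- The element `q^{c/2}`. -/
def phiC : phi q κ n M := phiGen q κ M .Cp trivial

/-- The element `q^{d₁}`. -/
def phiD1 : phi q κ n M := phiGen q κ M .D1p trivial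

/-- The Fourier component `K⁺_{i,k}` of `K_i^+(z)`. -/
def phiKPlus (i : Fin (n + 1)) (k : ℤ) : phi q κ n M :=
  kPlusMode q (phiKp q κ M i)
    (fun r => if hr : (r : ℤ) ≠ 0 then phiH q κ M i r hr else 0) k

/-- The Fourier component `K⁻_{i,k}` of `K_i^-(z)`. -/
def phiKMinus (i : Fin (n + 1)) (k : ℤ) : phi q κ n M :=
  kMinusMode q (phiKm q κ M i)
    (fun r => if hr : -(r : ℤ) ≠ 0 then phiH q κ M i (-r) hr else 0) k

/-- The central element `K_δ^+ = K_0^+ K_1^+ ⋯ K_n^+`. -/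
def phiKDelta : phi q κ n M := (List.ofFn fun i : Fin (n + 1) => phiKp q κ M i).prod

/-- A representation of `phi` has level `(k, l)` if the canonical central element `q^c` of the
first (horizontal) copy of `U_q(ŝl_{n+1})` acts as the scalar `q ^ k` and the canonical central
element `K_δ^+` of the second (vertical) copy of `U_q'(ŝl_{n+1})` acts as the scalar `q ^ l`. -/
def HasLevel {B : Type*} [Semiring B] [Algebra K B] (ρ : phi q κ n M →ₐ[K] B) (k l : ℤ) : Prop :=
  ρ (phiC q κ M ^ 2) = algebraMap K B (q ^ k) ∧ ρ (phiKDelta q κ M) = algebraMap K B (q ^ l)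

end

end QTor

/-! ### The Fock space

`L` is the ground field, `s` and `t` are the square roots of `q` and `κ`. -/

/-- The Fock space `S_n v₀`: the free module of rank one over the commutative algebra `S_n^-`, i.e.
the polynomial algebra in the variables `X (i, k) = H_{i,-k}`, with vacuum `v₀ = 1`. -/
abbrev Fock (n : ℕ) (L : Type*) [Field L] : Type _ := MvPolynomial (Fin (n + 1) × ℕ+) L

/-- The degree `k_1 + ⋯ + k_N` of the monomial `H_{i_1,-k_1} ⋯ H_{i_N,-k_N} v₀`. -/
def fockDeg {n : ℕ} (μ : (Fin (n + 1) × ℕ+) →₀ ℕ) : ℕ := μ.sum fun x e => e * (x.2 : ℕ)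

/-- The action of `H_{i,l}` on the Fock space: `H_{i,-k}` is the multiplication by the variable
`X (i, k)`, and `H_{i,k}` is the derivation that kills `v₀` and sends `X (j, r)` to
`[H_{i,k}, H_{j,-r}] = δ_{k,r} (1/k) [k ⟨h_i, α_j⟩] [k] κ ^ (-k m_{ij})`, for `k > 0`.
(There is no `H_{i,0}`, and the value at `l = 0` is not used.) -/
def fockH {n : ℕ} {L : Type*} [Field L] (q κ : L) (M : Matrix (Fin (n + 1)) (Fin (n + 1)) ℤ)
    (i : Fin (n + 1)) (l : ℤ) : Module.End L (Fock n L) :=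
  if hp : 0 < l then
    ∑ j, ((l : L)⁻¹ * qInt q (l * affCartan n i j) * qInt q l * κ ^ (-l * M i j)) •
      ((MvPolynomial.pderiv (R := L) (j, (⟨l.toNat, by omega⟩ : ℕ+))).toLinearMap)
  else if hm : l < 0 then
    LinearMap.mulLeft L (MvPolynomial.X (i, (⟨(-l).toNat, by omega⟩ : ℕ+)))
  else 0

section Finiteness

variable {n : ℕ} {L : Type*} [Field L]

/-- The polynomials all of whose monomials have degree less than `d`. -/
def fockBelow (n : ℕ) (L : Type*) [Field L] (d : ℕ) : Submodule L (Fock n L) :=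
  MvPolynomial.restrictSupport L {μ | fockDeg μ < d}

theorem fockBelow_zero : fockBelow n L 0 = ⊥ := by
  rw [eq_bot_iff]
  intro v hv
  rw [fockBelow, MvPolynomial.mem_restrictSupport_iff] at hv
  rw [Submodule.mem_bot, ← MvPolynomial.support_eq_empty, Finset.eq_empty_iff_forall_notMem]
  intro μ hμ
  exact absurd (hv hμ) (Nat.not_lt_zero _)

theorem exists_mem_fockBelow (v : Fock n L) : ∃ d, v ∈ fockBelow n L d := by
  refine ⟨v.support.sup fockDeg + 1, ?_⟩
  rw [fockBelow, MvPolynomial.mem_restrictSupport_iff]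
  intro μ hμ
  exact Nat.lt_succ_of_le (Finset.le_sup (f := fockDeg) hμ)

theorem pderiv_mem_fockBelow (x : Fin (n + 1) × ℕ+) (d : ℕ) (v : Fock n L)
    (hv : v ∈ fockBelow n L d) :
    MvPolynomial.pderiv x v ∈ fockBelow n L (d - x.2) := by
  classical
  rw [fockBelow, MvPolynomial.mem_restrictSupport_iff] at hv
  rw [v.as_sum, map_sum]
  refine Submodule.sum_mem _ fun μ hμ => ?_
  rw [MvPolynomial.pderiv_monomial]
  by_cases h0 : μ x = 0
  · simp [h0]
  · rw [fockBelow, MvPolynomial.mem_restrictSupport_iff]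
    intro ν hν
    have hν' := MvPolynomial.support_monomial_subset hν
    rw [Finset.mem_singleton] at hν'
    have h1 : fockDeg μ < d := hv hμ
    have h2 : fockDeg μ = fockDeg ν + x.2 := by
      have h3 : μ = ν + Finsupp.single x 1 := by
        rw [hν']
        ext y
        by_cases hy : y = x
        · subst hy; simp; omega
        · simp [Ne.symm hy]
      rw [h3]
      unfold fockDeg
      rw [Finsupp.sum_add_index' (by simp) (by intros; ring)]
      simp
    show fockDeg ν < d - x.2
    omega

/-- An operator that lowers the degree by at least `b`. -/
def FockLowers (b : ℕ) (T : Module.End L (Fock n L)) : Prop :=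
  ∀ d, ∀ v ∈ fockBelow n L d, T v ∈ fockBelow n L (d - b)

theorem fockLowers_sum {ι : Type*} (b : ℕ) (u : Finset ι) (T : ι → Module.End L (Fock n L))
    (h : ∀ x ∈ u, FockLowers b (T x)) : FockLowers b (∑ x ∈ u, T x) := by
  intro d v hv
  rw [LinearMap.sum_apply]
  exact Submodule.sum_mem _ fun x hx => h x hx d v hv

theorem fockLowers_smul (b : ℕ) (c : L) (T : Module.End L (Fock n L)) (h : FockLowers b T) :
    FockLowers b (c • T) := fun d v hv => Submodule.smul_mem _ c (h d v hv)

theorem fockLowers_mul (b c : ℕ) (S T : Module.End L (Fock n L)) (hS : FockLowers b S)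
    (hT : FockLowers c T) : FockLowers (b + c) (S * T) := by
  intro d v hv
  have := hS _ _ (hT d v hv)
  rwa [Nat.sub_sub, Nat.add_comm c b] at this

theorem fockLowers_fockH (q κ : L) (M : Matrix (Fin (n + 1)) (Fin (n + 1)) ℤ)
    (i : Fin (n + 1)) (k : ℕ) (hk : k ≠ 0) : FockLowers k (fockH q κ M i k) := by
  have hp : (0 : ℤ) < k := by omega
  unfold fockH
  rw [dif_pos hp]
  refine fockLowers_sum _ _ _ fun j _ => fockLowers_smul _ _ _ ?_
  intro d v hv
  exact pderiv_mem_fockBelow _ d v hv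

theorem fockLowers_expCoeff (x : ℕ → Module.End L (Fock n L))
    (hx : ∀ k, k ≠ 0 → FockLowers k (x k)) (b : ℕ) : FockLowers b (expCoeff L x b) := by
  refine fockLowers_sum _ _ _ fun N hN => fockLowers_smul _ _ _ ?_
  clear hN
  induction N generalizing b with
  | zero =>
    rw [pow_zero, PowerSeries.coeff_one]
    split_ifs with hb
    · subst hb; intro d v hv; simpa using hv
    · intro d v hv; simp
  | succ N ih =>
    rw [pow_succ, PowerSeries.coeff_mul]
    refine fockLowers_sum _ _ _ fun y hy => ?_
    rw [← Finset.HasAntidiagonal.mem_antidiagonal.mp hy]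
    refine fockLowers_mul _ _ _ _ (ih _) ?_
    rw [PowerSeries.coeff_mk]
    split_ifs with h0
    · intro d v hv; simp
    · exact hx _ h0

/-- A sequence of operators of which only finitely many are nonzero on any given vector. -/
def LocallyFinite0 (an : ℕ → Module.End L (Fock n L)) : Prop :=
  ∀ v, {b | an b v ≠ 0}.Finite

theorem locallyFinite0_expCoeff (x : ℕ → Module.End L (Fock n L))
    (hx : ∀ k, k ≠ 0 → FockLowers k (x k)) : LocallyFinite0 (expCoeff L x) := by
  intro v
  obtain ⟨d, hd⟩ := exists_mem_fockBelow v
  refine (Set.finite_lt_nat d).subset fun b hb => ?_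
  by_contra hlt
  apply hb
  have := fockLowers_expCoeff x hx b d v hd
  rw [Nat.sub_eq_zero_of_le (not_lt.mp hlt), fockBelow_zero] at this
  exact (Submodule.mem_bot L).mp this

end Finiteness

/-- The coefficient of `z ^ N` in `(∑_a cr_a z ^ a) (∑_b an_b z ^ (-b))`, i.e. the sum of
`cr_a an_b` over all `a, b ≥ 0` with `a - b = N`. Applied to a vector the sum is finite. -/
def fieldCoeff {n : ℕ} {L : Type*} [Field L] (cr an : ℕ → Module.End L (Fock n L))
    (han : LocallyFinite0 an) (N : ℤ) : Module.End L (Fock n L) where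
  toFun v := ∑ᶠ b : ℕ, if 0 ≤ N + b then cr (N + b).toNat (an b v) else 0
  map_add' v w := by
    have h : ∀ u, (Function.support fun b : ℕ =>
        if 0 ≤ N + (b : ℤ) then cr (N + b).toNat (an b u) else 0).Finite := fun u =>
      (han u).subset fun b hb hb0 => hb (by simp [hb0])
    rw [← finsum_add_distrib (h v) (h w)]
    congr 1
    ext1 b
    split_ifs <;> simp
  map_smul' c v := by
    rw [RingHom.id_apply, smul_finsum]
    congr 1
    ext1 b
    split_ifs <;> simp

/-- The coefficient of `z ^ N` in
`exp (∑_{k ≥ 1} H_{i,-k} / [k] (q^{-1/2} z)^k) exp (-∑_{k ≥ 1} H_{i,k} / [k] (q^{1/2} z)^{-k})`,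
where `q^{1/2} = s`, `κ^{1/2} = t`. -/
def fockE {n : ℕ} {L : Type*} [Field L] (s t : L) (M : Matrix (Fin (n + 1)) (Fin (n + 1)) ℤ)
    (i : Fin (n + 1)) (N : ℤ) : Module.End L (Fock n L) :=
  fieldCoeff
    (expCoeff L fun k => ((s⁻¹) ^ k / qInt (s ^ 2) k) • fockH (s ^ 2) (t ^ 2) M i (-(k : ℤ)))
    (expCoeff L fun k => (-((s⁻¹) ^ k / qInt (s ^ 2) k)) • fockH (s ^ 2) (t ^ 2) M i (k : ℤ))
    (locallyFinite0_expCoeff _ fun k hk =>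
      fockLowers_smul _ _ _ (fockLowers_fockH _ _ M i k hk)) N

/-- The coefficient of `z ^ N` in
`exp (-∑_{k ≥ 1} H_{i,-k} / [k] (q^{1/2} z)^k) exp (∑_{k ≥ 1} H_{i,k} / [k] (q^{-1/2} z)^{-k})`,
where `q^{1/2} = s`, `κ^{1/2} = t`. -/
def fockF {n : ℕ} {L : Type*} [Field L] (s t : L) (M : Matrix (Fin (n + 1)) (Fin (n + 1)) ℤ)
    (i : Fin (n + 1)) (N : ℤ) : Module.End L (Fock n L) :=
  fieldCoeff
    (expCoeff L fun k => (-(s ^ k / qInt (s ^ 2) k)) • fockH (s ^ 2) (t ^ 2) M i (-(k : ℤ)))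
    (expCoeff L fun k => (s ^ k / qInt (s ^ 2) k) • fockH (s ^ 2) (t ^ 2) M i (k : ℤ))
    (locallyFinite0_expCoeff _ fun k hk =>
      fockLowers_smul _ _ _ (fockLowers_fockH _ _ M i k hk)) N

/-! ### The twisted group algebra

The weight lattice of `sl_{n+1}` has the basis `ᾱ_2, …, ᾱ_n, Λ̄_n`; coordinates with respect to it
are functions on `Fin n`, where `k` with `k + 1 < n` belongs to `ᾱ_{k+2}` and `k = n - 1` to `Λ̄_n`.
The root lattice has the basis `ᾱ_1, …, ᾱ_n`; its elements are functions `m` on `Fin n`, where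
`m j` is the coefficient of `ᾱ_{j+1}`. -/

/-- The exponent of `-1` that arises from the commutation of the generators of the twisted group
algebra with positions `i < j` : `⟨h̄_{i+2}, ᾱ_{j+2}⟩`, or `δ_{i+2,n}` if position `j` belongs
to `Λ̄_n`. -/
def twistExp (n : ℕ) (i j : Fin n) : ℤ :=
  if (j : ℕ) + 1 = n then (if (i : ℕ) + 2 = n then 1 else 0)
  else if (j : ℕ) = i + 1 then -1 else 0

/-- The sign `ε(β, γ)` in `e^β e^γ = ε(β, γ) e^{β+γ}`, where `e^β` is the ordered monomial
`(e^{ᾱ_2})^{β_2} ⋯ (e^{ᾱ_n})^{β_n} (e^{Λ̄_n})^{β_{n+1}}` : to order the product one moves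
the power `γ_i` of each generator to the left past the powers `β_j`, `j > i`. -/
def twistSign {n : ℕ} (L : Type*) [Field L] (β γ : Fin n → ℤ) : L :=
  ∏ i, ∏ j, if i < j then (-1 : L) ^ (twistExp n i j * β j * γ i) else 1

/-- The coordinates of `ᾱ_{j+1}`; note `ᾱ_1 = -2 ᾱ_2 - 3 ᾱ_3 - ⋯ - n ᾱ_n + (n + 1) Λ̄_n`. -/
def rootCoord (n : ℕ) (j k : Fin n) : ℤ :=
  if (j : ℕ) = 0 then (if (k : ℕ) + 1 = n then (n : ℤ) + 1 else -((k : ℤ) + 2))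
  else if (j : ℕ) = k + 1 then 1 else 0

/-- The coordinates of `Λ̄_p`: `Λ̄_0 = 0` and
`Λ̄_p = -ᾱ_{p+1} - 2 ᾱ_{p+2} - ⋯ - (n - p) ᾱ_n + (n - p + 1) Λ̄_n` for `1 ≤ p ≤ n`. -/
def fundCoord (n : ℕ) (p : Fin (n + 1)) (k : Fin n) : ℤ :=
  if p = 0 then 0
  else if (k : ℕ) + 1 = n then (n : ℤ) - (p : ℤ) + 1
  else -(max ((k : ℤ) + 2 - (p : ℤ)) 0)

/-- The coordinates of the element `∑_j m_j ᾱ_j` of the root lattice. -/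
def latCoord {n : ℕ} (m : Fin n → ℤ) : Fin n → ℤ := fun k => ∑ j, m j * rootCoord n j k

/-- The elements `ᾱ_0 = -(ᾱ_1 + ⋯ + ᾱ_n)`, `ᾱ_1, …, ᾱ_n` of the root lattice. -/
def rootBar {n : ℕ} (i : Fin (n + 1)) : Fin n → ℤ :=
  Fin.cases (fun _ => -1) (fun j => Pi.single j 1) i

/-- The integer `⟨h̄_i, β⟩`, `0 ≤ i ≤ n`, for `β = ∑_j m_j ᾱ_j + Λ̄_p`; here
`⟨h̄_i, ᾱ_j⟩ = ⟨h_i, α_j⟩` and `⟨h̄_i, Λ̄_p⟩ = ⟨h_i, Λ_p - Λ_0⟩ = δ_{ip} - δ_{i0}`. -/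
def latPair {n : ℕ} (p i : Fin (n + 1)) (m : Fin n → ℤ) : ℤ :=
  ∑ j : Fin n, affCartan n i j.succ * m j + ((if i = p then 1 else 0) - (if i = 0 then 1 else 0))

/-- The integer `∑_{j=1}^n ⟨h̄_i, m_j ᾱ_j⟩ m_{ij}`. -/
def latTwist {n : ℕ} (M : Matrix (Fin (n + 1)) (Fin (n + 1)) ℤ) (i : Fin (n + 1))
    (m : Fin n → ℤ) : ℤ :=
  ∑ j : Fin n, affCartan n i j.succ * m j * M i j.succ

/-- The integer `(β|β)/2 - (Λ̄_p|Λ̄_p)/2 = (α|α)/2 + (α|Λ̄_p)` for `β = α + Λ̄_p` and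
`α = ∑_j m_j ᾱ_j`; here `(α|α)/2 = ∑_j m_j ^ 2 + ∑_{i<j} (ᾱ_i|ᾱ_j) m_i m_j` and `(α|Λ̄_p) = m_p`,
which is `0` for `p = 0`. -/
def latEnergy {n : ℕ} (p : Fin (n + 1)) (m : Fin n → ℤ) : ℤ :=
  (∑ j, m j ^ 2 + ∑ i : Fin n, ∑ j : Fin n,
      if i < j then affCartan n i.succ j.succ * m i * m j else 0)
    + ∑ j : Fin n, if j.succ = p then m j else 0

/-! ### The space `W(p)_n` and its operators -/

/-- The space `W(p)_n`, the tensor product of the Fock space and the span of the `e^β` with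
`β ∈ Q̄ + Λ̄_p`. The vector `v ⊗ e^β`, `β = ∑_j m_j ᾱ_j + Λ̄_p`, is `Finsupp.single m v`. -/
abbrev WSpace (n : ℕ) (_p : Fin (n + 1)) (L : Type*) [Field L] : Type _ :=
  (Fin n → ℤ) →₀ Fock n L

section Operators

variable {n : ℕ} {L : Type*} [Field L] (p : Fin (n + 1))

/-- The operator `v ⊗ e^β ↦ (T v) ⊗ e^β`. -/
def wFock (T : Module.End L (Fock n L)) : Module.End L (WSpace n p L) :=
  Finsupp.lsum L fun m => Finsupp.lsingle m ∘ₗ T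

/-- The operator `e^α`, `v ⊗ e^β ↦ v ⊗ e^α e^β`, for `α` in the root lattice. -/
def wExp (α : Fin n → ℤ) : Module.End L (WSpace n p L) :=
  Finsupp.lsum L fun m =>
    twistSign L (latCoord α) (latCoord m + fundCoord n p) • Finsupp.lsingle (α + m)

/-- The inverse `v ⊗ e^β ↦ v ⊗ (e^α)⁻¹ e^β` of the operator `e^α`. -/
def wExpInv (α : Fin n → ℤ) : Module.End L (WSpace n p L) :=
  Finsupp.lsum L fun m =>
    (twistSign L (latCoord α) (latCoord (m - α) + fundCoord n p))⁻¹ • Finsupp.lsingle (m - α)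

theorem twistSign_ne_zero (β γ : Fin n → ℤ) : twistSign L β γ ≠ 0 := by
  unfold twistSign
  refine Finset.prod_ne_zero_iff.mpr fun i _ => Finset.prod_ne_zero_iff.mpr fun j _ => ?_
  split_ifs
  · exact zpow_ne_zero _ (by simp)
  · exact one_ne_zero

theorem wExp_mul_wExpInv (α : Fin n → ℤ) :
    wExp p α * wExpInv p α = (1 : Module.End L (WSpace n p L)) := by
  refine Finsupp.lhom_ext fun m v => ?_
  simp [wExp, wExpInv, smul_smul, twistSign_ne_zero]

theorem wExpInv_mul_wExp (α : Fin n → ℤ) :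
    wExpInv p α * wExp p α = (1 : Module.End L (WSpace n p L)) := by
  refine Finsupp.lhom_ext fun m v => ?_
  simp [wExp, wExpInv, smul_smul, twistSign_ne_zero]

variable (s t : L) (M : Matrix (Fin (n + 1)) (Fin (n + 1)) ℤ)

/-- The operator `H_{i,l}`. -/
def wH (i : Fin (n + 1)) (l : ℤ) : Module.End L (WSpace n p L) :=
  wFock p (fockH (s ^ 2) (t ^ 2) M i l)

/-- The operator `q^{r ∂_{ᾱ_i}}`, `v ⊗ e^β ↦ q ^ (r ⟨h̄_i, β⟩) v ⊗ e^β`. -/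
def wQPartial (i : Fin (n + 1)) (r : ℤ) : Module.End L (WSpace n p L) :=
  Finsupp.lsum L fun m => ((s ^ 2) ^ (r * latPair p i m)) • Finsupp.lsingle m

/-- The operator `q^d` : on `H_{i_1,-k_1} ⋯ H_{i_N,-k_N} v₀ ⊗ e^β` it is the scalar `q` to the power
`-(k_1 + ⋯ + k_N) - (β|β)/2 + (Λ̄_p|Λ̄_p)/2`. -/
def wQD : Module.End L (WSpace n p L) :=
  Finsupp.lsum L fun m => Finsupp.lsingle m ∘ₗ
    (MvPolynomial.basisMonomials (Fin (n + 1) × ℕ+) L).constr L fun μ =>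
      (s ^ 2) ^ (-(fockDeg μ : ℤ) - latEnergy p m) • MvPolynomial.monomial μ (1 : L)

/-- The coefficient of `z ^ (-k)` in
`exp (∑_{k ≥ 1} H_{i,-k} / [k] (q^{-1/2} z)^k) exp (-∑_{k ≥ 1} H_{i,k} / [k] (q^{1/2} z)^{-k})
e^{ᾱ_i} z^{H_{i,0} + 1}`, where
`z^{H_{i,0}} (v ⊗ e^β) = z^{⟨h̄_i, β⟩} κ^{1/2 ∑_j ⟨h̄_i, m_j ᾱ_j⟩ m_{ij}} v ⊗ e^β`. -/
def wE (i : Fin (n + 1)) (k : ℤ) : Module.End L (WSpace n p L) :=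
  wExp p (rootBar i) * Finsupp.lsum L fun m =>
    (t ^ latTwist M i m) • (Finsupp.lsingle m ∘ₗ fockE s t M i (-k - (latPair p i m + 1)))

/-- The coefficient of `z ^ (-k)` in
`exp (-∑_{k ≥ 1} H_{i,-k} / [k] (q^{1/2} z)^k) exp (∑_{k ≥ 1} H_{i,k} / [k] (q^{-1/2} z)^{-k})
(e^{ᾱ_i})⁻¹ z^{-H_{i,0} + 1}`. -/
def wF (i : Fin (n + 1)) (k : ℤ) : Module.End L (WSpace n p L) :=
  wExpInv p (rootBar i) * Finsupp.lsum L fun m =>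
    (t ^ (-latTwist M i m)) • (Finsupp.lsingle m ∘ₗ fockF s t M i (-k - (-latPair p i m + 1)))

/-- The coefficient of `z ^ (-k)` in `exp ((q - q⁻¹) ∑_{k ≥ 1} H_{i,k} z^{-k}) q^{∂_{ᾱ_i}}`. -/
def wKPlus (i : Fin (n + 1)) (k : ℤ) : Module.End L (WSpace n p L) :=
  if 0 ≤ k then
    expCoeff L (fun r => (s ^ 2 - (s ^ 2)⁻¹) • wH p s t M i (r : ℤ)) k.toNat * wQPartial p s i 1
  else 0

/-- The coefficient of `z ^ (-k)` in `exp (-(q - q⁻¹) ∑_{k ≥ 1} H_{i,-k} z^k) q^{-∂_{ᾱ_i}}`. -/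
def wKMinus (i : Fin (n + 1)) (k : ℤ) : Module.End L (WSpace n p L) :=
  if k ≤ 0 then
    expCoeff L (fun r => (-(s ^ 2 - (s ^ 2)⁻¹)) • wH p s t M i (-(r : ℤ))) (-k).toNat
      * wQPartial p s i (-1)
  else 0

end Operators

/-- The prescription for the action of `phi` on `W(p)_n`: `q^{c/2}` acts as `q^{1/2}`, `q^{d₁}` as
`q^d`, and the currents `E_i(z)`, `F_i(z)`, `K_i^±(z)` (hence the `H_{i,l}` in `K_i^±(z)`)
as the vertex operators above. -/
structure IsVertexAction {K L : Type*} [Field K] [Field L] [Algebra K L] (q κ : K) {n : ℕ}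
    (M : Matrix (Fin (n + 1)) (Fin (n + 1)) ℤ) (p : Fin (n + 1)) (s t : L)
    (ρ : QTor.phi q κ n M →ₐ[K] Module.End L (WSpace n p L)) : Prop where
  map_c : ρ (QTor.phiC q κ M) = s • 1
  map_d1 : ρ (QTor.phiD1 q κ M) = wQD p s
  map_e : ∀ i k, ρ (QTor.phiE q κ M i k) = wE p s t M i k
  map_f : ∀ i k, ρ (QTor.phiF q κ M i k) = wF p s t M i k
  map_kPlus : ∀ i k, ρ (QTor.phiKPlus q κ M i k) = wKPlus p s t M i k
  map_kMinus : ∀ i k, ρ (QTor.phiKMinus q κ M i k) = wKMinus p s t M i k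
  map_h : ∀ i l (hl : l ≠ 0), ρ (QTor.phiH q κ M i l hl) = wH p s t M i l

end

/-! ### The Euler operator on power series over a noncommutative ring -/

noncomputable section

/-! The currents are Frenkel–Jing vertex operators twisted by κ, and the heart of the matter is
Wick's theorem. Moving the annihilation part of one exponential past the creation part of another
costs a scalar power series in the ratio u of the two variables. So a product of vertex operators is
this contraction series times a normally ordered product that does not depend on the order of the
factors (`expCoeff_mul_expCoeff`, `VertexFamily.op_op`).

The contraction exponent contains [k a_ij]/[k], which is 0, -1 or q^k + q^(-k), so the contraction
is rational in u. For two currents of the same type it is 1, (1 - ρu)⁻¹ or (1 - u)(1 - q^(∓2)u); for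
currents of opposite type it is 1, 1 - ρu or ((1 - qu)(1 - q⁻¹u))⁻¹. The relations between currents
thereby become identities of expansions at u = 0 and u = ∞. The quadratic relations multiply both
orderings to a common coefficient of the normally ordered product. In [E_i, F_i] the two expansions
of one rational function differ by delta functions at u = q^(±1), on which the normally ordered
product collapses to K_i^± (`op_commutator_self`). In the Serre relation the three orderings add up
to an antisymmetric kernel, which symmetrization kills (`VertexFamily.serre_kernel`).

The lattice factor supplies the remaining constants: e^(ᾱ_i) e^(ᾱ_j) = (-1)^(a_ij) e^(ᾱ_j) e^(ᾱ_i),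
also for the node 0 (`rootSign_mul_rootSign`), while z^(H_{i,0}) shifts modes by ±a_ij and
contributes powers of κ^(m_ij/2). The inputs are that the rows of A and M sum to zero and that a_ij
m_ij = -m_ij, which uses n > 1.

The algebra without q^(±d₂) is a subalgebra of the presented algebra and carries no presentation of
its own, so checking relations on W(p)_n does not by itself define an action. Instead the full
algebra acts on W(p)_n with a Laurent variable adjoined; q^(d₂) acts through the degree in that
variable (`torLift_rel`). The subalgebra respects the specialization of the variable to 1, and its
action descends (`gradedSum_torGradedRep`). Uniqueness holds because the prescription fixes every
generator of the subalgebra. Level zero in the second direction is the identity ∑_i ⟨h̄_i, β⟩ = 0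
(`sum_latPair`). -/

open PowerSeries in
/-- The Euler operator `X d/dX` on power series over a possibly noncommutative ring. -/
def euler {A : Type*} [Ring A] (f : PowerSeries A) : PowerSeries A :=
  PowerSeries.mk fun m => m • PowerSeries.coeff m f

/-- The exponent `∑_{k ≥ 1} x_k Z ^ k`. -/
def posSeries {A : Type*} [Ring A] (x : ℕ → A) : PowerSeries A :=
  PowerSeries.mk fun k => if k = 0 then 0 else x k

section Euler

open PowerSeries

variable {A : Type*} [Ring A]

theorem coeff_euler (f : PowerSeries A) (m : ℕ) : coeff m (euler f) = m • coeff m f := by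
  simp [euler]

theorem coeff_posSeries (x : ℕ → A) (k : ℕ) :
    coeff k (posSeries x) = if k = 0 then 0 else x k := by
  simp [posSeries]

theorem euler_mul (f g : PowerSeries A) : euler (f * g) = euler f * g + f * euler g := by
  ext m
  rw [coeff_euler, map_add, coeff_mul, coeff_mul, coeff_mul, Finset.smul_sum,
    ← Finset.sum_add_distrib]
  refine Finset.sum_congr rfl fun y hy => ?_
  rw [← Finset.HasAntidiagonal.mem_antidiagonal.mp hy, coeff_euler, coeff_euler, add_smul, smul_mul_assoc,
    mul_smul_comm]

theorem euler_sub (f g : PowerSeries A) : euler (f - g) = euler f - euler g := by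
  ext m
  simp [coeff_euler, mul_sub]

theorem euler_add (f g : PowerSeries A) : euler (f + g) = euler f + euler g := by
  ext m
  simp [coeff_euler]

theorem euler_C (a : A) : euler (C a) = 0 := by
  ext m
  rw [coeff_euler, coeff_C]
  split_ifs with h <;> simp [h]

theorem commute_of_coeff {f g : PowerSeries A} (h : ∀ i j, Commute (coeff i f) (coeff j g)) :
    Commute f g := by
  ext m
  rw [coeff_mul, coeff_mul, ← Finset.Nat.sum_antidiagonal_swap]
  exact Finset.sum_congr rfl fun y _ => h y.2 y.1

theorem euler_pow {f : PowerSeries A} (h : Commute (euler f) f) (N : ℕ) :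
    euler (f ^ (N + 1)) = (N + 1) • (euler f * f ^ N) := by
  induction N with
  | zero => simp
  | succ N ih =>
    rw [pow_succ, euler_mul, ih, succ_nsmul (n := N + 1), smul_mul_assoc, mul_assoc, ← pow_succ,
      (h.symm.pow_left (N + 1)).eq]

theorem coeff_posSeries_pow (x : ℕ → A) {m N : ℕ} (h : m < N) :
    coeff m (posSeries x ^ N) = 0 := by
  induction N generalizing m with
  | zero => omega
  | succ N ih =>
    rw [pow_succ, coeff_mul]
    refine Finset.sum_eq_zero fun y hy => ?_
    have := Finset.HasAntidiagonal.mem_antidiagonal.mp hy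
    rcases Nat.eq_zero_or_pos y.2 with h0 | h0
    · rw [h0, coeff_posSeries, if_pos rfl, mul_zero]
    · rw [ih (by omega), zero_mul]

theorem commute_euler {f g : PowerSeries A} (h : ∀ i j, Commute (coeff i f) (coeff j g)) :
    Commute (euler f) g := by
  refine commute_of_coeff fun i j => ?_
  rw [coeff_euler]
  exact (h i j).smul_left i

theorem commute_coeff_posSeries {x y : ℕ → A} (h : ∀ i j, Commute (x i) (y j)) (i j : ℕ) :
    Commute (coeff i (posSeries x)) (coeff j (posSeries y)) := by
  rw [coeff_posSeries, coeff_posSeries]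
  split_ifs
  exacts [Commute.zero_left _, Commute.zero_left _, Commute.zero_right _, h i j]

end Euler

/-! ### Exponential series and the differential equation that characterizes them -/

section ExpCoeff

open PowerSeries

variable (K : Type*) {A : Type*} [Field K] [Ring A] [Algebra K A]

/-- The series `exp (∑_{k ≥ 1} x_k Z ^ k)`. -/
def expSeries (x : ℕ → A) : PowerSeries A := PowerSeries.mk (expCoeff K x)

theorem coeff_expSeries (x : ℕ → A) (m : ℕ) : coeff m (expSeries K x) = expCoeff K x m := by
  simp [expSeries]

/-- The exponent has no constant term, so higher powers do not reach degree m and every truncation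
beyond m gives the same value. This permits a common truncation for all coefficients. -/
theorem expCoeff_eq_sum (x : ℕ → A) {m B : ℕ} (h : m < B) :
    expCoeff K x m =
      ∑ N ∈ Finset.range B, ((N.factorial : K)⁻¹) • coeff m (posSeries x ^ N) := by
  unfold expCoeff
  refine Finset.sum_subset (Finset.range_mono h) fun N _ hN => ?_
  rw [Finset.mem_range, not_lt] at hN
  have := coeff_posSeries_pow x (show m < N by omega)
  unfold posSeries at this
  rw [this, smul_zero]

theorem expCoeff_zero (x : ℕ → A) : expCoeff K x 0 = 1 := by
  simp [expCoeff]

theorem commute_expCoeff_right {a : A} {x : ℕ → A} (h : ∀ k, Commute a (x k)) (m : ℕ) :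
    Commute a (expCoeff K x m) := by
  refine Commute.sum_right _ _ _ fun N _ => Commute.smul_right ?_ _
  have hs : Commute (C a) (posSeries x) := by
    refine commute_of_coeff fun i j => ?_
    rw [coeff_C, coeff_posSeries]
    split_ifs
    exacts [Commute.zero_right _, h j, Commute.zero_left _, Commute.zero_left _]
  have := congrArg (coeff m) (hs.pow_right N).eq
  rwa [coeff_C_mul, coeff_mul_C] at this

theorem commute_expCoeff {x y : ℕ → A} (h : ∀ i j, Commute (x i) (y j)) (i j : ℕ) :
    Commute (expCoeff K x i) (expCoeff K y j) :=
  (commute_expCoeff_right K (fun k => ((commute_expCoeff_right K (fun l => (h l k).symm) i)).symm)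
    j)

theorem map_expCoeff {B : Type*} [Ring B] [Algebra K B] (f : A →ₐ[K] B) (x : ℕ → A) (m : ℕ) :
    f (expCoeff K x m) = expCoeff K (fun k => f (x k)) m := by
  unfold expCoeff
  rw [map_sum]
  refine Finset.sum_congr rfl fun N _ => ?_
  rw [map_smul]
  congr 1
  have h : (PowerSeries.mk fun k => if k = 0 then 0 else f (x k)) =
      PowerSeries.map (f : A →+* B) (PowerSeries.mk fun k => if k = 0 then 0 else x k) := by
    ext k
    simp only [coeff_mk, coeff_map]
    split_ifs <;> simp
  rw [h, ← map_pow, coeff_map]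
  rfl

/-- Since the x_k commute, the derivative of x^(N+1)/(N+1)! is x' x^N/N!. This equation replaces
manipulations of double sums in all later identities for exponentials. -/
theorem euler_expSeries [CharZero K] {x : ℕ → A} (hx : ∀ i j, Commute (x i) (x j)) :
    euler (expSeries K x) = euler (posSeries x) * expSeries K x := by
  ext m
  have hc : Commute (euler (posSeries x)) (posSeries x) :=
    commute_euler (commute_coeff_posSeries hx)
  rw [coeff_euler, coeff_expSeries, expCoeff_eq_sum K x (Nat.lt_succ_self m),
    Finset.sum_range_succ', smul_add, Finset.smul_sum, coeff_mul]
  have h0 : m • ((Nat.factorial 0 : K)⁻¹ • coeff m (posSeries x ^ 0)) = 0 := by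
    rw [pow_zero, coeff_one]
    split_ifs with h <;> simp [h]
  rw [h0, add_zero]
  have h1 : ∀ N ∈ Finset.range m,
      m • (((N + 1).factorial : K)⁻¹ • coeff m (posSeries x ^ (N + 1)))
        = ((N.factorial : K)⁻¹) • coeff m (euler (posSeries x) * posSeries x ^ N) := by
    intro N _
    rw [smul_comm, ← coeff_euler, euler_pow hc, map_nsmul, ← Nat.cast_smul_eq_nsmul K, smul_smul,
      Nat.factorial_succ]
    congr 1
    have : ((N + 1 : ℕ) : K) ≠ 0 := Nat.cast_ne_zero.mpr (Nat.succ_ne_zero N)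
    rw [Nat.cast_mul, mul_inv, mul_right_comm, inv_mul_cancel₀ this, one_mul]
  rw [Finset.sum_congr rfl h1]
  simp_rw [coeff_mul, Finset.smul_sum]
  rw [Finset.sum_comm]
  refine Finset.sum_congr rfl fun y hy => ?_
  have hy' := Finset.HasAntidiagonal.mem_antidiagonal.mp hy
  rcases Nat.eq_zero_or_pos y.1 with h | h
  · simp [h, coeff_euler]
  · rw [coeff_expSeries, expCoeff_eq_sum K x (show y.2 < m by omega), Finset.mul_sum]
    exact Finset.sum_congr rfl fun N _ => (mul_smul_comm _ _ _).symm

/-- As Y has no constant term, the coefficient of degree m reads m F_m = ∑_{k ≥ 1} Y_k F_{m-k}; in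
characteristic zero it determines F_m from the lower coefficients. -/
theorem eq_zero_of_euler (K : Type*) {A : Type*} [Field K] [Ring A] [Algebra K A] [CharZero K]
    {F Y : PowerSeries A} (hF : euler F = Y * F) (hY : coeff 0 Y = 0)
    (h0 : coeff 0 F = 0) : F = 0 := by
  ext m
  induction m using Nat.strong_induction_on with
  | _ m ih =>
    rcases Nat.eq_zero_or_pos m with h | h
    · rw [h, h0, map_zero]
    · have h1 := congrArg (coeff m) hF
      rw [coeff_euler, coeff_mul, Finset.sum_eq_zero, ← Nat.cast_smul_eq_nsmul K] at h1
      · have hm : (m : K) ≠ 0 := by exact_mod_cast h.ne'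
        rw [← one_smul K (coeff m F), ← inv_mul_cancel₀ hm, mul_smul, h1, smul_zero, map_zero]
      · intro y hy
        have hy' := Finset.HasAntidiagonal.mem_antidiagonal.mp hy
        rcases Nat.eq_zero_or_pos y.1 with h2 | h2
        · rw [h2, hY, zero_mul]
        · rw [ih y.2 (by omega), map_zero, mul_zero]

theorem coeff_zero_euler (f : PowerSeries A) : coeff 0 (euler f) = 0 := by
  simp [coeff_euler]

theorem eq_of_euler (K : Type*) {A : Type*} [Field K] [Ring A] [Algebra K A] [CharZero K]
    {F G Y : PowerSeries A} (hF : euler F = Y * F) (hG : euler G = Y * G)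
    (hY : coeff 0 Y = 0) (h0 : coeff 0 F = coeff 0 G) : F = G := by
  rw [← sub_eq_zero]
  refine eq_zero_of_euler K (Y := Y) ?_ hY ?_
  · rw [euler_sub, hF, hG, mul_sub]
  · rw [map_sub, h0, sub_self]

theorem eq_expSeries [CharZero K] {F : PowerSeries A} {x : ℕ → A} (hx : ∀ i j, Commute (x i) (x j))
    (hF : euler F = euler (posSeries x) * F) (h0 : coeff 0 F = 1) : F = expSeries K x :=
  eq_of_euler K hF (euler_expSeries K hx) (coeff_zero_euler _)
    (by rw [h0, coeff_expSeries, expCoeff_zero])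

/-- Both sides solve the same Euler equation with constant term 1; the three commutation hypotheses
are what the Leibniz rule needs to collect the factors. -/
theorem expSeries_add [CharZero K] {x y : ℕ → A} (hx : ∀ i j, Commute (x i) (x j))
    (hy : ∀ i j, Commute (y i) (y j)) (hxy : ∀ i j, Commute (x i) (y j)) :
    expSeries K x * expSeries K y = expSeries K (fun k => x k + y k) := by
  refine eq_expSeries K (fun i j => ((hx i j).add_left (hxy j i).symm).add_right
    ((hxy i j).add_left (hy i j))) ?_ ?_
  · have h1 : posSeries (fun k => x k + y k) = posSeries x + posSeries y := by
      ext k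
      simp only [map_add, coeff_posSeries]
      split_ifs <;> simp
    have h2 : Commute (euler (posSeries y)) (expSeries K x) := by
      refine commute_euler fun i j => ?_
      rw [coeff_expSeries]
      refine commute_expCoeff_right K (fun k => ?_) j
      rw [coeff_posSeries]
      split_ifs
      exacts [Commute.zero_left _, (hxy k i).symm]
    rw [euler_mul, euler_expSeries K hx, euler_expSeries K hy, h1, euler_add, add_mul, mul_assoc,
      ← mul_assoc (expSeries K x), ← h2.eq, mul_assoc]
  · simp [coeff_mul, coeff_expSeries, expCoeff_zero]

theorem expCoeff_add [CharZero K] {x y : ℕ → A} (hx : ∀ i j, Commute (x i) (x j))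
    (hy : ∀ i j, Commute (y i) (y j)) (hxy : ∀ i j, Commute (x i) (y j)) (m : ℕ) :
    expCoeff K (fun k => x k + y k) m =
      ∑ z ∈ Finset.HasAntidiagonal.antidiagonal m, expCoeff K x z.1 * expCoeff K y z.2 := by
  rw [← coeff_expSeries, ← expSeries_add K hx hy hxy, coeff_mul]
  simp_rw [coeff_expSeries]

theorem expCoeff_congr {x y : ℕ → A} (h : ∀ k, k ≠ 0 → x k = y k) (m : ℕ) :
    expCoeff K x m = expCoeff K y m := by
  have : (fun k => if k = 0 then 0 else x k) = fun k => if k = 0 then 0 else y k := by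
    funext k
    split_ifs with h0
    exacts [rfl, h _ h0]
  unfold expCoeff
  rw [this]

theorem expCoeff_zero_seq [CharZero K] (m : ℕ) :
    expCoeff K (fun _ => (0 : A)) m = if m = 0 then 1 else 0 := by
  have h : (1 : PowerSeries A) = expSeries K fun _ => (0 : A) := by
    refine eq_expSeries K (fun _ _ => Commute.zero_left _) ?_ (by simp)
    ext k
    simp only [coeff_euler, coeff_mul, coeff_posSeries, coeff_one]
    rw [Finset.sum_eq_zero (by simp)]
    split_ifs with h <;> simp [h]
  rw [← coeff_expSeries, ← h, coeff_one]

/-- If `T` rescales the exponents then it rescales the exponential. -/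
theorem expCoeff_scale {x y : ℕ → A} (T : A) (r : K) (h : ∀ k, k ≠ 0 → T * x k = r ^ k • (y k * T))
    (m : ℕ) : T * expCoeff K x m = r ^ m • (expCoeff K y m * T) := by
  have key : ∀ N m, T * coeff m (posSeries x ^ N) = r ^ m • (coeff m (posSeries y ^ N) * T) := by
    intro N
    induction N with
    | zero =>
      intro m
      rw [pow_zero, pow_zero, coeff_one]
      split_ifs with h <;> simp [h]
    | succ N ih =>
      intro m
      rw [pow_succ, pow_succ, coeff_mul, coeff_mul, Finset.mul_sum, Finset.sum_mul,
        Finset.smul_sum]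
      refine Finset.sum_congr rfl fun z hz => ?_
      rw [← mul_assoc, ih, smul_mul_assoc, mul_assoc, coeff_posSeries, coeff_posSeries]
      split_ifs with h0
      · simp
      · rw [h _ h0, mul_smul_comm, smul_smul, ← pow_add, Finset.HasAntidiagonal.mem_antidiagonal.mp hz, mul_assoc]
  unfold expCoeff
  rw [Finset.mul_sum, Finset.sum_mul, Finset.smul_sum]
  refine Finset.sum_congr rfl fun N _ => ?_
  have := key N m
  unfold posSeries at this
  rw [mul_smul_comm, this, smul_mul_assoc, smul_comm]

theorem expCoeff_pow_smul (x : ℕ → A) (r : K) (m : ℕ) :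
    expCoeff K (fun k => r ^ k • x k) m = r ^ m • expCoeff K x m := by
  have := expCoeff_scale K (x := fun k => r ^ k • x k) (y := x) 1 r (fun k _ => by simp) m
  simpa using this

end ExpCoeff

/-! ### Normal ordering of exponentials of Heisenberg elements -/

section Heisenberg

open PowerSeries

variable (K : Type*) {A : Type*} [Field K] [Ring A] [Algebra K A] [CharZero K]

/-- If `[a, x_k] = c δ_{k,r}` then `[a, exp (∑ x_k Z ^ k)] = c Z ^ r exp (∑ x_k Z ^ k)`. -/
theorem C_mul_expSeries {x : ℕ → A} (hx : ∀ i j, Commute (x i) (x j)) (a : A) (r : ℕ) (hr : r ≠ 0)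
    (c : K) (h : ∀ k, k ≠ 0 → a * x k = x k * a + if k = r then algebraMap K A c else 0) :
    C a * expSeries K x = expSeries K x * C a + c • (X ^ r * expSeries K x) := by
  set G := expSeries K x with hG
  have hE : euler G = euler (posSeries x) * G := euler_expSeries K hx
  have h1 : C a * euler (posSeries x) = euler (posSeries x) * C a + (r : K) • c • X ^ r := by
    ext k
    rw [map_add, coeff_C_mul, coeff_mul_C, coeff_euler, coeff_posSeries, coeff_smul, coeff_smul,
      coeff_X_pow]
    split_ifs with h0 h2 h2
    · omega
    · simp
    · rw [mul_smul_comm, smul_mul_assoc, h k h0, if_pos h2, smul_add, h2, Algebra.algebraMap_eq_smul_one,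
        Nat.cast_smul_eq_nsmul]
    · rw [mul_smul_comm, smul_mul_assoc, h k h0, if_neg h2]
      simp
  have hX : euler (X ^ r : PowerSeries A) = (r : K) • X ^ r := by
    ext k
    rw [coeff_euler, coeff_smul, coeff_X_pow]
    split_ifs with h2
    · rw [h2, Nat.cast_smul_eq_nsmul]
    · simp
  have hXc : ∀ f : PowerSeries A, X ^ r * f = f * X ^ r := fun f => ((commute_X f).pow_right r).eq.symm
  -- The difference of the two sides satisfies the Euler equation of `expSeries K x`, and its
  -- constant term is zero because r ≠ 0.
  rw [← sub_eq_zero]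
  refine eq_zero_of_euler K (Y := euler (posSeries x)) ?_ (coeff_zero_euler _) ?_
  · have hs : ∀ (c : K) (f : PowerSeries A), euler (c • f) = c • euler f := fun c f => by
      ext k
      simp only [coeff_euler, coeff_smul]
      exact smul_comm _ _ _
    rw [euler_sub, euler_add, euler_mul, euler_mul, hs, euler_mul, euler_C, hE, hX, ← mul_assoc, h1]
    simp only [mul_sub, mul_add, zero_mul, mul_zero, add_mul, zero_add, add_zero, mul_assoc,
      smul_mul_assoc, mul_smul_comm, smul_add]
    rw [← mul_assoc (X ^ r) (euler _) G, hXc (euler _), mul_assoc, smul_comm c (r : K)]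
    abel
  · have : constantCoeff G = 1 := by
      rw [← coeff_zero_eq_constantCoeff_apply, hG, coeff_expSeries, expCoeff_zero]
    simp [this, hr, zero_pow]

theorem mul_expCoeff {x : ℕ → A} (hx : ∀ i j, Commute (x i) (x j)) (a : A) (r : ℕ) (hr : r ≠ 0)
    (c : K) (h : ∀ k, k ≠ 0 → a * x k = x k * a + if k = r then algebraMap K A c else 0) (m : ℕ) :
    a * expCoeff K x m = expCoeff K x m * a + if r ≤ m then c • expCoeff K x (m - r) else 0 := by
  have := congrArg (coeff m) (C_mul_expSeries K hx a r hr c h)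
  rw [coeff_C_mul, map_add, coeff_mul_C, coeff_smul, coeff_X_pow_mul', coeff_expSeries,
    coeff_expSeries] at this
  rw [this]
  split_ifs <;> simp

/-- Normal ordering of a product of two exponentials of Heisenberg elements. -/
theorem expCoeff_mul_expCoeff {x d : ℕ → A} {σ : ℕ → K} (hx : ∀ i j, Commute (x i) (x j))
    (hd : ∀ i j, Commute (d i) (d j))
    (h : ∀ k r, k ≠ 0 → r ≠ 0 →
      d k * x r = x r * d k + if r = k then algebraMap K A (σ k) else 0) (b m : ℕ) :
    expCoeff K d b * expCoeff K x m = ∑ z ∈ Finset.HasAntidiagonal.antidiagonal b,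
      if z.1 ≤ m then expCoeff K σ z.1 • (expCoeff K x (m - z.1) * expCoeff K d z.2) else 0 := by
  set G := expSeries K x with hG
  -- Two variables are used: the outer one records the degree of d, the inner one that of x. The
  -- claim is the coefficient of bidegree (b, m) of D G = c G D, where c is the exponential of ∑ σ_k
  -- (outer · inner)^k.
  let ι : A →+* PowerSeries A := C
  set D : PowerSeries (PowerSeries A) := PowerSeries.map ι (expSeries K d) with hD
  set y : PowerSeries (PowerSeries A) := PowerSeries.map ι (euler (posSeries d)) with hy
  have hED : euler D = y * D := by
    have : euler D = PowerSeries.map ι (euler (expSeries K d)) := by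
      ext1 k
      rw [hD, coeff_euler, coeff_map, coeff_map, coeff_euler, map_nsmul]
    rw [this, euler_expSeries K hd, map_mul]
  set c : PowerSeries (PowerSeries A) :=
    PowerSeries.mk fun k => expCoeff K σ k • (X : PowerSeries A) ^ k with hc
  set w : PowerSeries (PowerSeries A) :=
    PowerSeries.mk fun k => (if k = 0 then 0 else (k : K) * σ k) • (X : PowerSeries A) ^ k with hw
  have hXc : ∀ (r : ℕ) (f : PowerSeries A), Commute (X ^ r) f := fun r f =>
    ((commute_X f).pow_right r).symm
  have hEc : euler c = w * c := by
    ext1 k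
    have := congrArg (coeff k) (euler_expSeries K (x := σ) fun _ _ => Commute.all _ _)
    rw [coeff_euler, coeff_expSeries, coeff_mul] at this
    rw [coeff_euler, coeff_mul, hc, coeff_mk, ← Nat.cast_smul_eq_nsmul K, smul_smul, ← nsmul_eq_mul,
      this, Finset.sum_smul]
    refine Finset.sum_congr rfl fun z hz => ?_
    rw [hw, coeff_mk, coeff_mk, smul_mul_smul_comm, ← pow_add, Finset.HasAntidiagonal.mem_antidiagonal.mp hz,
      coeff_euler, coeff_posSeries, coeff_expSeries]
    congr 2
    split_ifs <;> simp
  have hcc : ∀ f, Commute c f := fun f => commute_of_coeff fun i j => by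
    rw [hc, coeff_mk]
    exact (hXc i _).smul_left _
  -- Differentiating D in the outer variable produces y; its commutator with G is the logarithmic
  -- derivative w of c. Hence D G and c G D obey the same Euler equation.
  have hyG : y * C G = C G * y + w * C G := by
    ext1 k
    rw [map_add, coeff_mul_C, coeff_C_mul, coeff_mul_C, hy, hw, coeff_mk, coeff_map, coeff_euler,
      coeff_posSeries]
    split_ifs with h0
    · simp
    · rw [map_nsmul, smul_mul_assoc, mul_smul_comm,
        C_mul_expSeries K hx (d k) k h0 (σ k) (fun r hr => h k r h0 hr), smul_add, smul_mul_assoc,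
        mul_smul, Nat.cast_smul_eq_nsmul]
  have key : D * C G = c * C G * D := by
    refine eq_of_euler K (Y := y) ?_ ?_ ?_ ?_
    · rw [euler_mul, euler_C, mul_zero, add_zero, hED, mul_assoc]
    · rw [euler_mul, euler_mul, euler_C, mul_zero, add_zero, hED, hEc]
      have : y * (c * C G * D) = c * (y * C G) * D := by
        rw [← mul_assoc, ← mul_assoc, ← (hcc y).eq, ← mul_assoc, mul_assoc c]
      rw [this, hyG, mul_add, add_mul, (hcc w).symm.eq]
      simp only [mul_assoc]
      rw [add_comm]
    · rw [hy, coeff_map, coeff_zero_euler, map_zero]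
    · simp [hD, hc, coeff_mul, coeff_expSeries, expCoeff_zero, ι]
  have h1 : coeff m (coeff b (D * C G)) = coeff m (coeff b (c * C G * D)) := by rw [key]
  rw [coeff_mul_C, hD, coeff_map, coeff_expSeries,
    show ι (expCoeff K d b) = C (expCoeff K d b) from rfl, coeff_C_mul, hG, coeff_expSeries,
    coeff_mul, map_sum] at h1
  rw [h1]
  refine Finset.sum_congr rfl fun z _ => ?_
  rw [coeff_mul_C, coeff_map, hc, coeff_mk, coeff_expSeries,
    show ι (expCoeff K d z.2) = C (expCoeff K d z.2) from rfl, coeff_mul_C, smul_mul_assoc,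
    coeff_smul, coeff_X_pow_mul', coeff_expSeries]
  split_ifs <;> simp

end Heisenberg
end

noncomputable section

/-! ### The Heisenberg relations on the Fock space -/

section FockHeisenberg

variable {n : ℕ} {L : Type*} [Field L] (q κ : L) (M : Matrix (Fin (n + 1)) (Fin (n + 1)) ℤ)

theorem fockH_of_pos (i : Fin (n + 1)) (k : ℕ+) :
    fockH q κ M i (k : ℕ) = ∑ j, (((k : ℕ) : L)⁻¹ * qInt q ((k : ℕ) * affCartan n i j) *
      qInt q (k : ℕ) * κ ^ (-((k : ℕ) : ℤ) * M i j)) •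
      ((MvPolynomial.pderiv (R := L) (j, k)).toLinearMap) := by
  have hk : (0 : ℤ) < ((k : ℕ) : ℤ) := by exact_mod_cast k.pos
  unfold fockH
  rw [dif_pos hk]
  have h : ∀ h', (⟨((k : ℕ) : ℤ).toNat, h'⟩ : ℕ+) = k := fun _ => PNat.eq (by simp)
  simp only [h, Int.cast_natCast]
  rfl

theorem fockH_of_neg (i : Fin (n + 1)) (k : ℕ+) :
    fockH q κ M i (-((k : ℕ) : ℤ)) = LinearMap.mulLeft L (MvPolynomial.X (i, k)) := by
  have hk : (0 : ℤ) < ((k : ℕ) : ℤ) := by exact_mod_cast k.pos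
  unfold fockH
  rw [dif_neg (by omega), dif_pos (by omega)]
  have h : ∀ h', (⟨(- -((k : ℕ) : ℤ)).toNat, h'⟩ : ℕ+) = k := fun _ => PNat.eq (by simp)
  simp only [h]

theorem fockH_zero (i : Fin (n + 1)) : fockH q κ M i 0 = 0 := by
  simp [fockH]

theorem commute_mulLeft (x y : Fock n L) :
    Commute (LinearMap.mulLeft L x) (LinearMap.mulLeft L y) := by
  refine LinearMap.ext fun v => ?_
  simp [mul_left_comm]

theorem commute_pderiv (x y : Fin (n + 1) × ℕ+) :
    Commute (MvPolynomial.pderiv (R := L) x).toLinearMap (MvPolynomial.pderiv (R := L) y).toLinearMap := by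
  have h : ⁅MvPolynomial.pderiv (R := L) x, MvPolynomial.pderiv (R := L) y⁆ = 0 := by
    refine MvPolynomial.derivation_ext fun z => ?_
    rw [Derivation.commutator_apply, MvPolynomial.pderiv_X, MvPolynomial.pderiv_X]
    simp [Pi.single_apply, apply_ite]
  refine LinearMap.ext fun v => ?_
  have := congrArg (fun D => D v) h
  simpa [Derivation.commutator_apply, sub_eq_zero] using this

theorem commute_fockH_neg (i j : Fin (n + 1)) (k r : ℕ) :
    Commute (fockH q κ M i (-(k : ℤ))) (fockH q κ M j (-(r : ℤ))) := by
  rcases Nat.eq_zero_or_pos k with rfl | hk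
  · simp [fockH_zero]
  rcases Nat.eq_zero_or_pos r with rfl | hr
  · simp [fockH_zero]
  have h1 := fockH_of_neg q κ M i ⟨k, hk⟩
  have h2 := fockH_of_neg q κ M j ⟨r, hr⟩
  rw [PNat.mk_coe] at h1 h2
  rw [h1, h2]
  exact commute_mulLeft _ _

theorem commute_fockH_pos (i j : Fin (n + 1)) (k r : ℕ) :
    Commute (fockH q κ M i (k : ℤ)) (fockH q κ M j (r : ℤ)) := by
  rcases Nat.eq_zero_or_pos k with rfl | hk
  · simp [fockH_zero]
  rcases Nat.eq_zero_or_pos r with rfl | hr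
  · simp [fockH_zero]
  have h1 := fockH_of_pos q κ M i ⟨k, hk⟩
  have h2 := fockH_of_pos q κ M j ⟨r, hr⟩
  rw [PNat.mk_coe] at h1 h2
  rw [h1, h2]
  exact Commute.sum_left _ _ _ fun _ _ => Commute.sum_right _ _ _ fun _ _ =>
    ((commute_pderiv _ _).smul_left _).smul_right _

/-- By the Leibniz rule, the commutator of a derivation with multiplication by a variable is
multiplication by the derivative of that variable, here a constant. -/
theorem fockH_pos_mul_neg (i j : Fin (n + 1)) (k r : ℕ) (hk : k ≠ 0) (hr : r ≠ 0) :
    fockH q κ M i (k : ℤ) * fockH q κ M j (-(r : ℤ)) =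
      fockH q κ M j (-(r : ℤ)) * fockH q κ M i (k : ℤ) + if r = k then
        algebraMap L (Module.End L (Fock n L)) ((k : L)⁻¹ * qInt q (k * affCartan n i j) *
          qInt q k * κ ^ (-(k : ℤ) * M i j)) else 0 := by
  have h1 := fockH_of_pos q κ M i ⟨k, Nat.pos_of_ne_zero hk⟩
  have h2 := fockH_of_neg q κ M j ⟨r, Nat.pos_of_ne_zero hr⟩
  rw [PNat.mk_coe] at h1 h2
  rw [h1, h2]
  refine LinearMap.ext fun v => ?_
  simp only [Module.End.mul_apply, LinearMap.sum_apply, LinearMap.smul_apply, LinearMap.mulLeft_apply,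
    LinearMap.add_apply, Derivation.coeFn_coe, Derivation.leibniz, smul_eq_mul, smul_add,
    Finset.sum_add_distrib, Finset.mul_sum, mul_smul_comm]
  congr 1
  split_ifs with h
  · subst h
    simp only [MvPolynomial.pderiv_X, Pi.single_apply, mul_ite, mul_one, mul_zero, smul_ite,
      smul_zero, Module.algebraMap_end_apply]
    rw [Finset.sum_eq_single j, if_pos rfl]
    · exact fun x _ hx => if_neg fun h' => hx (Prod.mk.inj h').1.symm
    · exact fun hj => absurd (Finset.mem_univ j) hj
  · simp only [MvPolynomial.pderiv_X, Pi.single_apply, mul_ite, mul_one, mul_zero, smul_ite,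
      smul_zero, LinearMap.zero_apply]
    exact Finset.sum_eq_zero fun x _ => if_neg fun h' => h (Subtype.mk.inj (Prod.mk.inj h').2)

theorem commute_fockH_same_sign {k l : ℤ} (h : k + l ≠ 0) (i j : Fin (n + 1)) :
    Commute (fockH q κ M i k) (fockH q κ M j l) := by
  have h4 : ∀ i j (k r : ℕ), k ≠ r →
      Commute (fockH q κ M i (k : ℤ)) (fockH q κ M j (-(r : ℤ))) := by
    intro i j k r hkr
    rcases Nat.eq_zero_or_pos k with rfl | hk
    · simp [fockH_zero]
    rcases Nat.eq_zero_or_pos r with rfl | hr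
    · simp [fockH_zero]
    have := fockH_pos_mul_neg q κ M i j k r hk.ne' hr.ne'
    rwa [if_neg hkr.symm, add_zero] at this
  rcases Int.eq_nat_or_neg k with ⟨k, rfl | rfl⟩ <;> rcases Int.eq_nat_or_neg l with ⟨l, rfl | rfl⟩
  · exact commute_fockH_pos q κ M i j k l
  · exact h4 i j k l (by omega)
  · exact (h4 j i l k (by omega)).symm
  · exact commute_fockH_neg q κ M i j k l

theorem qInt_neg (k : ℤ) : qInt q (-k) = -qInt q k := by
  unfold qInt
  rw [neg_neg, ← neg_div, neg_sub]

theorem fockH_comm (hM : ∀ i j, M i j = -M j i) (hA : ∀ i j, affCartan n i j = affCartan n j i)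
    (i j : Fin (n + 1)) (k l : ℤ) (hk : k ≠ 0) :
    fockH q κ M i k * fockH q κ M j l - fockH q κ M j l * fockH q κ M i k =
      if k + l = 0 then algebraMap L (Module.End L (Fock n L))
        ((k : L)⁻¹ * qInt q (k * affCartan n i j) * qInt q k * κ ^ (-k * M i j)) else 0 := by
  split_ifs with h
  · obtain rfl : l = -k := by omega
    rcases Int.eq_nat_or_neg k with ⟨k, rfl | rfl⟩
    · rw [fockH_pos_mul_neg q κ M i j k k (by omega) (by omega), if_pos rfl, Int.cast_natCast]
      exact add_sub_cancel_left _ _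
    -- Negative k is the positive case with i and j exchanged. Under (i, j, k) ↦ (j, i, -k) three
    -- odd factors change sign, and κ^(-k m_ij) is unchanged because M is skew.
    · rw [neg_neg, fockH_pos_mul_neg q κ M j i k k (by omega) (by omega), if_pos rfl,
        sub_add_cancel_left, ← map_neg, hM j i, hA j i]
      congr 1
      push_cast
      simp only [inv_neg, mul_neg, neg_mul, neg_neg, qInt_neg]
  · rw [sub_eq_zero]
    exact commute_fockH_same_sign q κ M h i j

end FockHeisenberg

/-! ### Products of vertex operators -/

/-- Extension by zero of a sequence to negative indices. -/
def extZero {A : Type*} [Zero A] (f : ℕ → A) (m : ℤ) : A := if 0 ≤ m then f m.toNat else 0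

theorem extZero_natCast {A : Type*} [Zero A] (f : ℕ → A) (m : ℕ) : extZero f (m : ℤ) = f m := by
  simp [extZero]

theorem extZero_of_neg {A : Type*} [Zero A] (f : ℕ → A) {m : ℤ} (h : m < 0) : extZero f m = 0 := by
  simp [extZero, h.not_ge]

theorem sum_range_smul_eq_finsum {L V : Type*} [Field L] [AddCommGroup V] [Module L V] (c : ℕ → L)
    (G : ℤ → V) (B : ℕ) (hG : ∀ k : ℤ, B ≤ k → G k = 0) :
    ∑ k ∈ Finset.range B, c k • G k = ∑ᶠ k : ℤ, extZero c k • G k := by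
  rw [finsum_eq_sum_of_support_subset (s := (Finset.range B).map Nat.castEmbedding), Finset.sum_map]
  · simp [extZero_natCast]
  · intro k hk
    rw [Function.mem_support] at hk
    rcases lt_or_ge k 0 with h | h
    · rw [extZero_of_neg _ h, zero_smul] at hk
      exact absurd rfl hk
    · lift k to ℕ using h
      have : k < B := by
        by_contra h'
        exact hk (by rw [hG k (by omega), smul_zero])
      simpa using this

/-- A family of vertex operators `(∑_m g_m z ^ m) (∑_b D_b z ^ (-b))` on the Fock space, with
contraction coefficients `c`. -/
structure VertexFamily (n : ℕ) (L : Type*) [Field L] (J : Type*) where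
  g : J → ℕ → Module.End L (Fock n L)
  D : J → ℕ → Module.End L (Fock n L)
  c : J → J → ℕ → L
  lowers : ∀ i b, FockLowers b (D i b)
  commute_g : ∀ i j a b, Commute (g i a) (g j b)
  commute_D : ∀ i j a b, Commute (D i a) (D j b)
  contract : ∀ i j b m, D i b * g j m = ∑ z ∈ Finset.HasAntidiagonal.antidiagonal b,
    if z.1 ≤ m then c i j z.1 • (g j (m - z.1) * D i z.2) else 0

theorem fockBelow_mono {n : ℕ} {L : Type*} [Field L] {d e : ℕ} (h : d ≤ e) :
    fockBelow n L d ≤ fockBelow n L e := by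
  intro v hv
  rw [fockBelow, MvPolynomial.mem_restrictSupport_iff] at hv ⊢
  exact fun μ hμ => (show fockDeg μ < d from hv hμ).trans_le h

theorem FockLowers.apply_mem {n : ℕ} {L : Type*} [Field L] {b : ℕ} {T : Module.End L (Fock n L)}
    (h : FockLowers b T) {d : ℕ} {v : Fock n L} (hv : v ∈ fockBelow n L d) :
    T v ∈ fockBelow n L d :=
  fockBelow_mono (Nat.sub_le d b) (h d v hv)

theorem FockLowers.apply_eq_zero {n : ℕ} {L : Type*} [Field L] {b : ℕ}
    {T : Module.End L (Fock n L)} (h : FockLowers b T) {d : ℕ} {v : Fock n L}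
    (hv : v ∈ fockBelow n L d) (hb : d ≤ b) : T v = 0 := by
  have := h d v hv
  rwa [Nat.sub_eq_zero_of_le hb, fockBelow_zero, Submodule.mem_bot] at this

theorem locallyFinite0_of_lowers {n : ℕ} {L : Type*} [Field L] {D : ℕ → Module.End L (Fock n L)}
    (h : ∀ b, FockLowers b (D b)) : LocallyFinite0 D := by
  intro v
  obtain ⟨d, hd⟩ := exists_mem_fockBelow v
  refine (Set.finite_lt_nat d).subset fun b hb => ?_
  by_contra hlt
  exact hb ((h b).apply_eq_zero hd (not_lt.mp hlt))

theorem fieldCoeff_apply {n : ℕ} {L : Type*} [Field L] (g D : ℕ → Module.End L (Fock n L))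
    (h : LocallyFinite0 D) (a : ℤ) {B : ℕ} {v : Fock n L} (hB : ∀ b, B ≤ b → D b v = 0) :
    fieldCoeff g D h a v = ∑ b ∈ Finset.range B, extZero g (a + b) (D b v) := by
  have h1 : fieldCoeff g D h a v =
      ∑ᶠ b : ℕ, if 0 ≤ a + b then g (a + b).toNat (D b v) else 0 := rfl
  rw [h1, finsum_eq_sum_of_support_subset (s := Finset.range B)]
  · refine Finset.sum_congr rfl fun b _ => ?_
    unfold extZero
    split_ifs <;> simp
  · intro b hb
    rw [Function.mem_support] at hb
    by_contra h'
    exact hb (by rw [hB b (by simpa using h')]; simp)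

namespace VertexFamily

variable {n : ℕ} {L : Type*} [Field L] {J : Type*} (Y : VertexFamily n L J)

/-- The coefficient of `z ^ a` of a vertex operator. -/
def op (i : J) (a : ℤ) : Module.End L (Fock n L) :=
  fieldCoeff (Y.g i) (Y.D i) (locallyFinite0_of_lowers (Y.lowers i)) a

theorem op_apply (i : J) (a : ℤ) {d : ℕ} {v : Fock n L} (hv : v ∈ fockBelow n L d) :
    Y.op i a v = ∑ b ∈ Finset.range d, extZero (Y.g i) (a + b) (Y.D i b v) :=
  fieldCoeff_apply _ _ _ _ fun b hb => (Y.lowers i b).apply_eq_zero hv hb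

theorem commute_extZero_g (i j : J) (a b : ℤ) :
    Commute (extZero (Y.g i) a) (extZero (Y.g j) b) := by
  unfold extZero
  split_ifs
  exacts [Y.commute_g i j _ _, Commute.zero_right _, Commute.zero_left _, Commute.zero_left _]

/-- Moving one creation mode to the left through a whole vertex operator: k is the degree lost to
the contraction. Any B > m serves as a bound, since larger k leave a creation mode of negative
index. -/
theorem op_extZero_g (i j : J) (a m : ℤ) {B : ℕ} (hB : m < B) (v : Fock n L) :
    Y.op i a (extZero (Y.g j) m v) =
      ∑ k ∈ Finset.range B, Y.c i j k • extZero (Y.g j) (m - k) (Y.op i (a + k) v) := by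
  rcases lt_or_ge m 0 with hm | hm
  · rw [extZero_of_neg _ hm, Finset.sum_eq_zero]
    · simp
    · intro k _
      rw [extZero_of_neg _ (by omega)]
      simp
  lift m to ℕ using hm
  obtain ⟨d, hd⟩ := exists_mem_fockBelow v
  set f : ℕ → ℕ → Fock n L := fun k l =>
    Y.c i j k • extZero (Y.g j) (m - k) (extZero (Y.g i) (a + k + l) (Y.D i l v)) with hf
  have hf0 : ∀ k l, d ≤ l → f k l = 0 := fun k l h => by
    simp [hf, (Y.lowers i l).apply_eq_zero hd h]
  have hfm : ∀ k l, m < k → f k l = 0 := fun k l h => by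
    simp only [hf]
    rw [extZero_of_neg (Y.g j) (by omega)]
    simp
  have hD : ∀ b : ℕ, extZero (Y.g i) (a + b) (Y.D i b (extZero (Y.g j) m v)) =
      ∑ z ∈ Finset.HasAntidiagonal.antidiagonal b, f z.1 z.2 := by
    intro b
    rw [extZero_natCast, ← Module.End.mul_apply (Y.D i b), Y.contract, LinearMap.sum_apply, map_sum]
    refine Finset.sum_congr rfl fun z hz => ?_
    split_ifs with h
    · have h1 : (m : ℤ) - z.1 = ((m - z.1 : ℕ) : ℤ) := by omega
      have h2 : a + (b : ℤ) = a + z.1 + z.2 := by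
        rw [← Finset.HasAntidiagonal.mem_antidiagonal.mp hz]; push_cast; ring
      simp only [hf]
      rw [LinearMap.smul_apply, map_smul, Module.End.mul_apply, ← Module.End.mul_apply, h1, ← h2,
        ← extZero_natCast (Y.g j), (Y.commute_extZero_g i j _ _).eq, Module.End.mul_apply]
    · rw [hfm _ _ (by omega)]
      simp
  have hs : ∀ b, d + m + 1 ≤ b → Y.D i b (extZero (Y.g j) m v) = 0 := by
    intro b hb
    rw [extZero_natCast, ← Module.End.mul_apply, Y.contract, LinearMap.sum_apply]
    refine Finset.sum_eq_zero fun z hz => ?_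
    have := Finset.HasAntidiagonal.mem_antidiagonal.mp hz
    split_ifs with h
    · simp [(Y.lowers i z.2).apply_eq_zero hd (by omega)]
    · simp
  rw [op, fieldCoeff_apply _ _ _ a hs, Finset.sum_congr rfl fun b _ => hD b]
  -- The sum over antidiagonals becomes a sum over a rectangle, because `f k l` vanishes for k > m
  -- and for l ≥ d.
  simp_rw [Finset.Nat.sum_antidiagonal_eq_sum_range_succ_mk]
  rw [Finset.sum_range_diag_flip (d + m + 1) f]
  have h1 : ∀ k ∈ Finset.range B,
      Y.c i j k • extZero (Y.g j) (m - k) (Y.op i (a + k) v) = ∑ l ∈ Finset.range d, f k l := by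
    intro k _
    rw [Y.op_apply i _ hd, map_sum, Finset.smul_sum]
  rw [Finset.sum_congr rfl h1, ← Finset.sum_subset (Finset.range_mono (show m + 1 ≤ B by omega)),
    ← Finset.sum_subset (Finset.range_mono (show m + 1 ≤ d + m + 1 by omega))]
  · refine Finset.sum_congr rfl fun k hk => ?_
    rw [Finset.mem_range] at hk
    refine (Finset.sum_subset (Finset.range_mono (by omega)) fun l _ hl => ?_).symm
    exact hf0 k l (by simpa using hl)
  · intro k _ hk
    exact Finset.sum_eq_zero fun l _ => hfm k l (by simpa using hk)
  · intro k _ hk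
    exact Finset.sum_eq_zero fun l _ => hfm k l (by simpa using hk)

/-- The coefficient of `z₁ ^ a z₂ ^ b` in the normal ordered product of two vertex operators, applied
to a vector of degree less than `d`. -/
def normal₂ (d : ℕ) (i j : J) (a b : ℤ) (v : Fock n L) : Fock n L :=
  ∑ x ∈ Finset.range d, ∑ y ∈ Finset.range d,
    extZero (Y.g i) (a + x) (extZero (Y.g j) (b + y) (Y.D i x (Y.D j y v)))

/-- The coefficient of `z₁ ^ a z₂ ^ b z₃ ^ c` in the normal ordered product of three vertex
operators, applied to a vector of degree less than `d`. -/
def normal₃ (d : ℕ) (i j l : J) (a b c : ℤ) (v : Fock n L) : Fock n L :=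
  ∑ x ∈ Finset.range d, ∑ y ∈ Finset.range d, ∑ z ∈ Finset.range d,
    extZero (Y.g i) (a + x) (extZero (Y.g j) (b + y) (extZero (Y.g l) (c + z)
      (Y.D i x (Y.D j y (Y.D l z v)))))

theorem extZero_g_comm (i j : J) (a b : ℤ) (v : Fock n L) :
    extZero (Y.g i) a (extZero (Y.g j) b v) = extZero (Y.g j) b (extZero (Y.g i) a v) := by
  rw [← Module.End.mul_apply, (Y.commute_extZero_g i j a b).eq, Module.End.mul_apply]

theorem D_comm (i j : J) (a b : ℕ) (v : Fock n L) :
    Y.D i a (Y.D j b v) = Y.D j b (Y.D i a v) := by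
  rw [← Module.End.mul_apply, (Y.commute_D i j a b).eq, Module.End.mul_apply]

/-- This symmetry is what allows products in opposite orders to be compared: they differ only in
their contraction coefficients. -/
theorem normal₂_comm (d : ℕ) (i j : J) (a b : ℤ) (v : Fock n L) :
    Y.normal₂ d i j a b v = Y.normal₂ d j i b a v := by
  unfold normal₂
  rw [Finset.sum_comm]
  refine Finset.sum_congr rfl fun x _ => Finset.sum_congr rfl fun y _ => ?_
  rw [Y.extZero_g_comm, Y.D_comm]

theorem normal₃_comm_right (d : ℕ) (i j l : J) (a b c : ℤ) (v : Fock n L) :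
    Y.normal₃ d i j l a b c v = Y.normal₃ d i l j a c b v := by
  unfold normal₃
  refine Finset.sum_congr rfl fun x _ => ?_
  rw [Finset.sum_comm]
  refine Finset.sum_congr rfl fun y _ => Finset.sum_congr rfl fun z _ => ?_
  rw [Y.extZero_g_comm j l, Y.D_comm j l]

theorem normal₃_comm_left (d : ℕ) (i j l : J) (a b c : ℤ) (v : Fock n L) :
    Y.normal₃ d i j l a b c v = Y.normal₃ d j i l b a c v := by
  unfold normal₃
  rw [Finset.sum_comm]
  refine Finset.sum_congr rfl fun x _ => Finset.sum_congr rfl fun y _ =>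
    Finset.sum_congr rfl fun z _ => ?_
  rw [Y.extZero_g_comm i j, Y.D_comm i j]

/-- Annihilation modes of index at least d kill the vector, so the creation mode has index below a +
d. This bound and its variants make all contraction sums finite. -/
theorem normal₂_eq_zero_left {d : ℕ} {i j : J} {a b : ℤ} {v : Fock n L} (h : a + d ≤ 0) :
    Y.normal₂ d i j a b v = 0 := by
  refine Finset.sum_eq_zero fun x hx => Finset.sum_eq_zero fun y _ => ?_
  rw [Finset.mem_range] at hx
  rw [extZero_of_neg _ (by omega)]
  simp

theorem normal₂_eq_zero_right {d : ℕ} {i j : J} {a b : ℤ} {v : Fock n L} (h : b + d ≤ 0) :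
    Y.normal₂ d i j a b v = 0 := by
  rw [normal₂_comm, Y.normal₂_eq_zero_left h]

theorem normal₃_eq_zero_left {d : ℕ} {i j l : J} {a b c : ℤ} {v : Fock n L} (h : a + d ≤ 0) :
    Y.normal₃ d i j l a b c v = 0 := by
  refine Finset.sum_eq_zero fun x hx => Finset.sum_eq_zero fun y _ =>
    Finset.sum_eq_zero fun y _ => ?_
  rw [Finset.mem_range] at hx
  rw [extZero_of_neg _ (by omega)]
  simp

theorem normal₃_eq_zero_mid {d : ℕ} {i j l : J} {a b c : ℤ} {v : Fock n L} (h : b + d ≤ 0) :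
    Y.normal₃ d i j l a b c v = 0 := by
  rw [normal₃_comm_left, Y.normal₃_eq_zero_left h]

theorem normal₃_eq_zero_right {d : ℕ} {i j l : J} {a b c : ℤ} {v : Fock n L} (h : c + d ≤ 0) :
    Y.normal₃ d i j l a b c v = 0 := by
  rw [normal₃_comm_right, Y.normal₃_eq_zero_mid h]

/-- Wick's formula for two factors: the contraction transfers k units of degree from the second
factor to the first. -/
theorem op_op {d : ℕ} {v : Fock n L} (hv : v ∈ fockBelow n L d) (i j : J) (a b : ℤ) {B : ℕ}
    (hB : b + d ≤ B) :
    Y.op i a (Y.op j b v) =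
      ∑ k ∈ Finset.range B, Y.c i j k • Y.normal₂ d i j (a + k) (b - k) v := by
  have h1 : ∀ y ∈ Finset.range d, Y.op i a (extZero (Y.g j) (b + y) (Y.D j y v)) =
      ∑ k ∈ Finset.range B, Y.c i j k • ∑ x ∈ Finset.range d, extZero (Y.g j) (b + y - k)
        (extZero (Y.g i) (a + k + x) (Y.D i x (Y.D j y v))) := by
    intro y hy
    rw [Finset.mem_range] at hy
    rw [Y.op_extZero_g i j a (b + y) (B := B) (by omega)]
    refine Finset.sum_congr rfl fun k _ => ?_
    rw [Y.op_apply i _ ((Y.lowers j y).apply_mem hv), map_sum]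
  rw [Y.op_apply j b hv, map_sum, Finset.sum_congr rfl h1, Finset.sum_comm]
  refine Finset.sum_congr rfl fun k _ => ?_
  rw [← Finset.smul_sum, normal₂, Finset.sum_comm]
  congr 1
  refine Finset.sum_congr rfl fun x _ => Finset.sum_congr rfl fun y _ => ?_
  rw [Y.extZero_g_comm, add_sub_right_comm]

theorem op_normal₂ {d : ℕ} {v : Fock n L} (hv : v ∈ fockBelow n L d) (i j l : J) (a b c : ℤ)
    {B B' : ℕ} (hB : b + d ≤ B) (hB' : c + d ≤ B') :
    Y.op i a (Y.normal₂ d j l b c v) =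
      ∑ k ∈ Finset.range B, ∑ r ∈ Finset.range B', (Y.c i j k * Y.c i l r) •
        Y.normal₃ d i j l (a + k + r) (b - k) (c - r) v := by
  have h1 : ∀ y ∈ Finset.range d, ∀ z ∈ Finset.range d,
      Y.op i a (extZero (Y.g j) (b + y) (extZero (Y.g l) (c + z) (Y.D j y (Y.D l z v)))) =
      ∑ k ∈ Finset.range B, ∑ r ∈ Finset.range B', (Y.c i j k * Y.c i l r) •
        ∑ x ∈ Finset.range d, extZero (Y.g i) (a + k + r + x) (extZero (Y.g j) (b - k + y)
          (extZero (Y.g l) (c - r + z) (Y.D i x (Y.D j y (Y.D l z v))))) := by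
    intro y hy z hz
    rw [Finset.mem_range] at hy hz
    rw [Y.op_extZero_g i j a (b + y) (B := B) (by omega)]
    refine Finset.sum_congr rfl fun k _ => ?_
    rw [Y.op_extZero_g i l _ (c + z) (B := B') (by omega), map_sum, Finset.smul_sum]
    refine Finset.sum_congr rfl fun r _ => ?_
    rw [Y.op_apply i _ ((Y.lowers j y).apply_mem ((Y.lowers l z).apply_mem hv)), map_smul,
      smul_smul, map_sum, map_sum]
    congr 1
    refine Finset.sum_congr rfl fun x _ => ?_
    rw [Y.extZero_g_comm l i, Y.extZero_g_comm j i, add_sub_right_comm, add_sub_right_comm]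
  unfold normal₂
  rw [map_sum]
  simp_rw [map_sum]
  rw [Finset.sum_congr rfl fun y hy => Finset.sum_congr rfl fun z hz => h1 y hy z hz]
  rw [Finset.sum_congr rfl fun y hy => Finset.sum_comm, Finset.sum_comm]
  refine Finset.sum_congr rfl fun k _ => ?_
  rw [Finset.sum_congr rfl fun y hy => Finset.sum_comm, Finset.sum_comm]
  refine Finset.sum_congr rfl fun r _ => ?_
  simp_rw [← Finset.smul_sum]
  congr 1
  unfold normal₃
  rw [Finset.sum_congr rfl fun y hy => Finset.sum_comm, Finset.sum_comm]

/-- Wick's formula for three factors, with one contraction for each pair. The bound B must exceed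
that of two factors because contracting j with l first raises the degree of j by u < B'. -/
theorem op_op_op {d : ℕ} {v : Fock n L} (hv : v ∈ fockBelow n L d) (i j l : J) (a b c : ℤ)
    {B B' : ℕ} (hB' : c + d ≤ B') (hB : b + d + B' ≤ B) :
    Y.op i a (Y.op j b (Y.op l c v)) =
      ∑ k ∈ Finset.range B, ∑ r ∈ Finset.range B', ∑ u ∈ Finset.range B',
        (Y.c i j k * Y.c i l r * Y.c j l u) •
          Y.normal₃ d i j l (a + k + r) (b - k + u) (c - r - u) v := by
  rw [Y.op_op hv j l b c hB', map_sum]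
  have h : ∀ u ∈ Finset.range B', Y.op i a (Y.c j l u • Y.normal₂ d j l (b + u) (c - u) v) =
      ∑ k ∈ Finset.range B, ∑ r ∈ Finset.range B', (Y.c i j k * Y.c i l r * Y.c j l u) •
          Y.normal₃ d i j l (a + k + r) (b - k + u) (c - r - u) v := by
    intro u hu
    rw [Finset.mem_range] at hu
    rw [map_smul, Y.op_normal₂ hv i j l a _ _ (B := B) (B' := B') (by omega) (by omega),
      Finset.smul_sum]
    refine Finset.sum_congr rfl fun k _ => ?_
    rw [Finset.smul_sum]
    refine Finset.sum_congr rfl fun r _ => ?_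
    rw [smul_smul, mul_comm (Y.c j l u), add_sub_right_comm, sub_right_comm]
  rw [Finset.sum_congr rfl h, Finset.sum_comm]
  refine Finset.sum_congr rfl fun k _ => ?_
  rw [Finset.sum_comm]

/-- Summation over all of ℤ makes later shifts and reflections of k plain changes of variable. -/
theorem op_op_eq_finsum {d : ℕ} {v : Fock n L} (hv : v ∈ fockBelow n L d) (i j : J) (a b : ℤ) :
    Y.op i a (Y.op j b v) =
      ∑ᶠ k : ℤ, extZero (Y.c i j) k • Y.normal₂ d i j (a + k) (b - k) v := by
  rw [Y.op_op hv i j a b (B := (b + d).toNat) (by omega)]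
  refine sum_range_smul_eq_finsum _ (fun k => Y.normal₂ d i j (a + k) (b - k) v) _ fun k hk => ?_
  exact Y.normal₂_eq_zero_right (by omega)

theorem finite_support_normal₂ (d : ℕ) (i j : J) (a b : ℤ) (v : Fock n L) :
    (Function.support fun k : ℤ => Y.normal₂ d i j (a + k) (b - k) v).Finite := by
  refine (Set.finite_Icc (-(a + d)) (b + d)).subset fun k hk => ?_
  rw [Function.mem_support] at hk
  by_contra h
  rw [Set.mem_Icc, not_and_or, not_le, not_le] at h
  rcases h with h | h
  · exact hk (Y.normal₂_eq_zero_left (by omega))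
  · exact hk (Y.normal₂_eq_zero_right (by omega))

end VertexFamily
end

noncomputable section

/-! ### Bringing truncated contraction sums to a common index box -/

section Reindex

variable {L V : Type*} [Field L] [AddCommGroup V] [Module L V]

/-- The orderings in a Serre relation yield sums with different offsets, directions and bounds. Over
one box S that contains the support of G they can be compared coefficient by coefficient. -/
theorem sum_range_shift (c : ℕ → L) (G : ℤ → V) (o : ℤ) (B : ℕ) (S : Finset ℤ)
    (hB : ∀ k : ℕ, B ≤ k → G (o + k) = 0) (hS : ∀ k, k ∉ S → G k = 0) :
    ∑ k ∈ Finset.range B, c k • G (o + k) = ∑ k ∈ S, extZero c (k - o) • G k := by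
  rw [sum_range_smul_eq_finsum c (fun k => G (o + k)) B,
    ← finsum_eq_sum_of_support_subset (f := fun k => extZero c (k - o) • G k) (s := S)]
  · refine (finsum_congr fun k => ?_).trans (finsum_comp_equiv (Equiv.addLeft o))
    simp
  · intro k hk
    by_contra h
    exact hk (by simp [hS k h])
  · intro k hk
    lift k to ℕ using (by omega)
    exact hB k (by omega)

theorem sum_range_shift_neg (c : ℕ → L) (G : ℤ → V) (o : ℤ) (B : ℕ) (S : Finset ℤ)
    (hB : ∀ k : ℕ, B ≤ k → G (o - k) = 0) (hS : ∀ k, k ∉ S → G k = 0) :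
    ∑ k ∈ Finset.range B, c k • G (o - k) = ∑ k ∈ S, extZero c (o - k) • G k := by
  rw [sum_range_smul_eq_finsum c (fun k => G (o - k)) B,
    ← finsum_eq_sum_of_support_subset (f := fun k => extZero c (o - k) • G k) (s := S)]
  · refine (finsum_congr fun k => ?_).trans (finsum_comp_equiv (Equiv.subLeft o))
    simp
  · intro k hk
    by_contra h
    exact hk (by simp [hS k h])
  · intro k hk
    lift k to ℕ using (by omega)
    exact hB k (by omega)

theorem sum_range_range {c c' : ℕ → L} {C C' : ℤ → L} {f f' : ℕ → ℤ} {B B' : ℕ} {S : Finset ℤ}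
    (hc : ∀ G : ℤ → V, (∀ k, k ∉ S → G k = 0) →
      ∑ k ∈ Finset.range B, c k • G (f k) = ∑ k ∈ S, C k • G k)
    (hc' : ∀ G : ℤ → V, (∀ k, k ∉ S → G k = 0) →
      ∑ k ∈ Finset.range B', c' k • G (f' k) = ∑ k ∈ S, C' k • G k)
    (F : ℤ → ℤ → V) (h : ∀ k l, k ∉ S → F k l = 0) (h' : ∀ k l, l ∉ S → F k l = 0) :
    ∑ k ∈ Finset.range B, ∑ r ∈ Finset.range B', (c k * c' r) • F (f k) (f' r) =
      ∑ k ∈ S, ∑ l ∈ S, (C k * C' l) • F k l := by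
  simp_rw [mul_smul, ← Finset.smul_sum]
  rw [← hc fun k => ∑ l ∈ S, C' l • F k l]
  · exact Finset.sum_congr rfl fun k _ => by rw [hc' _ (h' _)]
  · exact fun k hk => Finset.sum_eq_zero fun l _ => by rw [h k l hk, smul_zero]

end Reindex

/-! ### Intertwining, specialization along a line, and the Serre relation for vertex operators -/

namespace VertexFamily

variable {n : ℕ} {L : Type*} [Field L] {J : Type*} (Y : VertexFamily n L J)

/-- Intended for T = H_{i,r} with r > 0, which meets only the creation part. The companion
`mul_op_of_comm_g` serves H_{i,-r}, which meets only the annihilation part. -/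
theorem mul_op_of_comm_D (T : Module.End L (Fock n L)) (i : J) (r : ℕ) (c : L)
    (hg : ∀ m, T * Y.g i m = Y.g i m * T + if r ≤ m then c • Y.g i (m - r) else 0)
    (hD : ∀ b, Commute T (Y.D i b)) (a : ℤ) :
    T * Y.op i a = Y.op i a * T + c • Y.op i (a - r) := by
  refine LinearMap.ext fun v => ?_
  obtain ⟨d, hd⟩ := exists_mem_fockBelow v
  have hg' : ∀ (m : ℤ) w, T (extZero (Y.g i) m w) =
      extZero (Y.g i) m (T w) + c • extZero (Y.g i) (m - r) w := by
    intro m w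
    rcases lt_or_ge m 0 with h | h
    · rw [extZero_of_neg _ h, extZero_of_neg _ (by omega)]
      simp
    · lift m to ℕ using h
      rw [extZero_natCast, ← Module.End.mul_apply, hg]
      split_ifs with h
      · rw [← Nat.cast_sub h, extZero_natCast]
        simp
      · rw [extZero_of_neg (m := (m : ℤ) - r) _ (by omega)]
        simp
  have hD' : ∀ b w, T (Y.D i b w) = Y.D i b (T w) := fun b w => by
    rw [← Module.End.mul_apply, (hD b).eq, Module.End.mul_apply]
  have h0 : ∀ b, d ≤ b → Y.D i b (T v) = 0 := fun b hb => by
    rw [← hD', (Y.lowers i b).apply_eq_zero hd hb, map_zero]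
  rw [Module.End.mul_apply, LinearMap.add_apply, Module.End.mul_apply, LinearMap.smul_apply,
    Y.op_apply i a hd, Y.op_apply i (a - r) hd, op, fieldCoeff_apply _ _ _ _ h0, map_sum,
    Finset.smul_sum, ← Finset.sum_add_distrib]
  refine Finset.sum_congr rfl fun b _ => ?_
  rw [hg', hD', add_sub_right_comm]

theorem mul_op_of_comm_g (T : Module.End L (Fock n L)) (i : J) (r : ℕ) (c : L)
    (hD : ∀ b, T * Y.D i b = Y.D i b * T + if r ≤ b then c • Y.D i (b - r) else 0)
    (hg : ∀ m, Commute T (Y.g i m)) (a : ℤ) :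
    T * Y.op i a = Y.op i a * T + c • Y.op i (a + r) := by
  refine LinearMap.ext fun v => ?_
  obtain ⟨d, hd⟩ := exists_mem_fockBelow v
  obtain ⟨e, he⟩ := exists_mem_fockBelow (T v)
  have hg' : ∀ (m : ℤ) w, T (extZero (Y.g i) m w) = extZero (Y.g i) m (T w) := by
    intro m w
    unfold extZero
    split_ifs
    · rw [← Module.End.mul_apply, (hg _).eq, Module.End.mul_apply]
    · simp
  have hb : ∀ b, d + e + r ≤ b → Y.D i b v = 0 := fun b hb =>
    (Y.lowers i b).apply_eq_zero hd (by omega)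
  have hb' : ∀ b, d + e ≤ b → Y.D i b v = 0 := fun b hb =>
    (Y.lowers i b).apply_eq_zero hd (by omega)
  have he' : ∀ b, d + e + r ≤ b → Y.D i b (T v) = 0 := fun b hb =>
    (Y.lowers i b).apply_eq_zero he (by omega)
  rw [Module.End.mul_apply, LinearMap.add_apply, Module.End.mul_apply, LinearMap.smul_apply, op, op,
    fieldCoeff_apply _ _ _ a hb, fieldCoeff_apply _ _ _ a he', fieldCoeff_apply _ _ _ _ hb',
    map_sum, Finset.smul_sum]
  have h1 : ∑ b ∈ Finset.range (d + e), c • extZero (Y.g i) (a + r + b) (Y.D i b v) =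
      ∑ b ∈ Finset.range (d + e + r),
        if r ≤ b then c • extZero (Y.g i) (a + b) (Y.D i (b - r) v) else 0 := by
    rw [add_comm (d + e) r, Finset.sum_range_add _ r (d + e), Finset.sum_eq_zero (s := Finset.range r), zero_add]
    · refine Finset.sum_congr rfl fun b _ => ?_
      rw [if_pos (by omega), Nat.add_sub_cancel_left]
      push_cast
      rw [add_assoc]
    · intro b hb
      rw [if_neg (by simpa using hb)]
  rw [h1, ← Finset.sum_add_distrib]
  refine Finset.sum_congr rfl fun b _ => ?_
  rw [hg', ← Module.End.mul_apply T, hD]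
  split_ifs <;> simp

/-- Intertwining with an operator that scales the modes. -/
theorem scale_op (T : Module.End L (Fock n L)) (i : J) (r : L) (hr : r ≠ 0)
    (hg : ∀ m, T * Y.g i m = r⁻¹ ^ m • (Y.g i m * T))
    (hD : ∀ b, T * Y.D i b = r ^ b • (Y.D i b * T)) (a : ℤ) :
    T * Y.op i a = r ^ (-a) • (Y.op i a * T) := by
  refine LinearMap.ext fun v => ?_
  obtain ⟨d, hd⟩ := exists_mem_fockBelow v
  obtain ⟨e, he⟩ := exists_mem_fockBelow (T v)
  have hb : ∀ b, d + e ≤ b → Y.D i b v = 0 := fun b hb =>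
    (Y.lowers i b).apply_eq_zero hd (by omega)
  have he' : ∀ b, d + e ≤ b → Y.D i b (T v) = 0 := fun b hb =>
    (Y.lowers i b).apply_eq_zero he (by omega)
  rw [LinearMap.smul_apply, Module.End.mul_apply, Module.End.mul_apply, op,
    fieldCoeff_apply _ _ _ a hb, fieldCoeff_apply _ _ _ a he', map_sum, Finset.smul_sum]
  refine Finset.sum_congr rfl fun b _ => ?_
  rcases lt_or_ge (a + b) 0 with h | h
  · rw [extZero_of_neg _ h]
    simp
  · obtain ⟨m, hm⟩ := Int.eq_ofNat_of_zero_le h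
    rw [hm, extZero_natCast, ← Module.End.mul_apply, hg, LinearMap.smul_apply,
      Module.End.mul_apply, ← Module.End.mul_apply T, hD, LinearMap.smul_apply, map_smul, smul_smul,
      Module.End.mul_apply, show -a = (-(m : ℤ)) + b by omega, zpow_add₀ hr, zpow_neg, zpow_natCast,
      zpow_natCast, inv_pow]

/-- If x + y ≥ d, the two annihilation modes together kill v, so only the triangle of the box
contributes. -/
theorem sum_box_eq (d : ℕ) (i j : J) {v : Fock n L} (hv : v ∈ fockBelow n L d)
    (f : ℕ → ℕ → Module.End L (Fock n L)) :
    ∑ x ∈ Finset.range d, ∑ y ∈ Finset.range d, f x y (Y.D i x (Y.D j y v)) =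
      ∑ b ∈ Finset.range d, ∑ z ∈ Finset.HasAntidiagonal.antidiagonal b,
        f z.1 z.2 (Y.D i z.1 (Y.D j z.2 v)) := by
  simp_rw [Finset.Nat.sum_antidiagonal_eq_sum_range_succ_mk]
  rw [Finset.sum_range_diag_flip d fun x y => f x y (Y.D i x (Y.D j y v))]
  refine Finset.sum_congr rfl fun x hx => ?_
  rw [Finset.mem_range] at hx
  refine (Finset.sum_subset (Finset.range_mono (Nat.sub_le d x)) fun y _ hy => ?_).symm
  rw [Finset.mem_range, not_lt] at hy
  have h1 := fockLowers_mul _ _ _ _ (Y.lowers i x) (Y.lowers j y)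
  rw [← Module.End.mul_apply (Y.D i x), h1.apply_eq_zero hv (by omega), map_zero]

/-- Summing over k leaves only the total degree a + b fixed, so the left side is the coefficient of
z^(a+b) in the product of the creation parts at αz and βz; by `hG` that product is G. -/
theorem finsum_extZero_mul (i j : J) (α β : L) (a b : ℤ)
    (G : ℕ → Module.End L (Fock n L))
    (hG : ∀ m, G m = ∑ z ∈ Finset.HasAntidiagonal.antidiagonal m,
      (α ^ z.1 * β ^ z.2) • (Y.g i z.1 * Y.g j z.2)) (w : Fock n L) :
    ∑ᶠ k : ℤ, (α ^ (a + k) * β ^ (b - k)) • extZero (Y.g i) (a + k) (extZero (Y.g j) (b - k) w) =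
      extZero G (a + b) w := by
  have h1 : ∑ᶠ k : ℤ, (α ^ (a + k) * β ^ (b - k)) •
        extZero (Y.g i) (a + k) (extZero (Y.g j) (b - k) w) =
      ∑ᶠ k : ℤ, (α ^ k * β ^ (a + b - k)) • extZero (Y.g i) k (extZero (Y.g j) (a + b - k) w) := by
    refine (finsum_congr fun k => ?_).trans (finsum_comp_equiv (Equiv.addLeft a))
    rw [Equiv.coe_addLeft, add_sub_add_left_eq_sub]
  rw [h1]
  rcases lt_or_ge (a + b) 0 with h | h
  · rw [extZero_of_neg _ h, finsum_eq_zero_of_forall_eq_zero]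
    · rfl
    · intro k
      rcases lt_or_ge k 0 with hk | hk
      · rw [extZero_of_neg _ hk]
        simp
      · rw [extZero_of_neg (Y.g j) (show a + b - k < 0 by omega)]
        simp
  · obtain ⟨m, hm⟩ := Int.eq_ofNat_of_zero_le h
    rw [hm, extZero_natCast, hG, LinearMap.sum_apply,
      Finset.Nat.sum_antidiagonal_eq_sum_range_succ_mk,
      finsum_eq_sum_of_support_subset (s := (Finset.range (m + 1)).map Nat.castEmbedding),
      Finset.sum_map]
    · refine Finset.sum_congr rfl fun k hk => ?_
      rw [Finset.mem_range] at hk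
      rw [Nat.castEmbedding_apply, ← Nat.cast_sub (by omega), extZero_natCast, extZero_natCast,
        zpow_natCast, zpow_natCast]
      rfl
    · intro k hk
      rw [Function.mem_support] at hk
      have h0 : 0 ≤ k := by
        by_contra h'
        exact hk (by rw [extZero_of_neg _ (not_le.mp h')]; simp)
      have h2 : 0 ≤ m - k := by
        by_contra h'
        exact hk (by rw [extZero_of_neg (Y.g j) (not_le.mp h')]; simp)
      lift k to ℕ using h0
      simp only [Finset.coe_map, Nat.castEmbedding_apply, Finset.coe_range, Set.mem_image,
        Set.mem_Iio, Nat.cast_inj, exists_eq_right]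
      omega

/-- Specialization of a normal ordered product along a line. -/
theorem finsum_normal₂ (i j : J) (α β : L) (hα : α ≠ 0) (hβ : β ≠ 0) (a b : ℤ) {d : ℕ}
    {v : Fock n L} (hv : v ∈ fockBelow n L d) (G Δ : ℕ → Module.End L (Fock n L))
    (hG : ∀ m, G m = ∑ z ∈ Finset.HasAntidiagonal.antidiagonal m,
      (α ^ z.1 * β ^ z.2) • (Y.g i z.1 * Y.g j z.2))
    (hΔ : ∀ m, Δ m = ∑ z ∈ Finset.HasAntidiagonal.antidiagonal m,
      (α⁻¹ ^ z.1 * β⁻¹ ^ z.2) • (Y.D i z.1 * Y.D j z.2)) :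
    ∑ᶠ k : ℤ, (α ^ (a + k) * β ^ (b - k)) • Y.normal₂ d i j (a + k) (b - k) v =
      ∑ x ∈ Finset.range d, extZero G (a + b + x) (Δ x v) := by
  -- The weight α^(a+k) splits as α^(a+x+k) α^(-x): one factor for the creation mode, one for the
  -- annihilation mode, and likewise for β. This is the origin of the inverses in `hΔ`.
  have h1 : ∀ k : ℤ, (α ^ (a + k) * β ^ (b - k)) • Y.normal₂ d i j (a + k) (b - k) v =
      ∑ z ∈ Finset.range d ×ˢ Finset.range d, (α⁻¹ ^ z.1 * β⁻¹ ^ z.2) •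
        (α ^ (a + z.1 + k) * β ^ (b + z.2 - k)) • extZero (Y.g i) (a + z.1 + k)
          (extZero (Y.g j) (b + z.2 - k) (Y.D i z.1 (Y.D j z.2 v))) := by
    intro k
    rw [normal₂, Finset.sum_product, Finset.smul_sum]
    refine Finset.sum_congr rfl fun x _ => ?_
    rw [Finset.smul_sum]
    refine Finset.sum_congr rfl fun y _ => ?_
    rw [smul_smul, add_right_comm a x k, add_sub_right_comm b y k, zpow_add₀ hα, zpow_add₀ hα,
      zpow_add₀ hα, zpow_add₀ hβ (b - k), zpow_natCast, zpow_natCast, inv_pow, inv_pow]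
    congr 1
    field_simp
  have hfin : ∀ z ∈ Finset.range d ×ˢ Finset.range d, (Function.support fun k : ℤ =>
      (α⁻¹ ^ z.1 * β⁻¹ ^ z.2) • (α ^ (a + z.1 + k) * β ^ (b + z.2 - k)) •
        extZero (Y.g i) (a + z.1 + k)
          (extZero (Y.g j) (b + z.2 - k) (Y.D i z.1 (Y.D j z.2 v)))).Finite := by
    intro z _
    refine (Set.finite_Icc (-(a + z.1)) (b + z.2)).subset fun k hk => ?_
    rw [Function.mem_support] at hk
    constructor
    · by_contra h
      exact hk (by rw [extZero_of_neg _ (by omega)]; simp)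
    · by_contra h
      exact hk (by rw [extZero_of_neg (Y.g j) (by omega)]; simp)
  rw [finsum_congr h1, finsum_sum_comm _ _ hfin]
  have h2 : ∀ z ∈ Finset.range d ×ˢ Finset.range d, ∑ᶠ k : ℤ,
      (α⁻¹ ^ z.1 * β⁻¹ ^ z.2) • (α ^ (a + z.1 + k) * β ^ (b + z.2 - k)) •
        extZero (Y.g i) (a + z.1 + k)
          (extZero (Y.g j) (b + z.2 - k) (Y.D i z.1 (Y.D j z.2 v))) =
      ((α⁻¹ ^ z.1 * β⁻¹ ^ z.2) • extZero G (a + b + ((z.1 + z.2 : ℕ) : ℤ)))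
        (Y.D i z.1 (Y.D j z.2 v)) := by
    intro z _
    rw [← smul_finsum, Y.finsum_extZero_mul i j α β _ _ G hG, LinearMap.smul_apply]
    congr 3
    push_cast
    ring
  rw [Finset.sum_congr rfl h2, Finset.sum_product, Y.sum_box_eq d i j hv fun x y =>
    (α⁻¹ ^ x * β⁻¹ ^ y) • extZero G (a + b + ((x + y : ℕ) : ℤ))]
  refine Finset.sum_congr rfl fun x _ => ?_
  rw [hΔ, LinearMap.sum_apply, map_sum]
  refine Finset.sum_congr rfl fun z hz => ?_
  rw [Finset.HasAntidiagonal.mem_antidiagonal.mp hz, LinearMap.smul_apply, LinearMap.smul_apply,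
    map_smul, Module.End.mul_apply]

/-- The analytic core of the Serre relation. -/
theorem serre_kernel {a b δ : ℤ → L} {Q w τ : L} (hQ : Q ≠ 0)
    (ha : ∀ k, a k = Q * w * a (k - 1) + τ * δ k)
    (hb : ∀ k, b k = Q⁻¹ * w * b (k - 1) - Q⁻¹ * τ * δ k) {P : ℤ → ℤ → L}
    (hP : ∀ k l, P k l = a k * a l + (Q + Q⁻¹) * (a k * b l) + b k * b l) (k l : ℤ) :
    (P k (l - 2) - (1 + Q ^ 2) * P (k - 1) (l - 1) + Q ^ 2 * P (k - 2) l) +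
      (P l (k - 2) - (1 + Q ^ 2) * P (l - 1) (k - 1) + Q ^ 2 * P (l - 2) k) = 0 := by
  -- For P(x, y) = ∑ P_{kl} x^k y^l this says that (y - Q²x) P is symmetric. The claim concerns (y -
  -- x)(y - Q²x) P, which is then antisymmetric and cancels against its transpose.
  have g : ∀ k l, P k (l - 1) - Q ^ 2 * P (k - 1) l = P l (k - 1) - Q ^ 2 * P (l - 1) k := by
    intro k l
    simp only [hP]
    rw [ha k, ha l, hb k, hb l]
    field_simp
    ring
  have h1 := g k (l - 1)
  have h2 := g (k - 1) l
  rw [sub_sub, one_add_one_eq_two] at h1 h2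
  linear_combination h1 - h2

theorem sum_range_three {V : Type*} [AddCommGroup V] (f : ℕ → V) {B : ℕ} (hB : 3 ≤ B)
    (hf : ∀ k, 3 ≤ k → f k = 0) : ∑ k ∈ Finset.range B, f k = f 0 + f 1 + f 2 := by
  rw [← Finset.sum_subset (Finset.range_mono hB) fun k _ hk => hf k (by simpa using hk)]
  simp [Finset.sum_range_succ]

/-- The coefficients of `(1 - u) (1 - p u)`. -/
def quadCoeff (p : L) (k : ℕ) : L :=
  if k = 0 then 1 else if k = 1 then -(1 + p) else if k = 2 then p else 0

theorem quadCoeff_of_ge (p : L) {k : ℕ} (hk : 3 ≤ k) : quadCoeff p k = 0 := by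
  unfold quadCoeff
  rw [if_neg (by omega), if_neg (by omega), if_neg (by omega)]

theorem extZero_pow_rec (r : L) (k : ℤ) : extZero (fun k => r ^ k) k =
    r * extZero (fun k => r ^ k) (k - 1) + if k = 0 then 1 else 0 := by
  rcases lt_trichotomy k 0 with h | h | h
  · rw [extZero_of_neg _ h, extZero_of_neg _ (by omega), if_neg h.ne]
    simp
  · rw [h, extZero_of_neg (m := 0 - 1) _ (by omega)]
    simp [extZero]
  · obtain ⟨m, rfl⟩ : ∃ m : ℕ, k = (m + 1 : ℕ) := ⟨(k - 1).toNat, by omega⟩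
    rw [extZero_natCast, if_neg h.ne', show (((m + 1 : ℕ) : ℤ) - 1) = (m : ℤ) by simp,
      extZero_natCast, pow_succ']
    simp

/-- The coefficients of the expansion of `τ (1 - Q τ² u)⁻¹` at `u = 0`. -/
def serreLeft (Q τ : L) (k : ℤ) : L := τ * extZero (fun k => (Q * τ ^ 2) ^ k) k

/-- The coefficients of the expansion at `u = ∞` that corresponds to `serreLeft`. -/
def serreRight (Q τ : L) (k : ℤ) : L := τ⁻¹ * extZero (fun k => (Q * (τ ^ 2)⁻¹) ^ k) (-1 - k)

/-- The two-variable generating function of the three terms of a Serre relation. -/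
def serreProd (Q τ : L) (k l : ℤ) : L :=
  serreLeft Q τ k * serreLeft Q τ l + (Q + Q⁻¹) * (serreLeft Q τ k * serreRight Q τ l) +
    serreRight Q τ k * serreRight Q τ l

/-- The two recursions express that `serreLeft` expands τ/(1 - Qτ²u) at 0 and `serreRight` expands
-Q⁻¹τ/(1 - Q⁻¹τ²u) at ∞; these are the hypotheses of `serre_kernel` with w = τ². -/
theorem serreProd_antisymm {Q τ : L} (hQ : Q ≠ 0) (hτ : τ ≠ 0) (k l : ℤ) :
    (serreProd Q τ k (l - 2) - (1 + Q ^ 2) * serreProd Q τ (k - 1) (l - 1) +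
        Q ^ 2 * serreProd Q τ (k - 2) l) +
      (serreProd Q τ l (k - 2) - (1 + Q ^ 2) * serreProd Q τ (l - 1) (k - 1) +
        Q ^ 2 * serreProd Q τ (l - 2) k) = 0 := by
  refine serre_kernel (a := serreLeft Q τ) (b := serreRight Q τ) (w := τ ^ 2) (τ := τ)
    (δ := fun k => if k = 0 then 1 else 0) hQ (fun k => ?_) (fun k => ?_) (fun _ _ => rfl) k l
  · simp only [serreLeft]
    rw [extZero_pow_rec]
    ring
  · simp only [serreRight]
    rw [show -1 - (k - 1) = -k by ring, extZero_pow_rec _ (-k), show -k - 1 = -1 - k by ring]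
    simp only [neg_eq_zero]
    field_simp
    ring

/-- The words iij, iji, jii are reduced to one family of normally ordered products; k and l are the
offsets of the exponents of the two i-factors. The mode shifts on the left are those that the
lattice factor creates from a_ii = 2 and a_ij = -1. The contraction of the two i-factors, (1 - u)(1
- Q²u), produces the three-term combination on the right. -/
theorem serre_half (i j : J) {Q τ : L} (hτ : τ ≠ 0)
    (hii : ∀ k, Y.c i i k = quadCoeff (Q ^ 2) k)
    (hij : ∀ k, Y.c i j k = (Q * τ ^ 2) ^ k) (hji : ∀ k, Y.c j i k = (Q * (τ ^ 2)⁻¹) ^ k)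
    (a b c : ℤ) {d R : ℕ} (hR : |a| + |b| + |c| + 3 * d + 10 ≤ R) {v : Fock n L}
    (hd : v ∈ fockBelow n L d) :
    τ ^ 2 • Y.op i (a - 1) (Y.op i (b + 1) (Y.op j c v)) +
      (Q + Q⁻¹) • Y.op i (a - 1) (Y.op j (c + 1) (Y.op i b v)) +
      (τ ^ 2)⁻¹ • Y.op j (c + 2) (Y.op i (a - 2) (Y.op i b v)) =
    ∑ k ∈ Finset.Icc (-(R : ℤ)) R, ∑ l ∈ Finset.Icc (-(R : ℤ)) R,
      (serreProd Q τ k (l - 2) - (1 + Q ^ 2) * serreProd Q τ (k - 1) (l - 1) +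
        Q ^ 2 * serreProd Q τ (k - 2) l) •
        Y.normal₃ d i i j (a - 1 + k) (b - 1 + l) (c + 2 - k - l) v := by
  set A : ℤ → L := extZero fun k => (Q * τ ^ 2) ^ k with hA
  set A' : ℤ → L := extZero fun k => (Q * (τ ^ 2)⁻¹) ^ k with hA'
  set S : Finset ℤ := Finset.Icc (-(R : ℤ)) R with hS
  set F : ℤ → ℤ → Fock n L := fun k l =>
    Y.normal₃ d i i j (a - 1 + k) (b - 1 + l) (c + 2 - k - l) v with hF
  have ha := abs_le.mp (le_refl |a|)
  have hb := abs_le.mp (le_refl |b|)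
  have hc := abs_le.mp (le_refl |c|)
  -- The three exponents have a sum independent of k and l. Outside the box one of them is so
  -- negative that the normally ordered product vanishes.
  have hF0 : ∀ k l, (k ∉ S ∨ l ∉ S) → F k l = 0 := by
    intro k l hk
    rw [hS, Finset.mem_Icc, Finset.mem_Icc, not_and_or, not_and_or, not_le, not_le, not_le,
      not_le] at hk
    simp only [hF]
    rcases le_or_gt (a - 1 + k + d) 0 with h1 | h1
    · exact Y.normal₃_eq_zero_left h1
    rcases le_or_gt (b - 1 + l + d) 0 with h2 | h2
    · exact Y.normal₃_eq_zero_mid h2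
    · exact Y.normal₃_eq_zero_right (by omega)
  have hF1 : ∀ k l, k ∉ S → F k l = 0 := fun k l h => hF0 k l (Or.inl h)
  have hF2 : ∀ k l, l ∉ S → F k l = 0 := fun k l h => hF0 k l (Or.inr h)
  have up : ∀ (r : L) (o : ℤ) (B : ℕ), -2 ≤ o → (R : ℤ) + 5 ≤ B → ∀ G : ℤ → Fock n L,
      (∀ k, k ∉ S → G k = 0) → ∑ k ∈ Finset.range B, r ^ k • G (o + k) =
        ∑ k ∈ S, extZero (fun k => r ^ k) (k - o) • G k := fun r o B ho hB G hG =>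
    sum_range_shift _ G o B S (fun k hk => hG _ (by rw [hS, Finset.mem_Icc]; omega)) hG
  have down : ∀ (r : L) (o : ℤ) (B : ℕ), o ≤ 2 → (R : ℤ) + 5 ≤ B → ∀ G : ℤ → Fock n L,
      (∀ k, k ∉ S → G k = 0) → ∑ k ∈ Finset.range B, r ^ k • G (o - k) =
        ∑ k ∈ S, extZero (fun k => r ^ k) (o - k) • G k := fun r o B ho hB G hG =>
    sum_range_shift_neg _ G o B S (fun k hk => hG _ (by rw [hS, Finset.mem_Icc]; omega)) hG
  set B' : ℕ := R + 5 with hB'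
  set B : ℕ := 2 * R + 2 * B' with hB
  have e1 : Y.op i (a - 1) (Y.op i (b + 1) (Y.op j c v)) =
      ∑ u ∈ Finset.range B, quadCoeff (Q ^ 2) u • ∑ k ∈ S, ∑ l ∈ S,
        (A (k - u) * A (l - (2 - u))) • F k l := by
    rw [Y.op_op_op hd i i j (a - 1) (b + 1) c (B := B) (B' := B') (by omega) (by omega)]
    refine Finset.sum_congr rfl fun u _ => ?_
    by_cases hu : 3 ≤ u
    · simp [hii, quadCoeff_of_ge _ hu]
    rw [← sum_range_range (up _ u B' (by omega) (by omega)) (up _ (2 - u) B' (by omega) (by omega))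
      F hF1 hF2, Finset.smul_sum]
    refine Finset.sum_congr rfl fun r _ => ?_
    rw [Finset.smul_sum]
    refine Finset.sum_congr rfl fun s _ => ?_
    rw [smul_smul, hii, hij, hij, mul_assoc]
    simp only [hF]
    congr 2 <;> ring
  have e2 : Y.op i (a - 1) (Y.op j (c + 1) (Y.op i b v)) =
      ∑ u ∈ Finset.range B', quadCoeff (Q ^ 2) u • ∑ k ∈ S, ∑ l ∈ S,
        (A (k - u) * A' (1 - u - l)) • F k l := by
    rw [Y.op_op_op hd i j i (a - 1) (c + 1) b (B := B) (B' := B') (by omega) (by omega),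
      Finset.sum_comm]
    refine Finset.sum_congr rfl fun u _ => ?_
    by_cases hu : 3 ≤ u
    · simp [hii, quadCoeff_of_ge _ hu]
    rw [← sum_range_range (up _ u B (by omega) (by omega)) (down _ (1 - u) B' (by omega) (by omega))
      F hF1 hF2, Finset.smul_sum]
    refine Finset.sum_congr rfl fun r _ => ?_
    rw [Finset.smul_sum]
    refine Finset.sum_congr rfl fun s _ => ?_
    rw [smul_smul, hii, hij, hji, mul_comm ((Q * τ ^ 2) ^ r), mul_assoc, Y.normal₃_comm_right]
    simp only [hF]
    congr 2 <;> ring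
  have e3 : Y.op j (c + 2) (Y.op i (a - 2) (Y.op i b v)) =
      ∑ u ∈ Finset.range B', quadCoeff (Q ^ 2) u • ∑ k ∈ S, ∑ l ∈ S,
        (A' (u - 1 - k) * A' (1 - u - l)) • F k l := by
    rw [Y.op_op_op hd j i i (c + 2) (a - 2) b (B := B) (B' := B') (by omega) (by omega),
      Finset.sum_congr rfl fun k _ => Finset.sum_comm, Finset.sum_comm]
    refine Finset.sum_congr rfl fun u _ => ?_
    by_cases hu : 3 ≤ u
    · simp [hii, quadCoeff_of_ge _ hu]
    rw [← sum_range_range (down _ (u - 1) B (by omega) (by omega))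
      (down _ (1 - u) B' (by omega) (by omega)) F hF1 hF2, Finset.smul_sum]
    refine Finset.sum_congr rfl fun r _ => ?_
    rw [Finset.smul_sum]
    refine Finset.sum_congr rfl fun s _ => ?_
    rw [smul_smul, hii, hji, hji, mul_comm _ (quadCoeff (Q ^ 2) u), Y.normal₃_comm_left,
      Y.normal₃_comm_right]
    simp only [hF]
    congr 2 <;> ring
  have three : ∀ {B : ℕ} (f : ℕ → Fock n L), 3 ≤ B →
      ∑ u ∈ Finset.range B, quadCoeff (Q ^ 2) u • f u =
        f 0 - (1 + Q ^ 2) • f 1 + Q ^ 2 • f 2 := by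
    intro B f hB
    rw [sum_range_three _ hB fun k hk => by rw [quadCoeff_of_ge _ hk, zero_smul]]
    simp only [quadCoeff, if_true, one_ne_zero, if_false, OfNat.ofNat_ne_zero, OfNat.ofNat_ne_one]
    module
  rw [e1, e2, e3, three _ (by omega), three _ (by omega), three _ (by omega)]
  -- All three words now range over the same normally ordered products, and only the scalar
  -- coefficients remain to be matched.
  simp only [Finset.smul_sum, ← Finset.sum_add_distrib, ← Finset.sum_sub_distrib]
  refine Finset.sum_congr rfl fun k _ => Finset.sum_congr rfl fun l _ => ?_
  simp only [smul_smul, ← add_smul, ← sub_smul]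
  congr 1
  simp only [serreProd, serreLeft, serreRight, ← hA, ← hA']
  rw [show -1 - (l - 2) = 1 - ((0 : ℕ) : ℤ) - l by push_cast; ring,
    show -1 - (l - 1) = 1 - ((1 : ℕ) : ℤ) - l by push_cast; ring,
    show -1 - l = 1 - ((2 : ℕ) : ℤ) - l by push_cast; ring,
    show -1 - k = ((0 : ℕ) : ℤ) - 1 - k by push_cast; ring,
    show -1 - (k - 1) = ((1 : ℕ) : ℤ) - 1 - k by push_cast; ring,
    show -1 - (k - 2) = ((2 : ℕ) : ℤ) - 1 - k by push_cast; ring,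
    show l - (2 - ((0 : ℕ) : ℤ)) = l - 2 by push_cast; ring,
    show l - (2 - ((1 : ℕ) : ℤ)) = l - 1 by push_cast; ring,
    show l - (2 - ((2 : ℕ) : ℤ)) = l by push_cast; ring]
  simp only [Nat.cast_zero, Nat.cast_one, Nat.cast_ofNat, sub_zero]
  field_simp
  ring

/-- The Serre relation for vertex operators, for the contraction coefficients
`(1 - u) (1 - Q ^ 2 u)`, `(1 - Q w u)⁻¹`, `(1 - Q w⁻¹ u)⁻¹`. -/
theorem serre (i j : J) {Q τ : L} (hQ : Q ≠ 0) (hτ : τ ≠ 0)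
    (hii : ∀ k, Y.c i i k = quadCoeff (Q ^ 2) k)
    (hij : ∀ k, Y.c i j k = (Q * τ ^ 2) ^ k) (hji : ∀ k, Y.c j i k = (Q * (τ ^ 2)⁻¹) ^ k)
    (a b c : ℤ) (v : Fock n L) :
    (τ ^ 2 • Y.op i (a - 1) (Y.op i (b + 1) (Y.op j c v)) +
      (Q + Q⁻¹) • Y.op i (a - 1) (Y.op j (c + 1) (Y.op i b v)) +
      (τ ^ 2)⁻¹ • Y.op j (c + 2) (Y.op i (a - 2) (Y.op i b v))) +
    (τ ^ 2 • Y.op i (b - 1) (Y.op i (a + 1) (Y.op j c v)) +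
      (Q + Q⁻¹) • Y.op i (b - 1) (Y.op j (c + 1) (Y.op i a v)) +
      (τ ^ 2)⁻¹ • Y.op j (c + 2) (Y.op i (b - 2) (Y.op i a v))) = 0 := by
  obtain ⟨d, hd⟩ := exists_mem_fockBelow v
  obtain ⟨R, hR⟩ : ∃ R : ℕ, |a| + |b| + |c| + 3 * d + 10 ≤ R :=
    ⟨(|a| + |b| + |c| + 3 * d + 10).toNat, by omega⟩
  rw [Y.serre_half i j hτ hii hij hji a b c hR hd,
    Y.serre_half i j hτ hii hij hji b a c (R := R) (by omega) hd,
    Finset.sum_comm (s := Finset.Icc (-(R : ℤ)) R) (f := fun k l => _ • Y.normal₃ d i i j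
      (b - 1 + k) (a - 1 + l) (c + 2 - k - l) v), ← Finset.sum_add_distrib]
  refine Finset.sum_eq_zero fun k _ => ?_
  rw [← Finset.sum_add_distrib]
  refine Finset.sum_eq_zero fun l _ => ?_
  -- In the half with a and b exchanged, the roles of k and l are exchanged as well, so the two
  -- kernels meet on the same normally ordered product.
  rw [Y.normal₃_comm_left d i i j (b - 1 + l), sub_right_comm, ← add_smul,
    serreProd_antisymm hQ hτ, zero_smul]

end VertexFamily
end

noncomputable section

/-! ### Closed forms of the scalar exponentials -/

section ScalarExp

open PowerSeries

variable {L : Type*} [Field L] [CharZero L]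

/-- The exponent is -log(1 - ρu); the geometric series satisfies the corresponding Euler equation.
-/
theorem expCoeff_geom (ρ : L) (m : ℕ) :
    expCoeff L (fun k => (k : L)⁻¹ * ρ ^ k) m = ρ ^ m := by
  have h : (PowerSeries.mk fun m => ρ ^ m) = expSeries L (fun k => (k : L)⁻¹ * ρ ^ k) := by
    refine eq_expSeries L (fun _ _ => Commute.all _ _) ?_ (by simp)
    ext m
    rw [coeff_euler, coeff_mul, coeff_mk]
    have h1 : ∀ z ∈ Finset.HasAntidiagonal.antidiagonal m,
        coeff z.1 (euler (posSeries fun k => (k : L)⁻¹ * ρ ^ k)) * coeff z.2 (mk fun m => ρ ^ m) =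
          if z.1 = 0 then 0 else ρ ^ m := by
      intro z hz
      rw [coeff_euler, coeff_posSeries, coeff_mk]
      split_ifs with h0
      · simp
      · have : (z.1 : L) ≠ 0 := by exact_mod_cast h0
        rw [nsmul_eq_mul, mul_inv_cancel_left₀ this, ← pow_add,
          Finset.HasAntidiagonal.mem_antidiagonal.mp hz]
    rw [Finset.sum_congr rfl h1, Finset.Nat.sum_antidiagonal_eq_sum_range_succ_mk,
      Finset.sum_range_succ']
    simp
  rw [← coeff_expSeries, ← h, coeff_mk]

/-- The coefficients of `1 - ρ u`. -/
def linCoeff (ρ : L) (k : ℕ) : L := if k = 0 then 1 else if k = 1 then -ρ else 0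

theorem expCoeff_linear (ρ : L) (m : ℕ) :
    expCoeff L (fun k => -((k : L)⁻¹ * ρ ^ k)) m = linCoeff ρ m := by
  have h1 : (1 - C ρ * X : PowerSeries L) * expSeries L (fun k => (k : L)⁻¹ * ρ ^ k) = 1 := by
    ext m
    rw [sub_mul, one_mul, map_sub, mul_assoc, coeff_C_mul, coeff_expSeries, expCoeff_geom]
    rcases m with _ | m
    · simp
    · rw [mul_comm X, coeff_succ_mul_X, coeff_expSeries, expCoeff_geom, coeff_one]
      simp [pow_succ']
  have h2 := expSeries_add L (x := fun k => (k : L)⁻¹ * ρ ^ k)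
    (y := fun k => -((k : L)⁻¹ * ρ ^ k)) (fun _ _ => Commute.all _ _) (fun _ _ => Commute.all _ _)
    (fun _ _ => Commute.all _ _)
  have h3 : expSeries L (fun k : ℕ => (k : L)⁻¹ * ρ ^ k + -((k : L)⁻¹ * ρ ^ k)) = 1 := by
    ext m
    simp_rw [add_neg_cancel]
    rw [coeff_expSeries, expCoeff_zero_seq, coeff_one]
  rw [h3] at h2
  have h4 := left_inv_eq_right_inv h1 h2
  rw [← coeff_expSeries, ← h4, linCoeff]
  rcases m with _ | _ | m <;> simp [coeff_one, coeff_succ_mul_X]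

theorem expCoeff_quad (p : L) (m : ℕ) :
    expCoeff L (fun k => -((k : L)⁻¹ * 1 ^ k) + -((k : L)⁻¹ * p ^ k)) m =
      VertexFamily.quadCoeff p m := by
  rw [expCoeff_add L (fun _ _ => Commute.all _ _) (fun _ _ => Commute.all _ _)
    (fun _ _ => Commute.all _ _)]
  simp_rw [expCoeff_linear]
  rw [Finset.Nat.sum_antidiagonal_eq_sum_range_succ_mk]
  rcases m with _ | _ | _ | m
  · simp [linCoeff, VertexFamily.quadCoeff]
  · simp [linCoeff, VertexFamily.quadCoeff, Finset.sum_range_succ]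
  · simp [linCoeff, VertexFamily.quadCoeff, Finset.sum_range_succ]
  · rw [VertexFamily.quadCoeff_of_ge _ (by omega)]
    refine Finset.sum_eq_zero fun k _ => ?_
    unfold linCoeff
    split_ifs <;> first | omega | simp

/-- The product of two geometric series has the coefficient ∑ q^k q^(-(m-k)), which telescopes to [m
+ 1]. -/
theorem expCoeff_geom_geom {q : L} (hq1 : q - q⁻¹ ≠ 0) (m : ℕ) :
    expCoeff L (fun k => (k : L)⁻¹ * q ^ k + (k : L)⁻¹ * q⁻¹ ^ k) m = qInt q (m + 1) := by
  rw [expCoeff_add L (fun _ _ => Commute.all _ _) (fun _ _ => Commute.all _ _)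
    (fun _ _ => Commute.all _ _)]
  simp_rw [expCoeff_geom]
  rw [Finset.Nat.sum_antidiagonal_eq_sum_range_succ_mk, qInt, eq_div_iff hq1]
  have := (Commute.all q q⁻¹).geom_sum₂_mul (m + 1)
  simp only [Nat.add_sub_cancel] at this
  rw [this, zpow_neg]
  norm_cast
  rw [inv_pow]

end ScalarExp

/-! ### Contraction coefficients of the currents E and F -/

section FockFamily

variable {n : ℕ} {L : Type*} [Field L] [CharZero L] (s t : L)
  (M : Matrix (Fin (n + 1)) (Fin (n + 1)) ℤ)

/-- The coefficients of the exponents of the vertex operators `E_i(z)` (`e = 1`) and `F_i(z)`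
(`e = -1`). -/
def vertexCoeff (e : ℤˣ) (k : ℕ) : L := ((e : ℤ) : L) * (s ^ (-(e : ℤ))) ^ k / qInt (s ^ 2) k

/-- The scalar `[H_{i,k}, H_{j,-k}]`. -/
def heisScalar (q κ : L) (i j : Fin (n + 1)) (k : ℕ) : L :=
  (k : L)⁻¹ * qInt q (k * affCartan n i j) * qInt q k * κ ^ (-(k : ℤ) * M i j)

/-- The vertex operators `E_i(z)` and `F_i(z)` on the Fock space. -/
def fockFamily : VertexFamily n L (Fin (n + 1) × ℤˣ) where
  g x := expCoeff L fun k => vertexCoeff s x.2 k • fockH (s ^ 2) (t ^ 2) M x.1 (-(k : ℤ))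
  D x := expCoeff L fun k => (-vertexCoeff s x.2 k) • fockH (s ^ 2) (t ^ 2) M x.1 (k : ℤ)
  c x y := expCoeff L fun k =>
    -(vertexCoeff s x.2 k * vertexCoeff s y.2 k * heisScalar M (s ^ 2) (t ^ 2) x.1 y.1 k)
  lowers x := fockLowers_expCoeff _ fun k hk => fockLowers_smul _ _ _ (fockLowers_fockH _ _ M _ k hk)
  commute_g x y := commute_expCoeff L fun k r =>
    ((commute_fockH_neg _ _ M _ _ k r).smul_left _).smul_right _
  commute_D x y := commute_expCoeff L fun k r =>
    ((commute_fockH_pos _ _ M _ _ k r).smul_left _).smul_right _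
  contract x y := by
    refine expCoeff_mul_expCoeff L (fun k r => ((commute_fockH_neg _ _ M _ _ k r).smul_left _).smul_right _)
      (fun k r => ((commute_fockH_pos _ _ M _ _ k r).smul_left _).smul_right _) fun k r hk hr => ?_
    rw [smul_mul_smul_comm, smul_mul_smul_comm, fockH_pos_mul_neg _ _ M _ _ k r hk hr, smul_add,
      mul_comm (-vertexCoeff s x.2 k)]
    congr 1
    split_ifs with h
    · rw [h, Algebra.smul_def, ← map_mul]
      congr 1
      unfold heisScalar
      ring
    · rw [smul_zero]

theorem fockE_eq_op (i : Fin (n + 1)) (a : ℤ) :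
    fockE s t M i a = (fockFamily s t M).op (i, 1) a := by
  have h : ∀ k : ℕ, (s⁻¹) ^ k / qInt (s ^ 2) k = vertexCoeff s 1 k := fun k => by
    simp [vertexCoeff]
  unfold fockE VertexFamily.op fockFamily
  simp only [h]

theorem fockF_eq_op (i : Fin (n + 1)) (a : ℤ) :
    fockF s t M i a = (fockFamily s t M).op (i, -1) a := by
  have h : ∀ k : ℕ, s ^ k / qInt (s ^ 2) k = -vertexCoeff s (-1) k := fun k => by
    simp [vertexCoeff, neg_div]
  unfold fockF VertexFamily.op fockFamily
  simp only [h, neg_neg]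

variable {s t M}

/-- The factor [k] of the Heisenberg commutator cancels one of the two denominators [k]. The
remaining quotient [k a_ij]/[k] is elementary for a_ij = 0, -1, 2, and this makes the contraction a
rational function. -/
theorem contraction_exponent (hs : s ≠ 0) (ht : t ≠ 0) (hq : ∀ k : ℕ, k ≠ 0 → qInt (s ^ 2) k ≠ 0)
    (i j : Fin (n + 1)) (e f : ℤˣ) (k : ℕ) (hk : k ≠ 0) :
    -(vertexCoeff s e k * vertexCoeff s f k * heisScalar M (s ^ 2) (t ^ 2) i j k) =
      -((e * f : ℤ) : L) * ((k : L)⁻¹ * (qInt (s ^ 2) (k * affCartan n i j) / qInt (s ^ 2) k) *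
        (s ^ (-(e : ℤ) - f) * (t ^ (-M i j)) ^ 2) ^ k) := by
  have h1 := hq k hk
  have h2 : (t ^ 2) ^ (-(k : ℤ) * M i j) = ((t ^ (-M i j)) ^ 2) ^ k := by
    rw [← pow_mul, ← zpow_natCast t 2, ← zpow_natCast (t ^ (-M i j)), ← zpow_mul, ← zpow_mul]
    congr 1
    push_cast
    ring
  have h3 : s ^ (-(e : ℤ) - f) = s ^ (-(e : ℤ)) * s ^ (-(f : ℤ)) := by
    rw [← zpow_add₀ hs, sub_eq_add_neg]
  unfold vertexCoeff heisScalar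
  rw [h2, h3, mul_pow, mul_pow]
  push_cast
  field_simp

theorem qInt_mul_neg_one {L : Type*} [Field L] (q : L) (k : ℤ) :
    qInt q (k * -1) = -qInt q k := by
  rw [mul_neg_one, qInt_neg]

theorem qInt_mul_two {L : Type*} [Field L] {q : L} (hq : q ≠ 0) (k : ℤ) :
    qInt q (k * 2) = qInt q k * (q ^ k + q ^ (-k)) := by
  unfold qInt
  rw [mul_two, neg_add, zpow_add₀ hq, zpow_add₀ hq]
  ring

theorem fockFamily_c_of_zero (hs : s ≠ 0) (ht : t ≠ 0)
    (hq : ∀ k : ℕ, k ≠ 0 → qInt (s ^ 2) k ≠ 0) (i j : Fin (n + 1)) (e f : ℤˣ)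
    (ha : affCartan n i j = 0) (k : ℕ) :
    (fockFamily s t M).c (i, e) (j, f) k = if k = 0 then 1 else 0 := by
  rw [← expCoeff_zero_seq L]
  refine expCoeff_congr L (fun k hk => ?_) k
  rw [contraction_exponent hs ht hq i j e f k hk, ha]
  simp [qInt]

theorem fockFamily_c_of_neg_one_same (hs : s ≠ 0) (ht : t ≠ 0)
    (hq : ∀ k : ℕ, k ≠ 0 → qInt (s ^ 2) k ≠ 0) (i j : Fin (n + 1)) (e : ℤˣ)
    (ha : affCartan n i j = -1) (k : ℕ) :
    (fockFamily s t M).c (i, e) (j, e) k =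
      ((s ^ 2) ^ (-(e : ℤ)) * (t ^ (-M i j)) ^ 2) ^ k := by
  rw [← expCoeff_geom]
  refine expCoeff_congr L (fun k hk => ?_) k
  have h1 := hq k hk
  have h2 : s ^ (-(e : ℤ) - e) = (s ^ 2) ^ (-(e : ℤ)) := by
    rw [← zpow_natCast s 2, ← zpow_mul]
    congr 1
    push_cast
    ring
  have h3 : ((e * e : ℤ) : L) = 1 := by
    rcases Int.units_eq_one_or e with rfl | rfl <;> simp
  rw [contraction_exponent hs ht hq i j e e k hk, ha, qInt_mul_neg_one, h2, h3]
  field_simp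

theorem fockFamily_c_of_neg_one_opp (hs : s ≠ 0) (ht : t ≠ 0)
    (hq : ∀ k : ℕ, k ≠ 0 → qInt (s ^ 2) k ≠ 0) (i j : Fin (n + 1)) (e : ℤˣ)
    (ha : affCartan n i j = -1) (k : ℕ) :
    (fockFamily s t M).c (i, e) (j, -e) k = linCoeff ((t ^ (-M i j)) ^ 2) k := by
  rw [← expCoeff_linear]
  refine expCoeff_congr L (fun k hk => ?_) k
  have h1 := hq k hk
  have h3 : ((e * (-e : ℤˣ) : ℤ) : L) = -1 := by
    rcases Int.units_eq_one_or e with rfl | rfl <;> simp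
  rw [contraction_exponent hs ht hq i j e (-e) k hk, ha, qInt_mul_neg_one, h3, Units.val_neg,
    sub_neg_eq_add, neg_add_cancel, zpow_zero, one_mul]
  field_simp

/-- Here (q^k + q^(-k)) q^(-ek) = 1 + q^(-2ek), so the exponent is the logarithm of (1 - u)(1 -
q^(-2e)u). For opposite signs the factor q^(-ek) is absent and the sign is reversed, giving ((1 -
qu)(1 - q⁻¹u))⁻¹. -/
theorem fockFamily_c_self (hs : s ≠ 0) (ht : t ≠ 0)
    (hq : ∀ k : ℕ, k ≠ 0 → qInt (s ^ 2) k ≠ 0) (i : Fin (n + 1)) (e : ℤˣ)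
    (ha : affCartan n i i = 2) (hM : M i i = 0) (k : ℕ) :
    (fockFamily s t M).c (i, e) (i, e) k = VertexFamily.quadCoeff (((s ^ 2) ^ (-(e : ℤ))) ^ 2) k := by
  rw [← expCoeff_quad]
  refine expCoeff_congr L (fun k hk => ?_) k
  have h1 := hq k hk
  have h3 : ((e * e : ℤ) : L) = 1 := by
    rcases Int.units_eq_one_or e with rfl | rfl <;> simp
  rw [contraction_exponent hs ht hq i i e e k hk, ha, qInt_mul_two (pow_ne_zero 2 hs), h3, hM]
  rcases Int.units_eq_one_or e with rfl | rfl
  · simp only [Units.val_one, zpow_neg, zpow_natCast, zpow_one, neg_zero, zpow_zero]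
    rw [show (-1 - 1 : ℤ) = -(2 : ℕ) by norm_num, zpow_neg, zpow_natCast]
    simp only [mul_pow, inv_pow, one_pow]
    field_simp
    ring
  · simp only [Units.val_neg, Units.val_one, zpow_neg, zpow_natCast, zpow_one, neg_zero, zpow_zero,
      neg_neg]
    rw [show (1 - -1 : ℤ) = (2 : ℕ) by norm_num, zpow_natCast]
    simp only [mul_pow, one_pow]
    field_simp
    ring

theorem fockFamily_c_self_opp (hs : s ≠ 0) (ht : t ≠ 0)
    (hq : ∀ k : ℕ, k ≠ 0 → qInt (s ^ 2) k ≠ 0) (i : Fin (n + 1)) (e : ℤˣ)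
    (ha : affCartan n i i = 2) (hM : M i i = 0) (k : ℕ) :
    (fockFamily s t M).c (i, e) (i, -e) k = qInt (s ^ 2) (k + 1) := by
  have hs2 : s ^ 2 ≠ 0 := pow_ne_zero 2 hs
  have hq1 : s ^ 2 - (s ^ 2)⁻¹ ≠ 0 := by
    have := hq 1 one_ne_zero
    intro h
    rw [qInt, h, div_zero] at this
    exact this rfl
  rw [← expCoeff_geom_geom hq1]
  refine expCoeff_congr L (fun k hk => ?_) k
  have h1 := hq k hk
  have h3 : ((e * (-e : ℤˣ) : ℤ) : L) = -1 := by
    rcases Int.units_eq_one_or e with rfl | rfl <;> simp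
  rw [contraction_exponent hs ht hq i i e (-e) k hk, ha, qInt_mul_two hs2, h3, hM, Units.val_neg,
    sub_neg_eq_add, neg_add_cancel, zpow_zero]
  simp only [zpow_neg, zpow_natCast, neg_zero, zpow_zero, inv_pow, one_pow, mul_one]
  field_simp

end FockFamily

/-! ### Exchange relations deduced from the contraction coefficients -/

namespace VertexFamily

variable {n : ℕ} {L : Type*} [Field L] {J : Type*} (Y : VertexFamily n L J)

theorem finsum_extZero_eq_sum (c : ℕ → L) (F : ℤ → Fock n L) (B : ℕ) (hc : ∀ k, B ≤ k → c k = 0) :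
    ∑ᶠ k : ℤ, extZero c k • F k = ∑ k ∈ Finset.range B, c k • F k := by
  rw [finsum_eq_sum_of_support_subset (s := (Finset.range B).map Nat.castEmbedding), Finset.sum_map]
  · simp [extZero_natCast]
  · intro k hk
    rw [Function.mem_support] at hk
    rcases lt_or_ge k 0 with h | h
    · rw [extZero_of_neg _ h, zero_smul] at hk
      exact absurd rfl hk
    · lift k to ℕ using h
      have : k < B := by
        by_contra h'
        exact hk (by rw [extZero_natCast, hc k (by omega), zero_smul])
      simpa using this

theorem op_op_of_one {i j : J} (hc : ∀ k, Y.c i j k = if k = 0 then 1 else 0) (a b : ℤ) {d : ℕ}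
    {v : Fock n L} (hv : v ∈ fockBelow n L d) :
    Y.op i a (Y.op j b v) = Y.normal₂ d i j a b v := by
  rw [Y.op_op_eq_finsum hv, finsum_extZero_eq_sum _ _ 1 fun k hk => by rw [hc, if_neg (by omega)]]
  simp [hc]

theorem op_comm_of_one {i j : J} (hij : ∀ k, Y.c i j k = if k = 0 then 1 else 0)
    (hji : ∀ k, Y.c j i k = if k = 0 then 1 else 0) (a b : ℤ) (v : Fock n L) :
    Y.op i a (Y.op j b v) = Y.op j b (Y.op i a v) := by
  obtain ⟨d, hd⟩ := exists_mem_fockBelow v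
  rw [Y.op_op_of_one hij a b hd, Y.op_op_of_one hji b a hd, Y.normal₂_comm]

theorem op_op_of_linear {i j : J} {ρ : L} (hc : ∀ k, Y.c i j k = linCoeff ρ k) (a b : ℤ) {d : ℕ}
    {v : Fock n L} (hv : v ∈ fockBelow n L d) :
    Y.op i a (Y.op j b v) = Y.normal₂ d i j a b v - ρ • Y.normal₂ d i j (a + 1) (b - 1) v := by
  rw [Y.op_op_eq_finsum hv, finsum_extZero_eq_sum _ _ 2 fun k hk => by
    rw [hc, linCoeff, if_neg (by omega), if_neg (by omega)]]
  simp [hc, linCoeff, Finset.sum_range_succ, sub_eq_add_neg]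

/-- The two contractions agree up to a monomial: 1 - τ²u = -τ²u (1 - τ⁻²u⁻¹). Hence a mode shift and
a sign. -/
theorem op_anticomm_of_linear {i j : J} {τ : L} (hτ : τ ≠ 0)
    (hij : ∀ k, Y.c i j k = linCoeff (τ ^ 2) k) (hji : ∀ k, Y.c j i k = linCoeff ((τ⁻¹) ^ 2) k)
    (a b : ℤ) (v : Fock n L) :
    τ⁻¹ • Y.op i (a - 1) (Y.op j b v) = -(τ • Y.op j (b - 1) (Y.op i a v)) := by
  obtain ⟨d, hd⟩ := exists_mem_fockBelow v
  rw [Y.op_op_of_linear hij _ _ hd, Y.op_op_of_linear hji _ _ hd, sub_add_cancel, sub_add_cancel,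
    Y.normal₂_comm d j i, Y.normal₂_comm d j i, smul_sub, smul_sub, smul_smul, smul_smul,
    show τ⁻¹ * τ ^ 2 = τ by field_simp, show τ * τ⁻¹ ^ 2 = τ⁻¹ by field_simp, neg_sub]

/-- Multiplication by 1 - ρu clears the denominator of the contraction and leaves the normally
ordered product alone. -/
theorem op_op_of_geom {i j : J} {ρ : L} (hc : ∀ k, Y.c i j k = ρ ^ k) (a b : ℤ) {d : ℕ}
    {v : Fock n L} (hv : v ∈ fockBelow n L d) :
    Y.op i a (Y.op j b v) - ρ • Y.op i (a + 1) (Y.op j (b - 1) v) = Y.normal₂ d i j a b v := by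
  set B : ℕ := (b + d).toNat with hB
  rw [Y.op_op hv i j a b (B := B + 1) (by omega), Y.op_op hv i j (a + 1) (b - 1) (B := B) (by omega),
    Finset.sum_range_succ', Finset.smul_sum, add_sub_right_comm, ← Finset.sum_sub_distrib,
    Finset.sum_eq_zero, zero_add]
  · simp [hc]
  · intro k _
    rw [smul_smul, hc, hc, pow_succ', sub_eq_zero]
    congr 2 <;> push_cast <;> ring

theorem op_exchange_of_geom {i j : J} {ρ ρ' : L} (hij : ∀ k, Y.c i j k = ρ ^ k)
    (hji : ∀ k, Y.c j i k = ρ' ^ k) (a b : ℤ) (v : Fock n L) :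
    Y.op i a (Y.op j b v) - ρ • Y.op i (a + 1) (Y.op j (b - 1) v) =
      Y.op j b (Y.op i a v) - ρ' • Y.op j (b + 1) (Y.op i (a - 1) v) := by
  obtain ⟨d, hd⟩ := exists_mem_fockBelow v
  rw [Y.op_op_of_geom hij _ _ hd, Y.op_op_of_geom hji _ _ hd, Y.normal₂_comm]

theorem op_op_of_quad {i j : J} {p : L} (hc : ∀ k, Y.c i j k = quadCoeff p k) (a b : ℤ) {d : ℕ}
    {v : Fock n L} (hv : v ∈ fockBelow n L d) :
    Y.op i a (Y.op j b v) = Y.normal₂ d i j a b v - (1 + p) • Y.normal₂ d i j (a + 1) (b - 1) v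
      + p • Y.normal₂ d i j (a + 2) (b - 2) v := by
  rw [Y.op_op_eq_finsum hv, finsum_extZero_eq_sum _ _ 3 fun k hk => by
    rw [hc, quadCoeff_of_ge _ hk]]
  simp only [Finset.sum_range_succ, Finset.sum_range_zero, hc, quadCoeff, if_true, one_ne_zero,
    if_false, OfNat.ofNat_ne_zero, OfNat.ofNat_ne_one, Nat.cast_zero, Nat.cast_one, add_zero,
    sub_zero, Nat.cast_ofNat]
  module

/-- Once each ordering is collected on its own side, both sides are the normally ordered product
with coefficient (1 - u)(1 - pu)(1 - p⁻¹u), up to the same monomial. -/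
theorem op_exchange_of_quad {i : J} {p : L} (hp : p ≠ 0) (hc : ∀ k, Y.c i i k = quadCoeff p k)
    (a b : ℤ) (v : Fock n L) :
    Y.op i (a - 3) (Y.op i b v) - p⁻¹ • Y.op i (b - 2) (Y.op i (a - 1) v) =
      p⁻¹ • Y.op i (a - 2) (Y.op i (b - 1) v) - Y.op i (b - 3) (Y.op i a v) := by
  obtain ⟨d, hd⟩ := exists_mem_fockBelow v
  simp only [Y.op_op_of_quad hc _ _ hd]
  rw [Y.normal₂_comm d i i (b - 2), Y.normal₂_comm d i i (b - 2 + 1),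
    Y.normal₂_comm d i i (b - 2 + 2), Y.normal₂_comm d i i (b - 3), Y.normal₂_comm d i i (b - 3 + 1),
    Y.normal₂_comm d i i (b - 3 + 2)]
  rw [show a - 3 + 1 = a - 2 by ring, show a - 3 + 2 = a - 1 by ring,
    show b - 2 + 1 = b - 1 by ring, show b - 2 + 2 = b by ring, show a - 1 - 1 = a - 2 by ring,
    show a - 1 - 2 = a - 3 by ring, show a - 2 + 1 = a - 1 by ring, show a - 2 + 2 = a by ring,
    show b - 1 - 1 = b - 2 by ring, show b - 1 - 2 = b - 3 by ring, show b - 3 + 1 = b - 2 by ring,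
    show b - 3 + 2 = b - 1 by ring]
  match_scalars <;> field_simp <;> ring

/-- After the shift by one the first ordering contributes [k] u^k for k > 0. Because [-k] = -[k],
the subtracted second ordering contributes [k] u^k for k < 0. Together they form ∑_{k ∈ ℤ} [k] u^k,
a difference of two delta functions divided by q - q⁻¹. -/
theorem op_sub_op_of_qInt {i j : J} {q : L} (hij : ∀ k, Y.c i j k = qInt q (k + 1))
    (hji : ∀ k, Y.c j i k = qInt q (k + 1)) (a b : ℤ) {d : ℕ} {v : Fock n L}
    (hv : v ∈ fockBelow n L d) :
    Y.op i (a + 1) (Y.op j (b - 1) v) - Y.op j (b + 1) (Y.op i (a - 1) v) =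
      ∑ᶠ k : ℤ, qInt q k • Y.normal₂ d i j (a + k) (b - k) v := by
  have hfin := Y.finite_support_normal₂ d i j a b v
  have h1 : Y.op i (a + 1) (Y.op j (b - 1) v) =
      ∑ᶠ k : ℤ, extZero (Y.c i j) (k - 1) • Y.normal₂ d i j (a + k) (b - k) v := by
    rw [Y.op_op_eq_finsum hv]
    refine (finsum_congr fun k => ?_).trans (finsum_comp_equiv (Equiv.addRight (1 : ℤ)))
    simp only [Equiv.coe_addRight, add_sub_cancel_right]
    congr 2 <;> ring
  have h2 : Y.op j (b + 1) (Y.op i (a - 1) v) =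
      ∑ᶠ k : ℤ, extZero (Y.c j i) (-1 - k) • Y.normal₂ d i j (a + k) (b - k) v := by
    rw [Y.op_op_eq_finsum hv]
    refine (finsum_congr fun k => ?_).trans (finsum_comp_equiv (Equiv.subLeft (-1 : ℤ)))
    simp only [Equiv.subLeft_apply, sub_sub_cancel]
    rw [Y.normal₂_comm]
    congr 2 <;> ring
  rw [h1, h2, ← finsum_sub_distrib]
  · refine finsum_congr fun k => ?_
    rw [← sub_smul]
    congr 1
    rcases lt_trichotomy k 0 with h | h | h
    · obtain ⟨m, rfl⟩ : ∃ m : ℕ, k = -(m + 1 : ℤ) := ⟨(-1 - k).toNat, by omega⟩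
      rw [extZero_of_neg _ (by omega), show -1 - -((m : ℤ) + 1) = m by ring, extZero_natCast, hji,
        qInt_neg, zero_sub]
    · rw [h, extZero_of_neg _ (by omega), extZero_of_neg _ (by omega)]
      simp [qInt]
    · obtain ⟨m, rfl⟩ : ∃ m : ℕ, k = (m + 1 : ℤ) := ⟨(k - 1).toNat, by omega⟩
      rw [extZero_of_neg (m := -1 - _) _ (by omega), add_sub_cancel_right, extZero_natCast, hij,
        sub_zero]
  · exact hfin.subset fun k hk h => hk (by simp [h])
  · exact hfin.subset fun k hk h => hk (by simp [h])

end VertexFamily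
end

noncomputable section

/-! ### Relations of the currents with H, q^d and each other on the Fock space -/

section FockRelations

variable {n : ℕ} {L : Type*} [Field L] [CharZero L] {s t : L}
  {M : Matrix (Fin (n + 1)) (Fin (n + 1)) ℤ}

/-- The commutation relations of the Heisenberg generators with the vertex operators. -/
theorem fockH_mul_op (hs : s ≠ 0) (hq : ∀ k : ℕ, k ≠ 0 → qInt (s ^ 2) k ≠ 0)
    (hM : ∀ i j, M i j = -M j i) (hA : ∀ i j, affCartan n i j = affCartan n j i)
    (i j : Fin (n + 1)) (e : ℤˣ) (k a : ℤ) (hk : k ≠ 0) :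
    fockH (s ^ 2) (t ^ 2) M i k * (fockFamily s t M).op (j, e) a =
      (fockFamily s t M).op (j, e) a * fockH (s ^ 2) (t ^ 2) M i k +
      (((e : ℤ) : L) * ((k : L)⁻¹ * qInt (s ^ 2) (k * affCartan n i j) *
        (t ^ 2) ^ (-k * M i j)) * s ^ (-(e : ℤ) * |k|)) •
        (fockFamily s t M).op (j, e) (a - k) := by
  rcases Int.eq_nat_or_neg k with ⟨r, rfl | rfl⟩
  · have hr : r ≠ 0 := by simpa using hk
    rw [VertexFamily.mul_op_of_comm_D _ _ (j, e) r
      (vertexCoeff s e r * heisScalar M (s ^ 2) (t ^ 2) i j r)]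
    · congr 2
      have := hq r hr
      rw [Nat.abs_cast, zpow_mul s, zpow_natCast, vertexCoeff, heisScalar]
      push_cast
      field_simp
    · refine mul_expCoeff L (fun k r => ((commute_fockH_neg _ _ M _ _ k r).smul_left _).smul_right _)
        _ r hr _ fun k hk => ?_
      rw [mul_smul_comm, fockH_pos_mul_neg _ _ M _ _ r k hr hk, smul_add, smul_mul_assoc]
      congr 1
      split_ifs with h
      · rw [h, Algebra.smul_def, ← map_mul]
        rfl
      · rw [smul_zero]
    · exact commute_expCoeff_right L fun k => (commute_fockH_pos _ _ M _ _ r k).smul_right _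
  · have hr : r ≠ 0 := by simpa using hk
    rw [VertexFamily.mul_op_of_comm_g _ _ (j, e) r
      (vertexCoeff s e r * heisScalar M (s ^ 2) (t ^ 2) j i r)]
    · rw [sub_neg_eq_add]
      congr 2
      have := hq r hr
      rw [abs_neg, Nat.abs_cast, zpow_mul s, zpow_natCast, vertexCoeff, heisScalar, hM i j, hA i j]
      simp only [neg_mul, mul_neg, neg_neg, qInt_neg, Int.cast_neg, Int.cast_natCast, inv_neg]
      field_simp
    · refine mul_expCoeff L (fun k r => ((commute_fockH_pos _ _ M _ _ k r).smul_left _).smul_right _)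
        _ r hr _ fun k hk => ?_
      have := fockH_pos_mul_neg (s ^ 2) (t ^ 2) M j i k r hk hr
      rw [mul_smul_comm, ← sub_eq_iff_eq_add.mpr this, smul_sub, smul_mul_assoc, sub_eq_add_neg]
      congr 1
      by_cases h : k = r
      · rw [if_pos h.symm, if_pos h, h, Algebra.smul_def, ← map_mul, ← map_neg]
        congr 1
        unfold heisScalar
        ring
      · rw [if_neg h, if_neg (Ne.symm h), smul_zero, neg_zero]
    · exact commute_expCoeff_right L fun k => (commute_fockH_neg _ _ M _ _ r k).smul_right _

/-- The operator `q ^ d` on the Fock space. -/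
def fockScale (n : ℕ) (q : L) : Module.End L (Fock n L) :=
  (MvPolynomial.basisMonomials (Fin (n + 1) × ℕ+) L).constr L fun μ =>
    q ^ (-(fockDeg μ : ℤ)) • MvPolynomial.monomial μ (1 : L)

theorem fockScale_monomial (q : L) (μ : (Fin (n + 1) × ℕ+) →₀ ℕ) (c : L) :
    fockScale n q (MvPolynomial.monomial μ c) =
      q ^ (-(fockDeg μ : ℤ)) • MvPolynomial.monomial μ c := by
  have h : MvPolynomial.monomial μ c = c • MvPolynomial.basisMonomials (Fin (n + 1) × ℕ+) L μ := by
    rw [MvPolynomial.coe_basisMonomials, MvPolynomial.smul_monomial, smul_eq_mul, mul_one]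
  rw [h, map_smul, fockScale, Module.Basis.constr_basis, smul_comm, MvPolynomial.coe_basisMonomials]

theorem fockDeg_add (μ ν : (Fin (n + 1) × ℕ+) →₀ ℕ) : fockDeg (μ + ν) = fockDeg μ + fockDeg ν := by
  unfold fockDeg
  exact Finsupp.sum_add_index' (by simp) (by intros; ring)

theorem fockDeg_single (x : Fin (n + 1) × ℕ+) : fockDeg (Finsupp.single x 1) = x.2 := by
  simp [fockDeg]

theorem fockScale_mul_fockH {q : L} (hq : q ≠ 0) (p κ : L) (i : Fin (n + 1)) (l : ℤ) :
    fockScale n q * fockH p κ M i l = q ^ l • (fockH p κ M i l * fockScale n q) := by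
  refine (MvPolynomial.basisMonomials _ L).ext fun μ => ?_
  simp only [MvPolynomial.coe_basisMonomials, Module.End.mul_apply, LinearMap.smul_apply,
    fockScale_monomial, map_smul]
  rcases Int.eq_nat_or_neg l with ⟨r, rfl | rfl⟩
  · rcases Nat.eq_zero_or_pos r with rfl | hr
    · simp [fockH_zero]
    have h1 := fockH_of_pos p κ M i ⟨r, hr⟩
    rw [PNat.mk_coe] at h1
    rw [h1, LinearMap.sum_apply, map_sum, Finset.smul_sum, Finset.smul_sum]
    refine Finset.sum_congr rfl fun j _ => ?_
    rw [LinearMap.smul_apply, map_smul, smul_comm _ (_ * _), smul_comm _ (_ * _)]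
    congr 1
    rw [Derivation.coeFn_coe, MvPolynomial.pderiv_monomial, fockScale_monomial, smul_smul]
    by_cases h0 : μ (j, ⟨r, hr⟩) = 0
    · simp [h0]
    · congr 1
      have h3 : μ = (μ - Finsupp.single (j, ⟨r, hr⟩) 1) + Finsupp.single (j, ⟨r, hr⟩) 1 := by
        rw [tsub_add_cancel_of_le]
        rw [Finsupp.single_le_iff]
        omega
      conv_rhs => rw [h3, fockDeg_add, fockDeg_single]
      rw [← zpow_add₀ hq]
      congr 1
      simp
  · rcases Nat.eq_zero_or_pos r with rfl | hr
    · simp [fockH_zero]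
    have h1 := fockH_of_neg p κ M i ⟨r, hr⟩
    rw [PNat.mk_coe] at h1
    rw [h1, LinearMap.mulLeft_apply, MvPolynomial.X, MvPolynomial.monomial_mul, fockScale_monomial,
      smul_smul, fockDeg_add, fockDeg_single, ← zpow_add₀ hq]
    congr 2
    rw [PNat.mk_coe]
    push_cast
    ring

theorem fockScale_mul_op {q : L} (hq : q ≠ 0) (x : Fin (n + 1) × ℤˣ) (a : ℤ) :
    fockScale n q * (fockFamily s t M).op x a =
      q ^ (-a) • ((fockFamily s t M).op x a * fockScale n q) := by
  refine VertexFamily.scale_op _ _ _ q hq (fun m => ?_) (fun b => ?_) a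
  · refine expCoeff_scale L _ q⁻¹ (fun k _ => ?_) m
    rw [mul_smul_comm, fockScale_mul_fockH hq, smul_mul_assoc, smul_comm, zpow_neg, zpow_natCast,
      inv_pow]
  · refine expCoeff_scale L _ q (fun k _ => ?_) b
    rw [mul_smul_comm, fockScale_mul_fockH hq, smul_mul_assoc, smul_comm, zpow_natCast]

theorem extZero_ite_apply (m : ℤ) (v : Fock n L) :
    extZero (fun k => if k = 0 then (1 : Module.End L (Fock n L)) else 0) m v =
      if m = 0 then v else 0 := by
  rcases lt_or_ge m 0 with h | h
  · rw [extZero_of_neg _ h, if_neg h.ne]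
    rfl
  · lift m to ℕ using h
    rw [extZero_natCast]
    rcases Nat.eq_zero_or_pos m with rfl | h
    · simp
    · rw [if_neg h.ne', if_neg (by omega)]
      rfl

/-- The commutator of `E_i(z)` and `F_i(w)` on the Fock space. -/
theorem op_commutator_self (hs : s ≠ 0) (ht : t ≠ 0) (hq : ∀ k : ℕ, k ≠ 0 → qInt (s ^ 2) k ≠ 0)
    (i : Fin (n + 1)) (ha : affCartan n i i = 2) (hM : M i i = 0) (a b : ℤ) (v : Fock n L) :
    (fockFamily s t M).op (i, 1) (a + 1) ((fockFamily s t M).op (i, -1) (b - 1) v) -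
      (fockFamily s t M).op (i, -1) (b + 1) ((fockFamily s t M).op (i, 1) (a - 1) v) =
    (s ^ 2 - (s ^ 2)⁻¹)⁻¹ • (s ^ (b - a) • extZero (expCoeff L fun k =>
        (s ^ 2 - (s ^ 2)⁻¹) • fockH (s ^ 2) (t ^ 2) M i (k : ℤ)) (-(a + b)) v -
      s ^ (a - b) • extZero (expCoeff L fun k =>
        (-(s ^ 2 - (s ^ 2)⁻¹)) • fockH (s ^ 2) (t ^ 2) M i (-(k : ℤ))) (a + b) v) := by
  obtain ⟨d, hd'⟩ := exists_mem_fockBelow v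
  -- The bound d + 1 keeps the range nonempty, so that the term x = 0 is available for the trivial
  -- annihilation part below.
  have hd : v ∈ fockBelow n L (d + 1) := fockBelow_mono (Nat.le_succ d) hd'
  set Y := fockFamily s t M with hY
  set q := s ^ 2 with hqs
  have hq0 : q ≠ 0 := pow_ne_zero 2 hs
  have hq1 : q - q⁻¹ ≠ 0 := by
    intro h
    have := hq 1 one_ne_zero
    rw [qInt, h, div_zero] at this
    exact this rfl
  have hE : ∀ k : ℕ, vertexCoeff s 1 k = (s⁻¹) ^ k / qInt q k := fun k => by simp [vertexCoeff, hqs]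
  have hF : ∀ k : ℕ, vertexCoeff s (-1) k = -(s ^ k / qInt q k) := fun k => by
    simp [vertexCoeff, hqs, neg_div]
  have hqk : ∀ k : ℕ, k ≠ 0 → (q ^ k - (q⁻¹) ^ k) / qInt q k = q - q⁻¹ := by
    intro k hk
    have h1 := hq k hk
    rw [div_eq_iff h1, qInt, mul_div_cancel₀ _ hq1, zpow_neg, zpow_natCast, inv_pow]
  have hg : ∀ (α β : L) (m : ℕ), expCoeff L (fun k => (α ^ k * vertexCoeff s 1 k +
        β ^ k * vertexCoeff s (-1) k) • fockH q (t ^ 2) M i (-(k : ℤ))) m =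
      ∑ z ∈ Finset.HasAntidiagonal.antidiagonal m,
        (α ^ z.1 * β ^ z.2) • (Y.g (i, 1) z.1 * Y.g (i, -1) z.2) := by
    intro α β m
    have h1 := expCoeff_add L
      (x := fun k => α ^ k • (vertexCoeff s 1 k • fockH q (t ^ 2) M i (-(k : ℤ))))
      (y := fun k => β ^ k • (vertexCoeff s (-1) k • fockH q (t ^ 2) M i (-(k : ℤ))))
      (fun k r => (((commute_fockH_neg _ _ M _ _ k r).smul_left _).smul_right _).smul_left _
        |>.smul_right _)
      (fun k r => (((commute_fockH_neg _ _ M _ _ k r).smul_left _).smul_right _).smul_left _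
        |>.smul_right _)
      (fun k r => (((commute_fockH_neg _ _ M _ _ k r).smul_left _).smul_right _).smul_left _
        |>.smul_right _) m
    simp_rw [expCoeff_pow_smul, smul_mul_smul_comm, smul_smul, ← add_smul] at h1
    exact h1
  have hD : ∀ (α β : L) (m : ℕ), expCoeff L (fun k => (-(α ^ k * vertexCoeff s 1 k +
        β ^ k * vertexCoeff s (-1) k)) • fockH q (t ^ 2) M i (k : ℤ)) m =
      ∑ z ∈ Finset.HasAntidiagonal.antidiagonal m,
        (α ^ z.1 * β ^ z.2) • (Y.D (i, 1) z.1 * Y.D (i, -1) z.2) := by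
    intro α β m
    have h1 := expCoeff_add L
      (x := fun k => α ^ k • ((-vertexCoeff s 1 k) • fockH q (t ^ 2) M i (k : ℤ)))
      (y := fun k => β ^ k • ((-vertexCoeff s (-1) k) • fockH q (t ^ 2) M i (k : ℤ)))
      (fun k r => (((commute_fockH_pos _ _ M _ _ k r).smul_left _).smul_right _).smul_left _
        |>.smul_right _)
      (fun k r => (((commute_fockH_pos _ _ M _ _ k r).smul_left _).smul_right _).smul_left _
        |>.smul_right _)
      (fun k r => (((commute_fockH_pos _ _ M _ _ k r).smul_left _).smul_right _).smul_left _
        |>.smul_right _) m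
    simp_rw [expCoeff_pow_smul, smul_mul_smul_comm, smul_smul, ← add_smul, mul_neg,
      ← neg_add] at h1
    exact h1
  have hzero : ∀ (x : ℕ → Module.End L (Fock n L)) (f : ℕ → L), (∀ k, k ≠ 0 → f k = 0) → ∀ m,
      expCoeff L (fun k => f k • x k) m = if m = 0 then 1 else 0 := by
    intro x f hf m
    rw [← expCoeff_zero_seq L]
    exact expCoeff_congr L (fun k hk => by rw [hf k hk, zero_smul]) m
  -- [k] is split into its two exponentials, each written as α^(a+k) β^(b-k) up to a constant, with
  -- (α, β) = (q, 1) and (1, q). These are the lines along which the normally ordered product is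
  -- specialized.
  have hsum : ∀ k : ℤ, qInt q k • Y.normal₂ (d + 1) (i, 1) (i, -1) (a + k) (b - k) v =
      ((q - q⁻¹)⁻¹ * q ^ (-a)) • (q ^ (a + k) * 1 ^ (b - k)) •
          Y.normal₂ (d + 1) (i, 1) (i, -1) (a + k) (b - k) v -
        ((q - q⁻¹)⁻¹ * q ^ (-b)) • (1 ^ (a + k) * q ^ (b - k)) •
          Y.normal₂ (d + 1) (i, 1) (i, -1) (a + k) (b - k) v := by
    intro k
    rw [smul_smul, smul_smul, ← sub_smul]
    congr 1
    rw [one_zpow, one_zpow, mul_one, one_mul, mul_assoc, mul_assoc, ← zpow_add₀ hq0,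
      ← zpow_add₀ hq0, neg_add_cancel_left, sub_eq_add_neg b, neg_add_cancel_left, qInt,
      div_eq_inv_mul, mul_sub]
  have hfin := Y.finite_support_normal₂ (d + 1) (i, 1) (i, -1) a b v
  rw [Y.op_sub_op_of_qInt (fockFamily_c_self_opp hs ht hq i 1 ha hM)
    (by simpa using fockFamily_c_self_opp hs ht hq i (-1) ha hM) a b hd, finsum_congr hsum,
    finsum_sub_distrib, ← smul_finsum, ← smul_finsum,
    Y.finsum_normal₂ _ _ q 1 hq0 one_ne_zero a b hd _ _ (fun m => rfl) (fun m => rfl),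
    Y.finsum_normal₂ _ _ 1 q one_ne_zero hq0 a b hd _ _ (fun m => rfl) (fun m => rfl)]
  · simp_rw [← hg, ← hD]
    -- On the line (q, 1) the creation parts of E and F cancel, as q^k s^(-k) = s^k, and the
    -- annihilation parts combine to K⁺. On (1, q) the annihilation parts cancel and the creation
    -- parts combine to K⁻.
    have hG1 : (expCoeff L fun k => (q ^ k * vertexCoeff s 1 k + 1 ^ k * vertexCoeff s (-1) k) •
        fockH q (t ^ 2) M i (-(k : ℤ))) = fun m => if m = 0 then 1 else 0 := by
      funext m
      refine hzero _ _ (fun k hk => ?_) m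
      rw [hE, hF, hqs]
      simp only [inv_pow, one_pow, inv_one, pow_right_comm s 2 k]
      field_simp
      try ring
    have hD2 : (expCoeff L fun k => (-((1 : L)⁻¹ ^ k * vertexCoeff s 1 k +
        q⁻¹ ^ k * vertexCoeff s (-1) k)) • fockH q (t ^ 2) M i (k : ℤ)) =
        fun m => if m = 0 then 1 else 0 := by
      funext m
      refine hzero _ _ (fun k hk => ?_) m
      rw [hE, hF, hqs]
      simp only [inv_pow, one_pow, inv_one, pow_right_comm s 2 k]
      field_simp
      try ring
    have hD1 : (expCoeff L fun k => (-(q⁻¹ ^ k * vertexCoeff s 1 k +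
        (1 : L)⁻¹ ^ k * vertexCoeff s (-1) k)) • fockH q (t ^ 2) M i (k : ℤ)) =
        fun m => s⁻¹ ^ m • expCoeff L (fun k => (q - q⁻¹) • fockH q (t ^ 2) M i (k : ℤ)) m := by
      funext m
      rw [← expCoeff_pow_smul]
      refine expCoeff_congr L (fun k hk => ?_) m
      rw [smul_smul, ← hqk k hk, hE, hF, hqs]
      simp only [inv_pow, one_pow, inv_one, pow_right_comm s 2 k]
      congr 1
      field_simp
      try ring
    have hG2 : (expCoeff L fun k => (1 ^ k * vertexCoeff s 1 k + q ^ k * vertexCoeff s (-1) k) •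
        fockH q (t ^ 2) M i (-(k : ℤ))) =
        fun m => s ^ m • expCoeff L (fun k => (-(q - q⁻¹)) • fockH q (t ^ 2) M i (-(k : ℤ))) m := by
      funext m
      rw [← expCoeff_pow_smul]
      refine expCoeff_congr L (fun k hk => ?_) m
      rw [smul_smul, ← hqk k hk, hE, hF, hqs]
      simp only [inv_pow, one_pow, inv_one, pow_right_comm s 2 k]
      congr 1
      field_simp
      try ring
    rw [hG1, hG2, hD1, hD2]
    set KP := expCoeff L fun k => (q - q⁻¹) • fockH q (t ^ 2) M i (k : ℤ) with hKP
    set KM := expCoeff L fun k => (-(q - q⁻¹)) • fockH q (t ^ 2) M i (-(k : ℤ)) with hKM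
    have e1 : ∑ x ∈ Finset.range (d + 1), extZero (fun m => if m = 0 then
        (1 : Module.End L (Fock n L)) else 0) (a + b + x) ((s⁻¹ ^ x • KP x) v) =
        s ^ (a + b) • extZero KP (-(a + b)) v := by
      simp_rw [extZero_ite_apply]
      rcases lt_or_ge (-(a + b)) 0 with h | h
      · rw [extZero_of_neg _ h, Finset.sum_eq_zero fun x _ => if_neg (by omega)]
        simp
      · obtain ⟨m, hm⟩ := Int.eq_ofNat_of_zero_le h
        rw [hm, extZero_natCast, show a + b = -(m : ℤ) by omega]
        have hlow : FockLowers m (KP m) := fockLowers_expCoeff _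
          (fun k hk => fockLowers_smul _ _ _ (fockLowers_fockH _ _ M i k hk)) m
        rw [Finset.sum_eq_single m]
        · rw [if_pos (by omega), LinearMap.smul_apply, zpow_neg, zpow_natCast, inv_pow]
        · intro x _ hx
          rw [if_neg (by omega)]
        · intro hm'
          rw [if_pos (by omega), LinearMap.smul_apply,
            hlow.apply_eq_zero hd (by simpa using hm'), smul_zero]
    have e2 : ∑ x ∈ Finset.range (d + 1), extZero (fun m => s ^ m • KM m) (a + b + x)
        ((if x = 0 then (1 : Module.End L (Fock n L)) else 0) v) =
        s ^ (a + b) • extZero KM (a + b) v := by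
      rw [Finset.sum_eq_single 0]
      · simp only [Nat.cast_zero, add_zero, if_true, Module.End.one_apply]
        rcases lt_or_ge (a + b) 0 with h | h
        · rw [extZero_of_neg _ h, extZero_of_neg _ h]
          simp
        · obtain ⟨m, hm⟩ := Int.eq_ofNat_of_zero_le h
          rw [hm, extZero_natCast, extZero_natCast, zpow_natCast, LinearMap.smul_apply]
      · intro x _ hx
        simp [hx]
      · intro h
        simp at h
    have hz : ∀ x : ℤ, q ^ (-x) = s ^ (-(2 * x)) := fun x => by
      rw [hqs, ← zpow_natCast s 2, ← zpow_mul]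
      congr 1
      push_cast
      ring
    rw [e1, e2, smul_smul, smul_smul, smul_sub, smul_smul, smul_smul, hz, hz, mul_assoc, mul_assoc,
      ← zpow_add₀ hs, ← zpow_add₀ hs, show -(2 * a) + (a + b) = b - a by ring,
      show -(2 * b) + (a + b) = a - b by ring]
  · exact hfin.subset fun k hk h => hk (by simp [h])
  · exact hfin.subset fun k hk h => hk (by simp [h])

end FockRelations
end

noncomputable section

/-! ### The affine Cartan matrix and the matrix M -/

section AffineCartan

variable {n : ℕ}

theorem add_one_ne_self (hn : 1 < n) (i : Fin (n + 1)) : i + 1 ≠ i := by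
  have : NeZero n := ⟨by omega⟩
  intro h
  rw [add_eq_left] at h
  simp at h

/-- This is where n > 1 enters: the two neighbours of a node are distinct, so off-diagonal Cartan
entries are 0 or -1 and never -2. -/
theorem add_one_add_one_ne_self (hn : 1 < n) (i : Fin (n + 1)) : i + 1 + 1 ≠ i := by
  intro h
  rw [add_assoc, add_eq_left, Fin.ext_iff, Fin.val_add, Fin.val_one',
    Nat.mod_eq_of_lt (show 1 < n + 1 by omega), Nat.mod_eq_of_lt (show 1 + 1 < n + 1 by omega)] at h
  simp at h

theorem affCartan_self (hn : 1 < n) (i : Fin (n + 1)) : affCartan n i i = 2 := by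
  simp [affCartan, (add_one_ne_self hn i).symm]

theorem affCartan_comm (i j : Fin (n + 1)) : affCartan n i j = affCartan n j i := by
  simp only [affCartan, @eq_comm _ i j]
  ring

theorem affCartan_eq_zero_or (hn : 1 < n) {i j : Fin (n + 1)} (hij : i ≠ j) :
    affCartan n i j = 0 ∨ affCartan n i j = -1 := by
  unfold affCartan
  rw [if_neg hij]
  split_ifs with h1 h2
  · subst h1
    exact absurd h2.symm (add_one_add_one_ne_self hn i)
  all_goals simp

theorem torMatrix_skew (a : ℤ) (i j : Fin (n + 1)) : torMatrix n a i j = -torMatrix n a j i := by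
  unfold torMatrix
  ring

theorem torMatrix_self (a : ℤ) (i : Fin (n + 1)) : torMatrix n a i i = 0 := by
  unfold torMatrix
  ring

/-- M is supported on pairs of adjacent nodes, where the Cartan entry is -1. This turns the exponent
of κ in z^(H_{i,0}) into a linear form given by a row of M. -/
theorem affCartan_mul_torMatrix (hn : 1 < n) (a : ℤ) (i j : Fin (n + 1)) :
    affCartan n i j * torMatrix n a i j = -torMatrix n a i j := by
  rcases eq_or_ne i j with rfl | hij
  · simp [torMatrix_self]
  · unfold affCartan torMatrix
    rw [if_neg hij]
    split_ifs with h1 h2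
    · subst h1
      exact absurd h2.symm (add_one_add_one_ne_self hn i)
    all_goals ring

theorem torMatrix_eq_zero (hn : 1 < n) (a : ℤ) {i j : Fin (n + 1)} (h : affCartan n i j = 0) :
    torMatrix n a i j = 0 := by
  have := affCartan_mul_torMatrix hn a i j
  rw [h, zero_mul] at this
  omega

theorem sum_ite_eq_add_one {A : Type*} [AddCommMonoid A] (i : Fin (n + 1)) (c : A) :
    ∑ j : Fin (n + 1), (if i = j + 1 then c else 0) = c := by
  simp_rw [← sub_eq_iff_eq_add]
  simp

theorem sum_affCartan (i : Fin (n + 1)) : ∑ j, affCartan n i j = 0 := by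
  simp only [affCartan, Finset.sum_sub_distrib, sum_ite_eq_add_one]
  simp

theorem sum_torMatrix (a : ℤ) (i : Fin (n + 1)) : ∑ j, torMatrix n a i j = 0 := by
  simp only [torMatrix, Finset.sum_sub_distrib, sum_ite_eq_add_one]
  simp

theorem affCartan_succ_succ (x y : Fin n) : affCartan n x.succ y.succ =
    (if x = y then 2 else 0) - (if (y : ℕ) = x + 1 then 1 else 0) -
      (if (x : ℕ) = y + 1 then 1 else 0) := by
  have h : ∀ x y : Fin n, y.succ = x.succ + 1 ↔ (y : ℕ) = x + 1 := by
    intro x y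
    rw [Fin.ext_iff, Fin.val_add, Fin.val_one', Fin.val_succ, Fin.val_succ, Nat.add_mod_mod]
    rcases (show x + 1 + 1 < n + 1 ∨ (x : ℕ) + 1 + 1 = n + 1 by omega) with h | h
    · rw [Nat.mod_eq_of_lt h]
      omega
    · rw [h, Nat.mod_self]
      omega
  simp only [affCartan, h, Fin.succ_inj]

end AffineCartan

/-! ### Shifts of the pairing, the κ-exponent and the energy under ±ᾱ_i -/

section RootLattice

variable {n : ℕ}

/-- A functional on the span of `α_0, …, α_n` that kills `α_0 + ⋯ + α_n` is determined by its
restriction to the root lattice. -/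
theorem sum_mul_rootBar {f : Fin (n + 1) → ℤ} (hf : ∑ j, f j = 0) (i : Fin (n + 1)) :
    ∑ k : Fin n, f k.succ * rootBar i k = f i := by
  rw [Fin.sum_univ_succ] at hf
  refine Fin.cases ?_ (fun j => ?_) i
  · simp [rootBar]
    omega
  · simp [rootBar, Pi.single_apply]

theorem latPair_add_smul_rootBar (p i j : Fin (n + 1)) (m : Fin n → ℤ) (e : ℤ) :
    latPair p i (m + e • rootBar j) = latPair p i m + e * affCartan n i j := by
  rw [← sum_mul_rootBar (sum_affCartan i) j]
  simp only [latPair, Pi.add_apply, Pi.smul_apply, smul_eq_mul, mul_add, Finset.sum_add_distrib,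
    Finset.mul_sum, mul_left_comm e]
  ring

/-- Up to sign, `latTwist` is the linear form given by a row of M. Since that row sums to zero, the
same formula covers j = 0. -/
theorem latTwist_add_smul_rootBar (hn : 1 < n) (a : ℤ) (i j : Fin (n + 1)) (m : Fin n → ℤ)
    (e : ℤ) :
    latTwist (torMatrix n a) i (m + e • rootBar j) =
      latTwist (torMatrix n a) i m - e * torMatrix n a i j := by
  have h : ∀ x : Fin n → ℤ, latTwist (torMatrix n a) i x =
      -∑ k : Fin n, torMatrix n a i k.succ * x k := by
    intro x
    rw [latTwist, ← Finset.sum_neg_distrib]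
    refine Finset.sum_congr rfl fun k _ => ?_
    linear_combination x k * affCartan_mul_torMatrix hn a i k.succ
  rw [h, h, ← sum_mul_rootBar (sum_torMatrix a i) j]
  simp only [Pi.add_apply, Pi.smul_apply, smul_eq_mul, mul_add, Finset.sum_add_distrib,
    Finset.mul_sum, mul_left_comm e]
  ring

/-- The columns of the Cartan matrix sum to zero and the Λ̄_p term is δ_ip - δ_i0. This is the
vanishing second component of the level. -/
theorem sum_latPair (p : Fin (n + 1)) (m : Fin n → ℤ) : ∑ i, latPair p i m = 0 := by
  simp only [latPair, Finset.sum_add_distrib, Finset.sum_sub_distrib]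
  rw [Finset.sum_comm]
  simp_rw [← Finset.sum_mul, affCartan_comm _ (Fin.succ _), sum_affCartan]
  simp

theorem two_mul_latEnergy (hn : 1 < n) (p : Fin (n + 1)) (m : Fin n → ℤ) :
    2 * latEnergy p m = ∑ i : Fin n, ∑ j : Fin n, affCartan n i.succ j.succ * m i * m j +
      2 * ∑ j : Fin n, if j.succ = p then m j else 0 := by
  have h1 : ∑ i : Fin n, ∑ j : Fin n, (if i < j then affCartan n i.succ j.succ * m i * m j else 0) =
      ∑ i : Fin n, ∑ j : Fin n, if j < i then affCartan n i.succ j.succ * m i * m j else 0 := by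
    rw [Finset.sum_comm]
    refine Finset.sum_congr rfl fun i _ => Finset.sum_congr rfl fun j _ => ?_
    rw [affCartan_comm, mul_right_comm]
  have h2 : ∑ j, 2 * m j ^ 2 = ∑ i : Fin n, ∑ j : Fin n,
      if i = j then affCartan n i.succ j.succ * m i * m j else 0 := by
    refine Finset.sum_congr rfl fun i _ => ?_
    rw [Finset.sum_ite_eq, if_pos (Finset.mem_univ i), affCartan_self hn]
    ring
  have h3 : ∑ i : Fin n, ∑ j : Fin n, affCartan n i.succ j.succ * m i * m j =
      ∑ j, 2 * m j ^ 2 + (∑ i : Fin n, ∑ j : Fin n,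
        (if i < j then affCartan n i.succ j.succ * m i * m j else 0)) +
      ∑ i : Fin n, ∑ j : Fin n, if j < i then affCartan n i.succ j.succ * m i * m j else 0 := by
    rw [h2]
    simp only [← Finset.sum_add_distrib]
    refine Finset.sum_congr rfl fun i _ => Finset.sum_congr rfl fun j _ => ?_
    rcases lt_trichotomy i j with h | h | h
    · simp [h, h.ne, h.not_gt]
    · simp [h]
    · simp [h, h.ne', h.not_gt]
  rw [h3, ← h1, latEnergy, ← Finset.mul_sum]
  ring

theorem sum_affCartan_mul_rootBar_rootBar (i j : Fin (n + 1)) :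
    ∑ x : Fin n, ∑ y : Fin n, affCartan n x.succ y.succ * rootBar i x * rootBar j y =
      affCartan n i j := by
  have h : ∀ x : Fin n, ∑ y : Fin n, affCartan n x.succ y.succ * rootBar i x * rootBar j y =
      affCartan n j x.succ * rootBar i x := by
    intro x
    rw [affCartan_comm, ← sum_mul_rootBar (sum_affCartan x.succ) j, Finset.sum_mul]
    exact Finset.sum_congr rfl fun y _ => by ring
  rw [Finset.sum_congr rfl fun x _ => h x, sum_mul_rootBar (sum_affCartan j) i, affCartan_comm]

/-- For γ = ±ᾱ_i one has (β + γ|β + γ)/2 = (β|β)/2 + (β|γ) + (γ|γ)/2, and (γ|γ)/2 = 1. The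
computation is done with twice the energy, which is a symmetric double sum. -/
theorem latEnergy_add_smul_rootBar (hn : 1 < n) (p i : Fin (n + 1)) (m : Fin n → ℤ) (e : ℤˣ) :
    latEnergy p (m + (e : ℤ) • rootBar i) = latEnergy p m + e * latPair p i m + 1 := by
  have h1 : ∑ j : Fin n, (if j.succ = p then (m + (e : ℤ) • rootBar i) j else 0) =
      (∑ j : Fin n, if j.succ = p then m j else 0) +
        e * ((if i = p then 1 else 0) - (if i = 0 then 1 else 0)) := by
    have h := sum_mul_rootBar (n := n)
      (f := fun j => (if j = p then 1 else 0) - (if j = 0 then 1 else 0)) (by simp) i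
    rw [← h, Finset.mul_sum, ← Finset.sum_add_distrib]
    refine Finset.sum_congr rfl fun j _ => ?_
    rw [if_neg (Fin.succ_ne_zero j)]
    split_ifs <;> simp
  have h2 : ∑ x : Fin n, ∑ y : Fin n, affCartan n x.succ y.succ *
        (m + (e : ℤ) • rootBar i) x * (m + (e : ℤ) • rootBar i) y =
      ∑ x : Fin n, ∑ y : Fin n, affCartan n x.succ y.succ * m x * m y +
        2 * e * ∑ j : Fin n, affCartan n i j.succ * m j + 2 := by
    have h3 : ∀ x y : Fin n, affCartan n x.succ y.succ *
        (m + (e : ℤ) • rootBar i) x * (m + (e : ℤ) • rootBar i) y =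
        affCartan n x.succ y.succ * m x * m y +
          e * (m x * (affCartan n x.succ y.succ * rootBar i y)) +
          e * (m y * (affCartan n y.succ x.succ * rootBar i x)) +
          affCartan n x.succ y.succ * rootBar i x * rootBar i y := by
      intro x y
      have he : (e : ℤ) * e = 1 := by
        rcases Int.units_eq_one_or e with rfl | rfl <;> rfl
      rw [affCartan_comm y.succ]
      simp only [Pi.add_apply, Pi.smul_apply, smul_eq_mul]
      linear_combination affCartan n x.succ y.succ * rootBar i x * rootBar i y * he
    have h4 : ∀ x : Fin n, ∑ y : Fin n, affCartan n x.succ y.succ * rootBar i y =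
        affCartan n i x.succ := fun x => by
      rw [sum_mul_rootBar (sum_affCartan x.succ) i, affCartan_comm]
    simp only [h3, Finset.sum_add_distrib, ← Finset.mul_sum]
    rw [sum_affCartan_mul_rootBar_rootBar, affCartan_self hn, Finset.sum_comm
      (f := fun x y => m y * (affCartan n y.succ x.succ * rootBar i x))]
    simp only [← Finset.mul_sum, h4]
    simp only [mul_comm (m _)]
    ring
  have h5 := two_mul_latEnergy hn p (m + (e : ℤ) • rootBar i)
  have h6 := two_mul_latEnergy hn p m
  rw [h1, h2] at h5
  rw [latPair]
  linarith

end RootLattice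

/-! ### The signs of the twisted group algebra -/

section TwistSign

variable {n : ℕ} {L : Type*} [Field L]

theorem neg_one_zpow_congr {a b : ℤ} (h : (a : ZMod 2) = b) : (-1 : L) ^ a = (-1) ^ b := by
  rw [ZMod.intCast_eq_intCast_iff_dvd_sub] at h
  obtain ⟨c, hc⟩ := h
  rw [show b = a + 2 * c by push_cast at hc; linarith, zpow_add₀ (by simp), zpow_mul]
  simp

theorem neg_one_zpow_sum {ι : Type*} (u : Finset ι) (f : ι → ℤ) :
    (-1 : L) ^ (∑ x ∈ u, f x) = ∏ x ∈ u, (-1 : L) ^ f x := by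
  classical
  induction u using Finset.induction_on with
  | empty => simp
  | insert x u hx ih => rw [Finset.sum_insert hx, Finset.prod_insert hx, zpow_add₀ (by simp), ih]

/-- The bilinear form on coordinates whose parity is the sign of the twisted group algebra. -/
def twistForm (β γ : Fin n → ℤ) : ℤ :=
  ∑ i : Fin n, ∑ j : Fin n, if (j : ℕ) = i + 1 then β j * γ i else 0

/-- Modulo 2 the commutation exponent of two generators is 1 at consecutive positions and 0
otherwise; the special role of Λ̄_n disappears. -/
theorem twistSign_eq (β γ : Fin n → ℤ) : twistSign L β γ = (-1) ^ twistForm β γ := by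
  rw [twistSign, twistForm, neg_one_zpow_sum]
  refine Finset.prod_congr rfl fun i _ => ?_
  rw [neg_one_zpow_sum]
  refine Finset.prod_congr rfl fun j _ => ?_
  by_cases h : (j : ℕ) = i + 1
  · rw [if_pos h, if_pos (Fin.lt_def.mpr (by omega))]
    refine neg_one_zpow_congr ?_
    have h2 : (twistExp n i j : ZMod 2) = 1 := by
      unfold twistExp
      split_ifs
      · simp
      · omega
      · simp
    push_cast
    rw [h2, one_mul]
  · rw [if_neg h, zpow_zero]
    split_ifs with h1
    · have h2 : twistExp n i j = 0 := by
        unfold twistExp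
        rw [Fin.lt_def] at h1
        split_ifs <;> omega
      rw [h2]
      simp
    · rfl

theorem twistForm_add_left (β β' γ : Fin n → ℤ) :
    twistForm (β + β') γ = twistForm β γ + twistForm β' γ := by
  simp only [twistForm, ← Finset.sum_add_distrib]
  refine Finset.sum_congr rfl fun i _ => Finset.sum_congr rfl fun j _ => ?_
  split_ifs
  · rw [Pi.add_apply, add_mul]
  · rfl

theorem twistForm_add_right (β γ γ' : Fin n → ℤ) :
    twistForm β (γ + γ') = twistForm β γ + twistForm β γ' := by
  simp only [twistForm, ← Finset.sum_add_distrib]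
  refine Finset.sum_congr rfl fun i _ => Finset.sum_congr rfl fun j _ => ?_
  split_ifs
  · rw [Pi.add_apply, mul_add]
  · rfl

theorem latCoord_add (m m' : Fin n → ℤ) : latCoord (m + m') = latCoord m + latCoord m' := by
  funext k
  simp [latCoord, add_mul, Finset.sum_add_distrib]

theorem latCoord_eq_sum (m : Fin n → ℤ) : latCoord m = ∑ x, m x • rootCoord n x := by
  funext k
  simp [latCoord]

theorem twistForm_latCoord (m m' : Fin n → ℤ) : twistForm (latCoord m) (latCoord m') =
    ∑ x : Fin n, ∑ y : Fin n, twistForm (rootCoord n x) (rootCoord n y) * m x * m' y := by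
  have h1 : ∀ γ, twistForm (latCoord m) γ = ∑ x, m x * twistForm (rootCoord n x) γ := by
    intro γ
    have := map_sum (AddMonoidHom.mk' (fun β => twistForm β γ) fun β β' =>
      twistForm_add_left β β' γ) (fun x => m x • rootCoord n x) Finset.univ
    simp only [map_zsmul, smul_eq_mul, AddMonoidHom.mk'_apply, ← latCoord_eq_sum] at this
    exact this
  have h2 : ∀ β, twistForm β (latCoord m') = ∑ y, m' y * twistForm β (rootCoord n y) := by
    intro β
    have := map_sum (AddMonoidHom.mk' (twistForm β) fun γ γ' =>
      twistForm_add_right β γ γ') (fun x => m' x • rootCoord n x) Finset.univ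
    simp only [map_zsmul, smul_eq_mul, AddMonoidHom.mk'_apply, ← latCoord_eq_sum] at this
    exact this
  rw [h1]
  refine Finset.sum_congr rfl fun x _ => ?_
  rw [h2, Finset.mul_sum]
  exact Finset.sum_congr rfl fun y _ => by ring

/-- All coordinates of ᾱ_1, the last one n + 1 included, have the parity of their position. -/
theorem rootCoord_mod_two (x k : Fin n) : (rootCoord n x k : ZMod 2) =
    if (x : ℕ) = 0 then ((k : ℕ) : ZMod 2) else if (x : ℕ) = k + 1 then 1 else 0 := by
  have h2 : (2 : ZMod 2) = 0 := rfl
  unfold rootCoord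
  split_ifs with h h1
  · have h3 : (n : ZMod 2) = ((k : ℕ) : ZMod 2) + 1 := by exact_mod_cast congrArg _ h1.symm
    push_cast
    rw [h3]
    linear_combination h2
  · push_cast
    linear_combination (-(k : ℕ) - 1 : ZMod 2) * h2
  all_goals simp

/-- The commutation of `e^{ᾱ_i}` and `e^{ᾱ_j}`, `i, j ≥ 1`. -/
theorem twistForm_rootCoord_add (x y : Fin n) :
    ((twistForm (rootCoord n x) (rootCoord n y) + twistForm (rootCoord n y) (rootCoord n x) : ℤ) :
      ZMod 2) = (affCartan n x.succ y.succ : ℤ) := by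
  have h2 : (2 : ZMod 2) = 0 := rfl
  -- Pairing with ᾱ_{y+1}, y ≠ 0, on the right: its only nonzero coordinate is at position y - 1, so
  -- the form reads off the next coordinate of β.
  have hl : ∀ β γ : Fin n → ZMod 2, ∀ y : Fin n, (y : ℕ) ≠ 0 →
      (∀ k : Fin n, γ k = if (y : ℕ) = k + 1 then 1 else 0) →
      (∑ i : Fin n, ∑ j : Fin n, if (j : ℕ) = i + 1 then β j * γ i else 0) = β y := by
    intro β γ y hy hγ
    rw [Finset.sum_eq_single ⟨y - 1, by omega⟩, Finset.sum_eq_single y, hγ, if_pos, if_pos, mul_one]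
    · simp only
      omega
    · simp only
      omega
    · intro j _ hj
      rw [if_neg]
      rw [Ne, Fin.ext_iff] at hj
      simp only
      omega
    · simp
    · intro i _ hi
      rw [Ne, Fin.ext_iff] at hi
      simp only at hi
      refine Finset.sum_eq_zero fun j _ => ?_
      have h : ¬ (y : ℕ) = i + 1 := by omega
      rw [hγ, if_neg h, mul_zero, ite_self]
    · simp
  -- Pairing ᾱ_{x+1} with ᾱ_1 on the right: only j = x - 1, i = x - 2 contributes, with value x - 2
  -- ≡ x. For x = 1 there is no such i; this exception yields the odd entry between ᾱ_1 and ᾱ_2.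
  have hr : ∀ β : Fin n → ZMod 2, ∀ x : Fin n, (x : ℕ) ≠ 0 →
      (∀ k : Fin n, β k = if (x : ℕ) = k + 1 then 1 else 0) →
      (∑ i : Fin n, ∑ j : Fin n, if (j : ℕ) = i + 1 then β j * ((i : ℕ) : ZMod 2) else 0) =
        if (x : ℕ) = 1 then 0 else ((x : ℕ) : ZMod 2) := by
    intro β x hx hβ
    split_ifs with h1
    · refine Finset.sum_eq_zero fun i _ => Finset.sum_eq_zero fun j _ => ?_
      rw [hβ]
      split_ifs
      · omega
      · rw [zero_mul]
      · rfl
    · rw [Finset.sum_eq_single ⟨x - 2, by omega⟩, Finset.sum_eq_single ⟨x - 1, by omega⟩, hβ,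
        if_pos, if_pos, one_mul, Nat.cast_sub (by omega)]
      · push_cast
        linear_combination -h2
      · simp only
        omega
      · simp only
        omega
      · intro j _ hj
        rw [Ne, Fin.ext_iff] at hj
        simp only at hj ⊢
        rw [if_neg]
        omega
      · simp
      · intro i _ hi
        rw [Ne, Fin.ext_iff] at hi
        simp only at hi
        refine Finset.sum_eq_zero fun j _ => ?_
        rw [hβ]
        split_ifs
        · omega
        · rw [zero_mul]
        · rfl
      · simp
  have hc : ∀ x y : Fin n, ((twistForm (rootCoord n x) (rootCoord n y) : ℤ) : ZMod 2) =
      ∑ i : Fin n, ∑ j : Fin n, if (j : ℕ) = i + 1 then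
        (rootCoord n x j : ZMod 2) * (rootCoord n y i : ZMod 2) else 0 := by
    intro x y
    simp [twistForm]
  have h0 : ∀ y : Fin n, (y : ℕ) = 0 → ∀ k : Fin n,
      (rootCoord n y k : ZMod 2) = ((k : ℕ) : ZMod 2) := fun y hy k => by
    rw [rootCoord_mod_two, if_pos hy]
  have h1 : ∀ y : Fin n, (y : ℕ) ≠ 0 → ∀ k : Fin n,
      (rootCoord n y k : ZMod 2) = if (y : ℕ) = k + 1 then 1 else 0 := fun y hy k => by
    rw [rootCoord_mod_two, if_neg hy]
  have key : ∀ x y : Fin n, (x : ℕ) = 0 → (y : ℕ) ≠ 0 →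
      ((twistForm (rootCoord n x) (rootCoord n y) + twistForm (rootCoord n y) (rootCoord n x) : ℤ) :
        ZMod 2) = (affCartan n x.succ y.succ : ℤ) := by
    intro x y hx hy
    rw [Int.cast_add, hc, hc, hl _ _ y hy (h1 y hy)]
    simp only [h0 x hx]
    rw [hr _ y hy (h1 y hy), affCartan_succ_succ, if_neg (fun h : x = y => hy (h ▸ hx)), hx,
      if_neg (by omega : ¬ 0 = (y : ℕ) + 1), zero_add]
    split_ifs with h
    · rw [h]
      rfl
    · push_cast
      linear_combination ((y : ℕ) : ZMod 2) * h2
  by_cases hx : (x : ℕ) = 0 <;> by_cases hy : (y : ℕ) = 0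
  · have hxy : x = y := Fin.ext (hx.trans hy.symm)
    subst hxy
    rw [affCartan_succ_succ, ← two_mul]
    simp [h2]
  · exact key x y hx hy
  · rw [add_comm, affCartan_comm]
    exact key y x hy hx
  · rw [Int.cast_add, hc, hc, hl _ _ y hy (h1 y hy), hl _ _ x hx (h1 x hx), h1 x hx, h1 y hy,
      affCartan_succ_succ]
    push_cast
    split_ifs <;> first | omega | simp [h2]

/-- The sign in `e^{ᾱ_i} e^{ᾱ_j} = ε(ᾱ_i, ᾱ_j) e^{ᾱ_i + ᾱ_j}`. -/
def rootSign (L : Type*) [Field L] (i j : Fin (n + 1)) : L :=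
  twistSign L (latCoord (rootBar i)) (latCoord (rootBar j))

/-- The exponent is bilinear modulo 2, so the rule for simple roots extends to ᾱ_0, whose pairings
are again Cartan entries by `sum_affCartan_mul_rootBar_rootBar`. -/
theorem rootSign_mul_rootSign (i j : Fin (n + 1)) :
    rootSign L i j * rootSign L j i = (-1) ^ affCartan n i j := by
  rw [rootSign, rootSign, twistSign_eq, twistSign_eq, ← zpow_add₀ (by simp)]
  refine neg_one_zpow_congr ?_
  rw [← sum_affCartan_mul_rootBar_rootBar i j, twistForm_latCoord, twistForm_latCoord,
    Finset.sum_comm (f := fun x y => twistForm (rootCoord n x) (rootCoord n y) * rootBar j x *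
      rootBar i y)]
  simp only [← Finset.sum_add_distrib]
  push_cast
  refine Finset.sum_congr rfl fun x _ => Finset.sum_congr rfl fun y _ => ?_
  rw [← twistForm_rootCoord_add]
  push_cast
  ring

theorem twistSign_mul_self (β γ : Fin n → ℤ) : twistSign L β γ * twistSign L β γ = 1 := by
  rw [twistSign_eq, ← zpow_add₀ (by simp), ← two_mul, zpow_mul]
  simp

theorem twistSign_inv (β γ : Fin n → ℤ) : (twistSign L β γ)⁻¹ = twistSign L β γ :=
  inv_eq_of_mul_eq_one_left (twistSign_mul_self β γ)

theorem twistSign_add_right (β γ γ' : Fin n → ℤ) :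
    twistSign L β (γ + γ') = twistSign L β γ * twistSign L β γ' := by
  rw [twistSign_eq, twistSign_eq, twistSign_eq, twistForm_add_right, zpow_add₀ (by simp)]

theorem rootSign_mul_self (i j : Fin (n + 1)) : rootSign L i j * rootSign L i j = 1 :=
  twistSign_mul_self _ _

theorem rootSign_comm (i j : Fin (n + 1)) :
    rootSign L j i = (-1) ^ affCartan n i j * rootSign L i j := by
  rw [← rootSign_mul_rootSign]
  linear_combination -rootSign L j i * rootSign_mul_self (L := L) i j

theorem twistSign_latCoord_add_smul_rootBar (i j : Fin (n + 1)) (m : Fin n → ℤ) (e : ℤˣ)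
    (γ : Fin n → ℤ) :
    twistSign L (latCoord (rootBar i)) (latCoord (m + (e : ℤ) • rootBar j) + γ) =
      twistSign L (latCoord (rootBar i)) (latCoord m + γ) * rootSign L i j := by
  rcases Int.units_eq_one_or e with rfl | rfl
  · rw [Units.val_one, one_smul, latCoord_add, add_right_comm, twistSign_add_right, rootSign]
  · have h := twistSign_add_right (L := L) (latCoord (rootBar i))
      (latCoord (m + ((-1 : ℤˣ) : ℤ) • rootBar j) + γ) (latCoord (rootBar j))
    rw [add_right_comm, ← latCoord_add, Units.val_neg, Units.val_one, neg_smul, one_smul,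
      neg_add_cancel_right] at h
    rw [Units.val_neg, Units.val_one, neg_smul, one_smul, h, mul_assoc, rootSign,
      twistSign_mul_self, mul_one]

end TwistSign
end

noncomputable section

/-! ### Operators on W(p)_n that preserve e^β -/

section FirstFactor

variable {n : ℕ} {L : Type*} [Field L] {p : Fin (n + 1)}

theorem wFock_single (T : Module.End L (Fock n L)) (m : Fin n → ℤ) (v : Fock n L) :
    wFock p T (Finsupp.single m v) = Finsupp.single m (T v) := by
  simp [wFock]

/-- The action of operators on the first tensor factor, as a homomorphism of algebras. -/
def wFockHom (p : Fin (n + 1)) (L : Type*) [Field L] :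
    Module.End L (Fock n L) →ₐ[L] Module.End L (WSpace n p L) :=
  AlgHom.ofLinearMap
    { toFun := wFock p
      map_add' := fun S T => Finsupp.lhom_ext fun m v => by simp [wFock_single]
      map_smul' := fun c T => Finsupp.lhom_ext fun m v => by simp [wFock_single] }
    (Finsupp.lhom_ext fun m v => by simp [wFock_single])
    (fun S T => Finsupp.lhom_ext fun m v => by simp [wFock_single])

theorem wFockHom_apply (T : Module.End L (Fock n L)) : wFockHom p L T = wFock p T := rfl

end FirstFactor

section DiagonalOperators

variable {n : ℕ} {L : Type*} [Field L] [CharZero L] {p : Fin (n + 1)} {s t : L}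
  {M : Matrix (Fin (n + 1)) (Fin (n + 1)) ℤ}

theorem wH_single (i : Fin (n + 1)) (l : ℤ) (m : Fin n → ℤ) (v : Fock n L) :
    wH p s t M i l (Finsupp.single m v) =
      Finsupp.single m (fockH (s ^ 2) (t ^ 2) M i l v) := wFock_single _ _ _

theorem wQPartial_single (i : Fin (n + 1)) (r : ℤ) (m : Fin n → ℤ) (v : Fock n L) :
    wQPartial p s i r (Finsupp.single m v) =
      Finsupp.single m ((s ^ 2) ^ (r * latPair p i m) • v) := by
  simp [wQPartial]

theorem wQD_single (m : Fin n → ℤ) (v : Fock n L) (hs : s ≠ 0) :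
    wQD p s (Finsupp.single m v) =
      Finsupp.single m ((s ^ 2) ^ (-latEnergy p m) • fockScale n (s ^ 2) v) := by
  rw [wQD, Finsupp.lsum_single, LinearMap.comp_apply, Finsupp.lsingle_apply]
  congr 1
  rw [← LinearMap.smul_apply]
  congr 1
  refine (MvPolynomial.basisMonomials _ L).ext fun μ => ?_
  rw [Module.Basis.constr_basis, LinearMap.smul_apply, MvPolynomial.coe_basisMonomials,
    fockScale_monomial, smul_smul, ← zpow_add₀ (pow_ne_zero 2 hs), neg_add_eq_sub]

theorem wKPlus_single (i : Fin (n + 1)) (k : ℤ) (m : Fin n → ℤ) (v : Fock n L) :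
    wKPlus p s t M i k (Finsupp.single m v) = Finsupp.single m ((s ^ 2) ^ latPair p i m •
      extZero (expCoeff L fun r =>
        (s ^ 2 - (s ^ 2)⁻¹) • fockH (s ^ 2) (t ^ 2) M i (r : ℤ)) k v) := by
  rw [wKPlus]
  split_ifs with h
  · lift k to ℕ using h
    have h1 := map_expCoeff L (B := Module.End L (WSpace n p L)) (wFockHom p L)
      (fun r : ℕ => (s ^ 2 - (s ^ 2)⁻¹) • fockH (s ^ 2) (t ^ 2) M i (r : ℤ)) k
    simp only [map_smul, wFockHom_apply] at h1
    rw [Int.toNat_natCast, extZero_natCast, Module.End.mul_apply, wQPartial_single, one_mul]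
    simp only [wH]
    rw [← h1, wFock_single, map_smul]
  · rw [extZero_of_neg _ (not_le.mp h)]
    simp

theorem wKMinus_single (i : Fin (n + 1)) (k : ℤ) (m : Fin n → ℤ) (v : Fock n L) :
    wKMinus p s t M i k (Finsupp.single m v) = Finsupp.single m ((s ^ 2) ^ (-latPair p i m) •
      extZero (expCoeff L fun r =>
        (-(s ^ 2 - (s ^ 2)⁻¹)) • fockH (s ^ 2) (t ^ 2) M i (-(r : ℤ))) (-k) v) := by
  rw [wKMinus]
  split_ifs with h
  · obtain ⟨r, hr⟩ := Int.eq_ofNat_of_zero_le (show 0 ≤ -k by omega)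
    have h1 := map_expCoeff L (B := Module.End L (WSpace n p L)) (wFockHom p L)
      (fun r : ℕ => (-(s ^ 2 - (s ^ 2)⁻¹)) • fockH (s ^ 2) (t ^ 2) M i (-(r : ℤ))) r
    simp only [map_smul, wFockHom_apply] at h1
    rw [hr, Int.toNat_natCast, extZero_natCast, Module.End.mul_apply, wQPartial_single, neg_one_mul]
    simp only [wH]
    rw [← h1, wFock_single, map_smul]
  · rw [extZero_of_neg _ (by omega)]
    simp

theorem wQPartial_mul (hs : s ≠ 0) (i : Fin (n + 1)) (r r' : ℤ) :
    wQPartial p s i r * wQPartial p s i r' = wQPartial p s i (r + r') := by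
  refine Finsupp.lhom_ext fun m v => ?_
  simp only [Module.End.mul_apply, wQPartial_single]
  rw [smul_smul, ← zpow_add₀ (pow_ne_zero 2 hs), add_mul]

theorem wQPartial_zero (i : Fin (n + 1)) : wQPartial p s i 0 = 1 := by
  refine Finsupp.lhom_ext fun m v => ?_
  simp [wQPartial_single]

theorem wQPartial_comm (i j : Fin (n + 1)) (r r' : ℤ) :
    wQPartial p s i r * wQPartial p s j r' = wQPartial p s j r' * wQPartial p s i r := by
  refine Finsupp.lhom_ext fun m v => ?_
  simp only [Module.End.mul_apply, wQPartial_single]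
  rw [smul_comm]

theorem wQPartial_mul_wH (i j : Fin (n + 1)) (r l : ℤ) :
    wQPartial p s i r * wH p s t M j l = wH p s t M j l * wQPartial p s i r := by
  refine Finsupp.lhom_ext fun m v => ?_
  simp only [Module.End.mul_apply, wQPartial_single, wH_single, map_smul]

theorem wQD_mul_wQPartial {σ : L} (hσ : σ ≠ 0) (i : Fin (n + 1)) (r : ℤ) :
    wQD p σ * wQPartial p s i r = wQPartial p s i r * wQD p σ := by
  refine Finsupp.lhom_ext fun m v => ?_
  simp only [Module.End.mul_apply, wQPartial_single, wQD_single _ _ hσ, map_smul]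
  rw [smul_comm]

theorem fockScale_mul_inv {q : L} (hq : q ≠ 0) : fockScale n q * fockScale n q⁻¹ = 1 := by
  refine (MvPolynomial.basisMonomials _ L).ext fun μ => ?_
  rw [Module.End.mul_apply, MvPolynomial.coe_basisMonomials, fockScale_monomial, map_smul,
    fockScale_monomial, smul_smul, inv_zpow, inv_mul_cancel₀ (zpow_ne_zero _ hq), one_smul]
  rfl

theorem wQD_mul_inv (hs : s ≠ 0) : wQD p s * wQD p s⁻¹ = 1 := by
  refine Finsupp.lhom_ext fun m v => ?_
  have h := LinearMap.congr_fun (fockScale_mul_inv (n := n) (pow_ne_zero 2 hs)) v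
  rw [Module.End.mul_apply, Module.End.one_apply] at h
  simp only [Module.End.mul_apply, wQD_single _ _ hs, wQD_single _ _ (inv_ne_zero hs), map_smul]
  rw [inv_pow, h, smul_smul, inv_zpow, mul_inv_cancel₀ (zpow_ne_zero _ (pow_ne_zero 2 hs)),
    one_smul]
  rfl

theorem wQD_mul_wH (hs : s ≠ 0) (i : Fin (n + 1)) (l : ℤ) :
    wQD p s * wH p s t M i l = (s ^ 2) ^ l • (wH p s t M i l * wQD p s) := by
  refine Finsupp.lhom_ext fun m v => ?_
  have h := LinearMap.congr_fun (fockScale_mul_fockH (M := M) (pow_ne_zero 2 hs) (s ^ 2) (t ^ 2) i l) v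
  rw [Module.End.mul_apply, LinearMap.smul_apply, Module.End.mul_apply] at h
  simp only [Module.End.mul_apply, LinearMap.smul_apply, wQD_single _ _ hs, wH_single, map_smul]
  rw [h, Finsupp.smul_single, smul_comm]

theorem wH_comm (hM : ∀ i j, M i j = -M j i) (i j : Fin (n + 1)) (k l : ℤ)
    (hk : k ≠ 0) :
    wH p s t M i k * wH p s t M j l - wH p s t M j l * wH p s t M i k =
      if k + l = 0 then ((k : L)⁻¹ * qInt (s ^ 2) (k * affCartan n i j) * qInt (s ^ 2) k *
        (t ^ 2) ^ (-k * M i j)) • 1 else 0 := by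
  refine Finsupp.lhom_ext fun m v => ?_
  have h := LinearMap.congr_fun (fockH_comm (s ^ 2) (t ^ 2) M hM affCartan_comm i j k l hk) v
  rw [LinearMap.sub_apply, Module.End.mul_apply, Module.End.mul_apply] at h
  simp only [Module.End.mul_apply, LinearMap.sub_apply, wH_single]
  rw [← Finsupp.single_sub, h]
  split_ifs
  · rw [Module.algebraMap_end_apply]
    simp only [LinearMap.smul_apply, Module.End.one_apply, Finsupp.smul_single]
  · simp

theorem list_prod_wQPartial (hs : s ≠ 0) :
    (List.ofFn fun i : Fin (n + 1) => wQPartial p s i 1).prod = 1 := by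
  have h : ∀ (l : List (Fin (n + 1))) (m : Fin n → ℤ) (v : Fock n L),
      (l.map fun i => wQPartial p s i 1).prod (Finsupp.single m v) =
        Finsupp.single m ((s ^ 2) ^ (l.map fun i => latPair p i m).sum • v) := by
    intro l m v
    induction l generalizing v with
    | nil => simp
    | cons i l ih =>
      rw [List.map_cons, List.prod_cons, Module.End.mul_apply, ih, wQPartial_single, smul_smul,
        List.map_cons, List.sum_cons, zpow_add₀ (pow_ne_zero 2 hs), one_mul]
  refine Finsupp.lhom_ext fun m v => ?_
  rw [List.ofFn_eq_map, h, ← List.ofFn_eq_map, List.sum_ofFn, sum_latPair]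
  simp

end DiagonalOperators
end

noncomputable section

/-! ### The currents on W(p)_n -/

section VertexOperators

variable {n : ℕ} {L : Type*} [Field L] [CharZero L]

/-- The scalar by which `e^{± ᾱ_i} z^{± H_{i,0}}` acts on `e^β`, up to the power of `z`. -/
def vertexScalar (p : Fin (n + 1)) (t : L) (M : Matrix (Fin (n + 1)) (Fin (n + 1)) ℤ)
    (x : Fin (n + 1) × ℤˣ) (m : Fin n → ℤ) : L :=
  t ^ ((x.2 : ℤ) * latTwist M x.1 m) *
    twistSign L (latCoord (rootBar x.1)) (latCoord m + fundCoord n p) *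
    (if x.2 = 1 then 1 else rootSign L x.1 x.1)

/-- The operators `E_{i,k}` (`x = (i, 1)`) and `F_{i,k}` (`x = (i, -1)`). -/
def wVertex (p : Fin (n + 1)) (s t : L) (M : Matrix (Fin (n + 1)) (Fin (n + 1)) ℤ)
    (x : Fin (n + 1) × ℤˣ) (k : ℤ) : Module.End L (WSpace n p L) :=
  Finsupp.lsum L fun m => vertexScalar p t M x m • (Finsupp.lsingle (m + (x.2 : ℤ) • rootBar x.1) ∘ₗ
    (fockFamily s t M).op x (-k - 1 - x.2 * latPair p x.1 m))

variable {p : Fin (n + 1)} {s t : L} {M : Matrix (Fin (n + 1)) (Fin (n + 1)) ℤ}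

theorem wVertex_single (x : Fin (n + 1) × ℤˣ) (k : ℤ) (m : Fin n → ℤ) (v : Fock n L) :
    wVertex p s t M x k (Finsupp.single m v) =
      Finsupp.single (m + (x.2 : ℤ) • rootBar x.1) (vertexScalar p t M x m •
        (fockFamily s t M).op x (-k - 1 - x.2 * latPair p x.1 m) v) := by
  simp [wVertex]

theorem wE_eq_wVertex (i : Fin (n + 1)) (k : ℤ) : wE p s t M i k = wVertex p s t M (i, 1) k := by
  refine Finsupp.lhom_ext fun m v => ?_
  rw [wVertex_single]
  simp only [wE, wExp, Module.End.mul_apply, Finsupp.lsum_single, LinearMap.smul_apply,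
    LinearMap.comp_apply, Finsupp.lsingle_apply, map_smul, fockE_eq_op, vertexScalar, if_true,
    Units.val_one, one_mul, one_smul, mul_one, Finsupp.smul_single, smul_smul]
  rw [add_comm m, sub_sub (-k), add_comm _ (1 : ℤ)]

/-- The inverse of e^(ᾱ_i) carries the sign ε(ᾱ_i, β - ᾱ_i) = ε(ᾱ_i, β) ε(ᾱ_i, ᾱ_i), whence the
additional `rootSign L i i` in `vertexScalar`. -/
theorem wF_eq_wVertex (i : Fin (n + 1)) (k : ℤ) : wF p s t M i k = wVertex p s t M (i, -1) k := by
  refine Finsupp.lhom_ext fun m v => ?_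
  have h := twistSign_latCoord_add_smul_rootBar (L := L) i i m (-1) (fundCoord n p)
  rw [wVertex_single]
  rw [Units.val_neg, Units.val_one, neg_smul, one_smul, ← sub_eq_add_neg] at h
  simp only [wF, wExpInv, Module.End.mul_apply, Finsupp.lsum_single, LinearMap.smul_apply,
    LinearMap.comp_apply, Finsupp.lsingle_apply, map_smul, fockF_eq_op, vertexScalar,
    Units.val_neg, Units.val_one, neg_mul, one_mul, neg_smul, one_smul, Finsupp.smul_single,
    smul_smul, twistSign_inv, h, ← sub_eq_add_neg]
  rw [if_neg (by decide), sub_sub (-k), add_comm _ (1 : ℤ), mul_assoc]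

variable {a : ℤ}

theorem vertexScalar_add_smul_rootBar (hn : 1 < n) (ht : t ≠ 0) (i j : Fin (n + 1)) (e f : ℤˣ)
    (m : Fin n → ℤ) :
    vertexScalar p t (torMatrix n a) (i, e) (m + (f : ℤ) • rootBar j) =
      vertexScalar p t (torMatrix n a) (i, e) m *
        (t ^ (-(e * f * torMatrix n a i j) : ℤ) * rootSign L i j) := by
  simp only [vertexScalar]
  rw [latTwist_add_smul_rootBar hn, twistSign_latCoord_add_smul_rootBar,
    show (e : ℤ) * (latTwist (torMatrix n a) i m - f * torMatrix n a i j) =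
      e * latTwist (torMatrix n a) i m + -(e * f * torMatrix n a i j) by ring, zpow_add₀ ht]
  ring

/-- The outer scalar is the same for both orders of the factors. What remains depends on the order:
a power of t, a sign, and a mode shift by e f a_ij; so relations on W(p)_n reduce to relations on
the Fock space. -/
theorem wVertex_wVertex_single (hn : 1 < n) (ht : t ≠ 0) (i j : Fin (n + 1)) (e f : ℤˣ) (k l : ℤ)
    (m : Fin n → ℤ) (v : Fock n L) :
    wVertex p s t (torMatrix n a) (i, e) k
        (wVertex p s t (torMatrix n a) (j, f) l (Finsupp.single m v)) =
      (vertexScalar p t (torMatrix n a) (i, e) m * vertexScalar p t (torMatrix n a) (j, f) m) •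
        Finsupp.single (m + (f : ℤ) • rootBar j + (e : ℤ) • rootBar i)
        ((t ^ (-(e * f * torMatrix n a i j) : ℤ) * rootSign L i j) •
          (fockFamily s t (torMatrix n a)).op (i, e)
            (-k - 1 - e * latPair p i m - e * f * affCartan n i j)
          ((fockFamily s t (torMatrix n a)).op (j, f) (-l - 1 - f * latPair p j m) v)) := by
  rw [wVertex_single, wVertex_single, map_smul, smul_smul, Finsupp.smul_single, smul_smul]
  simp only [vertexScalar_add_smul_rootBar hn ht, latPair_add_smul_rootBar]
  rw [mul_add, ← mul_assoc, ← sub_sub, ← mul_assoc (e : ℤ)]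
  congr 2
  ring

/-- Once ε(j, i) is replaced by (-1)^(a_ij) ε(i, j), the cases i = j, a_ij = 0 and a_ij = -1 are the
quadratic, trivial and geometric exchange relations. -/
theorem op_quadratic (hs : s ≠ 0) (ht : t ≠ 0) (hq : ∀ k : ℕ, k ≠ 0 → qInt (s ^ 2) k ≠ 0)
    (hn : 1 < n) (i j : Fin (n + 1)) (e : ℤˣ) (A B : ℤ) (v : Fock n L) :
    ((t ^ 2) ^ torMatrix n a i j * (t ^ (-torMatrix n a i j) * rootSign L i j)) •
        (fockFamily s t (torMatrix n a)).op (i, e) (A - 1 - affCartan n i j)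
          ((fockFamily s t (torMatrix n a)).op (j, e) B v) -
      (((s ^ 2) ^ ((e : ℤ) * affCartan n i j) * (t ^ 2) ^ torMatrix n a i j) *
          (t ^ torMatrix n a i j * rootSign L j i)) •
        (fockFamily s t (torMatrix n a)).op (j, e) (B - affCartan n i j)
          ((fockFamily s t (torMatrix n a)).op (i, e) (A - 1) v) =
    ((s ^ 2) ^ ((e : ℤ) * affCartan n i j) * (t ^ (-torMatrix n a i j) * rootSign L i j)) •
        (fockFamily s t (torMatrix n a)).op (i, e) (A - affCartan n i j)
          ((fockFamily s t (torMatrix n a)).op (j, e) (B - 1) v) -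
      (t ^ torMatrix n a i j * rootSign L j i) •
        (fockFamily s t (torMatrix n a)).op (j, e) (B - 1 - affCartan n i j)
          ((fockFamily s t (torMatrix n a)).op (i, e) A v) := by
  have hq0 : s ^ 2 ≠ 0 := pow_ne_zero 2 hs
  have hτ : t ^ torMatrix n a i j ≠ 0 := zpow_ne_zero _ ht
  have h2 : (t ^ 2) ^ torMatrix n a i j = (t ^ torMatrix n a i j) ^ 2 := by
    rw [← zpow_natCast t, ← zpow_natCast (t ^ _), ← zpow_mul, ← zpow_mul, mul_comm]
  rw [h2, zpow_neg t, rootSign_comm i j]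
  rcases eq_or_ne i j with rfl | hij
  · rw [affCartan_self hn, torMatrix_self]
    have h := (fockFamily s t (torMatrix n a)).op_exchange_of_quad
      (pow_ne_zero 2 (zpow_ne_zero _ hq0)) (fockFamily_c_self hs ht hq i e (affCartan_self hn i)
        (torMatrix_self a i)) A B v
    have h3 : (s ^ 2) ^ ((e : ℤ) * 2) = (((s ^ 2) ^ (-(e : ℤ))) ^ 2)⁻¹ := by
      rw [zpow_neg, inv_pow, inv_inv, zpow_mul, zpow_ofNat]
    rw [h3, show A - 1 - 2 = A - 3 by ring, show B - 1 - 2 = B - 3 by ring]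
    simp only [zpow_ofNat, zpow_zero, pow_zero]
    linear_combination (norm := module) rootSign L i i • h
  · rcases affCartan_eq_zero_or hn hij with h0 | h0
    · have hc := fun e => fockFamily_c_of_zero (M := torMatrix n a) hs ht hq i j e e h0
      have hc' := fun e => fockFamily_c_of_zero (M := torMatrix n a) hs ht hq j i e e
        ((affCartan_comm j i).trans h0)
      rw [h0, torMatrix_eq_zero hn a h0]
      simp only [sub_zero]
      rw [(fockFamily s t (torMatrix n a)).op_comm_of_one (hc e) (hc' e) (A - 1) B,
        (fockFamily s t (torMatrix n a)).op_comm_of_one (hc e) (hc' e) A (B - 1)]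
      simp
    · have h := (fockFamily s t (torMatrix n a)).op_exchange_of_geom
        (fockFamily_c_of_neg_one_same hs ht hq i j e h0)
        (fockFamily_c_of_neg_one_same hs ht hq j i e ((affCartan_comm j i).trans h0)) A B v
      rw [torMatrix_skew a j i, neg_neg, zpow_neg t] at h
      rw [h0, mul_neg_one]
      simp only [sub_neg_eq_add, sub_add_cancel]
      generalize (s ^ 2) ^ (-(e : ℤ)) = Q at *
      generalize t ^ torMatrix n a i j = τ at *
      linear_combination (norm := skip) (τ * rootSign L i j) • h
      rw [zpow_neg_one]
      match_scalars <;> field_simp <;> ring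

theorem wVertex_quadratic (hs : s ≠ 0) (ht : t ≠ 0) (hq : ∀ k : ℕ, k ≠ 0 → qInt (s ^ 2) k ≠ 0)
    (hn : 1 < n) (i j : Fin (n + 1)) (e : ℤˣ) (k l : ℤ) :
    (t ^ 2) ^ torMatrix n a i j • (wVertex p s t (torMatrix n a) (i, e) (k + 1) *
        wVertex p s t (torMatrix n a) (j, e) l) -
      ((s ^ 2) ^ ((e : ℤ) * affCartan n i j) * (t ^ 2) ^ torMatrix n a i j) •
        (wVertex p s t (torMatrix n a) (j, e) l * wVertex p s t (torMatrix n a) (i, e) (k + 1)) =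
    (s ^ 2) ^ ((e : ℤ) * affCartan n i j) • (wVertex p s t (torMatrix n a) (i, e) k *
        wVertex p s t (torMatrix n a) (j, e) (l + 1)) -
      wVertex p s t (torMatrix n a) (j, e) (l + 1) * wVertex p s t (torMatrix n a) (i, e) k := by
  refine Finsupp.lhom_ext fun m v => ?_
  have he : (e : ℤ) * e = 1 := by
    rcases Int.units_eq_one_or e with rfl | rfl <;> rfl
  simp only [LinearMap.sub_apply, LinearMap.smul_apply, Module.End.mul_apply,
    wVertex_wVertex_single hn ht, he, one_mul]
  rw [add_right_comm m ((e : ℤ) • rootBar i),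
    mul_comm (vertexScalar p t (torMatrix n a) (j, e) m)]
  simp only [smul_comm _ (_ * vertexScalar p t (torMatrix n a) (j, e) m)]
  rw [← smul_sub, ← smul_sub]
  congr 1
  simp only [Finsupp.smul_single, smul_smul]
  rw [← Finsupp.single_sub, ← Finsupp.single_sub]
  congr 1
  have h := op_quadratic (a := a) hs ht hq hn i j e (-k - 1 - e * latPair p i m)
    (-l - 1 - e * latPair p j m) v
  rw [affCartan_comm j i, torMatrix_skew a j i, neg_neg,
    show ∀ x : ℤ, -(k + 1) - 1 - x = -k - 1 - x - 1 by intro x; ring,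
    show ∀ x : ℤ, -(l + 1) - 1 - x = -l - 1 - x - 1 by intro x; ring]
  exact h

/-- The commutator of the currents `E_i(z)` and `F_j(w)`. -/
theorem wVertex_commutator (hs : s ≠ 0) (ht : t ≠ 0) (hq : ∀ k : ℕ, k ≠ 0 → qInt (s ^ 2) k ≠ 0)
    (hn : 1 < n) (i j : Fin (n + 1)) (k l : ℤ) :
    wVertex p s t (torMatrix n a) (i, 1) k * wVertex p s t (torMatrix n a) (j, -1) l -
      wVertex p s t (torMatrix n a) (j, -1) l * wVertex p s t (torMatrix n a) (i, 1) k =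
    if i = j then (s ^ 2 - (s ^ 2)⁻¹)⁻¹ •
      (s ^ (k - l) • wKPlus p s t (torMatrix n a) i (k + l) -
        s ^ (l - k) • wKMinus p s t (torMatrix n a) i (k + l)) else 0 := by
  refine Finsupp.lhom_ext fun m v => ?_
  simp only [LinearMap.sub_apply, Module.End.mul_apply, wVertex_wVertex_single hn ht,
    Units.val_neg, Units.val_one, mul_neg, neg_mul, one_mul, mul_one, neg_neg, sub_neg_eq_add]
  rw [add_right_comm m ((1 : ℤ) • rootBar i),
    mul_comm (vertexScalar p t (torMatrix n a) (j, -1) m), ← smul_sub, ← Finsupp.single_sub]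
  split_ifs with h
  · subst h
    have h1 := op_commutator_self hs ht hq i (affCartan_self hn i) (torMatrix_self a i)
      (-k - latPair p i m) (-l + latPair p i m) v
    -- The powers of t in E_i and F_i are inverse to each other, and every lattice sign occurs
    -- squared.
    have h2 : vertexScalar p t (torMatrix n a) (i, 1) m *
        vertexScalar p t (torMatrix n a) (i, -1) m * rootSign L i i = 1 := by
      rw [vertexScalar, vertexScalar]
      rw [if_pos rfl, if_neg (show ¬(-1 : ℤˣ) = 1 by decide), Units.val_neg, Units.val_one, one_mul, neg_one_mul,
        zpow_neg, mul_one]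
      have h3 : t ^ latTwist (torMatrix n a) i m ≠ 0 := zpow_ne_zero _ ht
      have h4 := twistSign_mul_self (L := L) (latCoord (rootBar i)) (latCoord m + fundCoord n p)
      have h5 := rootSign_mul_self (L := L) i i
      field_simp
      linear_combination h4 * rootSign L i i ^ 2 + h5
    rw [torMatrix_self, affCartan_self hn, neg_smul, one_smul, neg_add_cancel_right, zpow_zero,
      one_mul, ← smul_sub, ← Finsupp.smul_single, smul_smul, h2, one_smul]
    simp only [LinearMap.smul_apply, LinearMap.sub_apply, wKPlus_single, wKMinus_single,
      Finsupp.smul_single, ← Finsupp.single_sub]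
    rw [show -k - 1 - latPair p i m + 2 = -k - latPair p i m + 1 by ring,
      show -l - 1 + latPair p i m = -l + latPair p i m - 1 by ring,
      show -l + latPair p i m - 1 + 2 = -l + latPair p i m + 1 by ring,
      show -k - 1 - latPair p i m = -k - latPair p i m - 1 by ring, h1]
    have h6 : ∀ x : ℤ, (s ^ 2) ^ x = s ^ (2 * x) := fun x => by
      rw [zpow_mul, zpow_ofNat]
    rw [smul_smul (s ^ (k - l)), smul_smul (s ^ (l - k)), h6, h6, ← zpow_add₀ hs, ← zpow_add₀ hs]
    congr 5 <;> ring_nf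
  -- For adjacent nodes the sign -1 of the lattice factor cancels the sign with which the linear
  -- contractions exchange; for a_ij = 0 everything commutes.
  · suffices h1 : (t ^ torMatrix n a i j * rootSign L i j) •
        (fockFamily s t (torMatrix n a)).op (i, 1) (-k - 1 - latPair p i m + affCartan n i j)
          ((fockFamily s t (torMatrix n a)).op (j, -1) (-l - 1 + latPair p j m) v) -
        (t ^ torMatrix n a j i * rootSign L j i) •
          (fockFamily s t (torMatrix n a)).op (j, -1) (-l - 1 + latPair p j m + affCartan n j i)
          ((fockFamily s t (torMatrix n a)).op (i, 1) (-k - 1 - latPair p i m) v) = 0 by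
      rw [h1]
      simp
    have hc := affCartan_comm j i
    rw [rootSign_comm i j, hc, torMatrix_skew a j i]
    rcases affCartan_eq_zero_or hn h with h0 | h0
    · rw [h0, torMatrix_eq_zero hn a h0]
      rw [h0] at hc
      simp only [neg_zero, zpow_zero, one_mul, add_zero]
      rw [(fockFamily s t (torMatrix n a)).op_comm_of_one
        (fockFamily_c_of_zero hs ht hq i j 1 (-1) h0) (fockFamily_c_of_zero hs ht hq j i (-1) 1 hc),
        sub_self]
    · rw [h0] at hc ⊢
      have h2 := (fockFamily s t (torMatrix n a)).op_anticomm_of_linear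
        (zpow_ne_zero (-torMatrix n a i j) ht) (fockFamily_c_of_neg_one_opp hs ht hq i j 1 h0)
        (fun k => by
          have := fockFamily_c_of_neg_one_opp (M := torMatrix n a) hs ht hq j i (-1) hc k
          rw [neg_neg, torMatrix_skew a j i, neg_neg] at this
          rw [this, zpow_neg, inv_inv])
        (-k - 1 - latPair p i m) (-l - 1 + latPair p j m) v
      rw [zpow_neg, inv_inv] at h2
      rw [zpow_neg, ← sub_eq_add_neg, ← sub_eq_add_neg]
      rw [zpow_neg_one]
      linear_combination (norm := module) rootSign L i j • h2

theorem wVertex_comm_of_zero (hs : s ≠ 0) (ht : t ≠ 0) (hq : ∀ k : ℕ, k ≠ 0 → qInt (s ^ 2) k ≠ 0)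
    (hn : 1 < n) {i j : Fin (n + 1)} (h0 : affCartan n i j = 0) (e : ℤˣ)
    (k l : ℤ) :
    wVertex p s t (torMatrix n a) (i, e) k * wVertex p s t (torMatrix n a) (j, e) l =
      wVertex p s t (torMatrix n a) (j, e) l * wVertex p s t (torMatrix n a) (i, e) k := by
  refine Finsupp.lhom_ext fun m v => ?_
  have hc := (affCartan_comm j i).trans h0
  simp only [Module.End.mul_apply, wVertex_wVertex_single hn ht]
  rw [add_right_comm m ((e : ℤ) • rootBar i), rootSign_comm i j, torMatrix_skew a j i, hc, h0,
    torMatrix_eq_zero hn a h0, mul_comm (vertexScalar p t (torMatrix n a) (j, e) m),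
    (fockFamily s t (torMatrix n a)).op_comm_of_one
        (fockFamily_c_of_zero hs ht hq i j e e h0) (fockFamily_c_of_zero hs ht hq j i e e hc)]
  simp

/-- The Serre relation for adjacent nodes. -/
theorem wVertex_serre (hs : s ≠ 0) (ht : t ≠ 0) (hq : ∀ k : ℕ, k ≠ 0 → qInt (s ^ 2) k ≠ 0)
    (hn : 1 < n) {i j : Fin (n + 1)} (h0 : affCartan n i j = -1) (e : ℤˣ)
    (k₁ k₂ l : ℤ) :
    (wVertex p s t (torMatrix n a) (i, e) k₁ * wVertex p s t (torMatrix n a) (i, e) k₂ *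
          wVertex p s t (torMatrix n a) (j, e) l -
        (s ^ 2 + (s ^ 2)⁻¹) • (wVertex p s t (torMatrix n a) (i, e) k₁ *
          wVertex p s t (torMatrix n a) (j, e) l * wVertex p s t (torMatrix n a) (i, e) k₂) +
        wVertex p s t (torMatrix n a) (j, e) l * wVertex p s t (torMatrix n a) (i, e) k₁ *
          wVertex p s t (torMatrix n a) (i, e) k₂) +
      (wVertex p s t (torMatrix n a) (i, e) k₂ * wVertex p s t (torMatrix n a) (i, e) k₁ *
          wVertex p s t (torMatrix n a) (j, e) l -
        (s ^ 2 + (s ^ 2)⁻¹) • (wVertex p s t (torMatrix n a) (i, e) k₂ *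
          wVertex p s t (torMatrix n a) (j, e) l * wVertex p s t (torMatrix n a) (i, e) k₁) +
        wVertex p s t (torMatrix n a) (j, e) l * wVertex p s t (torMatrix n a) (i, e) k₂ *
          wVertex p s t (torMatrix n a) (i, e) k₁) = 0 := by
  refine Finsupp.lhom_ext fun m v => ?_
  have hc := (affCartan_comm j i).trans h0
  have he : (e : ℤ) * e = 1 := by
    rcases Int.units_eq_one_or e with rfl | rfl <;> rfl
  have hq0 : s ^ 2 ≠ 0 := pow_ne_zero 2 hs
  have h := (fockFamily s t (torMatrix n a)).serre (i, e) (j, e)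
    (zpow_ne_zero (-(e : ℤ)) hq0) (zpow_ne_zero (-torMatrix n a i j) ht)
    (fockFamily_c_self hs ht hq i e (affCartan_self hn i) (torMatrix_self a i))
    (fockFamily_c_of_neg_one_same hs ht hq i j e h0)
    (fun k => by
      rw [fockFamily_c_of_neg_one_same hs ht hq j i e hc, torMatrix_skew a j i, neg_neg,
        zpow_neg t, inv_pow, inv_inv])
    (-k₁ - 1 - e * latPair p i m) (-k₂ - 1 - e * latPair p i m) (-l - 1 - e * latPair p j m) v
  have hQ : (s ^ 2) ^ (-(e : ℤ)) + ((s ^ 2) ^ (-(e : ℤ)))⁻¹ = s ^ 2 + (s ^ 2)⁻¹ := by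
    rcases Int.units_eq_one_or e with rfl | rfl
    · simp [add_comm]
    · simp
  rw [hQ, zpow_neg] at h
  have hτ : t ^ torMatrix n a i j ≠ 0 := zpow_ne_zero _ ht
  have h1 := rootSign_mul_self (L := L) i j
  simp only [LinearMap.add_apply, LinearMap.sub_apply, LinearMap.smul_apply, Module.End.mul_apply,
    wVertex_single, map_smul, vertexScalar_add_smul_rootBar hn ht, latPair_add_smul_rootBar, he,
    one_mul, mul_add, ← mul_assoc, torMatrix_self, affCartan_self hn, h0, hc, torMatrix_skew a j i,
    neg_neg, neg_zero, zpow_zero, zpow_neg, smul_smul, rootSign_comm i j, LinearMap.zero_apply]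
  rw [show m + (e : ℤ) • rootBar i + (e : ℤ) • rootBar j + (e : ℤ) • rootBar i =
      m + (e : ℤ) • rootBar j + (e : ℤ) • rootBar i + (e : ℤ) • rootBar i by abel,
    show m + (e : ℤ) • rootBar i + (e : ℤ) • rootBar i + (e : ℤ) • rootBar j =
      m + (e : ℤ) • rootBar j + (e : ℤ) • rootBar i + (e : ℤ) • rootBar i by abel]
  simp only [Finsupp.smul_single, ← Finsupp.single_add, ← Finsupp.single_sub]
  refine (congrArg (Finsupp.single _) ?_).trans (Finsupp.single_zero _)
  simp only [show ∀ x y : ℤ, x - 1 - (y + -1 + 2) = x - 1 - y - 1 by intro x y; ring,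
    show ∀ x y : ℤ, x - 1 - (y + 2 + -1) = x - 1 - y - 1 by intro x y; ring,
    show ∀ x y : ℤ, x - 1 - (y + -1 + -1) = x - 1 - y + 2 by intro x y; ring,
    show ∀ x y : ℤ, x - 1 - (y + -1) = x - 1 - y + 1 by intro x y; ring,
    show ∀ x y : ℤ, x - 1 - (y + 2) = x - 1 - y - 2 by intro x y; ring, zpow_one]
  generalize t ^ torMatrix n a i j = τ at *
  linear_combination (norm := skip) (vertexScalar p t (torMatrix n a) (i, e) m ^ 2 *
    vertexScalar p t (torMatrix n a) (j, e) m * rootSign L i i) • h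
  -- Only the word iji mixes ε(i, j) with ε(j, i) = -ε(i, j). This turns the + of `serre` into the -
  -- of the middle Serre term; the other words contain a square.
  rcases mul_self_eq_one_iff.mp h1 with h1 | h1 <;> rw [h1] <;> match_scalars <;> field_simp <;> ring

theorem wH_mul_wVertex (hs : s ≠ 0) (hq : ∀ k : ℕ, k ≠ 0 → qInt (s ^ 2) k ≠ 0)
    (i j : Fin (n + 1)) (e : ℤˣ) (k l : ℤ) (hk : k ≠ 0) :
    wH p s t (torMatrix n a) i k * wVertex p s t (torMatrix n a) (j, e) l -
        wVertex p s t (torMatrix n a) (j, e) l * wH p s t (torMatrix n a) i k =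
      (((e : ℤ) : L) * ((k : L)⁻¹ * qInt (s ^ 2) (k * affCartan n i j) *
        (t ^ 2) ^ (-k * torMatrix n a i j)) * s ^ (-(e : ℤ) * |k|)) •
        wVertex p s t (torMatrix n a) (j, e) (k + l) := by
  refine Finsupp.lhom_ext fun m v => ?_
  have h := LinearMap.congr_fun (fockH_mul_op (t := t) hs hq (torMatrix_skew a) affCartan_comm i j e k
    (-l - 1 - e * latPair p j m) hk) v
  simp only [LinearMap.add_apply, LinearMap.smul_apply, Module.End.mul_apply] at h
  simp only [LinearMap.sub_apply, LinearMap.smul_apply, Module.End.mul_apply, wVertex_single,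
    wH_single, map_smul, h, Finsupp.smul_single, ← Finsupp.single_sub]
  rw [smul_add, add_sub_cancel_left, smul_comm,
    show -(k + l) - 1 - (e : ℤ) * latPair p j m = -l - 1 - e * latPair p j m - k by ring]

theorem wQPartial_mul_wVertex (hs : s ≠ 0) (i j : Fin (n + 1)) (e : ℤˣ) (r k : ℤ) :
    wQPartial p s i r * wVertex p s t M (j, e) k =
      (s ^ 2) ^ (r * (e * affCartan n i j)) • (wVertex p s t M (j, e) k * wQPartial p s i r) := by
  refine Finsupp.lhom_ext fun m v => ?_
  simp only [LinearMap.smul_apply, Module.End.mul_apply, wVertex_single,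
    wQPartial_single, map_smul, Finsupp.smul_single, latPair_add_smul_rootBar]
  rw [mul_add, zpow_add₀ (pow_ne_zero 2 hs)]
  simp only [smul_smul]
  congr 2
  ring

/-- The Fock part contributes q^(k + 1 + e⟨h̄_i, β⟩) and the change of lattice energy q^(-e⟨h̄_i, β⟩
- 1). The extra +1 in z^(±H_{i,0} + 1) is thus matched by (ᾱ_i|ᾱ_i)/2 = 1. -/
theorem wQD_mul_wVertex (hn : 1 < n) (hs : s ≠ 0) (x : Fin (n + 1) × ℤˣ) (k : ℤ) :
    wQD p s * wVertex p s t M x k = (s ^ 2) ^ k • (wVertex p s t M x k * wQD p s) := by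
  refine Finsupp.lhom_ext fun m v => ?_
  have hq0 : s ^ 2 ≠ 0 := pow_ne_zero 2 hs
  have h := LinearMap.congr_fun (fockScale_mul_op (s := s) (t := t) (M := M) hq0 x
    (-k - 1 - x.2 * latPair p x.1 m)) v
  simp only [LinearMap.smul_apply, Module.End.mul_apply] at h
  simp only [LinearMap.smul_apply, Module.End.mul_apply, wVertex_single,
    wQD_single _ _ hs, map_smul, h, Finsupp.smul_single, latEnergy_add_smul_rootBar hn]
  simp only [smul_smul, mul_left_comm _ (vertexScalar p t M x m), ← mul_assoc, ← zpow_add₀ hq0]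
  congr 4
  ring

end VertexOperators
end

noncomputable section

/-! ### Adjoining a Laurent variable u -/

section Graded

variable {K L V : Type*} [Field K] [Field L] [Algebra K L] [AddCommGroup V] [Module L V]
  [Module K V] [IsScalarTower K L V]

/-- The operator `T ⊗ u ^ d` on `V ⊗ L[u, u⁻¹]`. -/
def gradedOp (T : Module.End L V) (d : ℤ) : Module.End L (ℤ →₀ V) :=
  Finsupp.lsum L fun z => Finsupp.lsingle (z + d) ∘ₗ T

theorem gradedOp_single (T : Module.End L V) (d z : ℤ) (v : V) :
    gradedOp T d (Finsupp.single z v) = Finsupp.single (z + d) (T v) := by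
  simp [gradedOp]

theorem gradedOp_mul (S T : Module.End L V) (d d' : ℤ) :
    gradedOp S d * gradedOp T d' = gradedOp (S * T) (d + d') := by
  refine Finsupp.lhom_ext fun z v => ?_
  simp only [Module.End.mul_apply, gradedOp_single]
  rw [add_assoc, add_comm d']

theorem gradedOp_one : gradedOp (1 : Module.End L V) 0 = 1 := by
  refine Finsupp.lhom_ext fun z v => ?_
  simp [gradedOp_single]

theorem gradedOp_sub (S T : Module.End L V) (d : ℤ) :
    gradedOp (S - T) d = gradedOp S d - gradedOp T d := by
  refine Finsupp.lhom_ext fun z v => ?_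
  simp [gradedOp_single]

theorem gradedOp_add (S T : Module.End L V) (d : ℤ) :
    gradedOp (S + T) d = gradedOp S d + gradedOp T d := by
  refine Finsupp.lhom_ext fun z v => ?_
  simp [gradedOp_single]

theorem gradedOp_smul (c : L) (T : Module.End L V) (d : ℤ) :
    gradedOp (c • T) d = c • gradedOp T d := by
  refine Finsupp.lhom_ext fun z v => ?_
  simp [gradedOp_single]

theorem gradedOp_zero (d : ℤ) : gradedOp (0 : Module.End L V) d = 0 := by
  refine Finsupp.lhom_ext fun z v => ?_
  simp [gradedOp_single]

variable (K L V) in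
/-- The operators `T ⊗ 1` on `V ⊗ L[u, u⁻¹]`. -/
def gradedHom : Module.End L V →ₐ[K] Module.End L (ℤ →₀ V) :=
  AlgHom.ofLinearMap
    { toFun := fun T => gradedOp T 0
      map_add' := fun S T => gradedOp_add S T 0
      map_smul' := fun c T => Finsupp.lhom_ext fun z v => by simp [gradedOp_single] }
    gradedOp_one (fun S T => by simp [gradedOp_mul])

variable (V) in
/-- The operator `1 ⊗ q ^ (u ∂_u)` on `V ⊗ L[u, u⁻¹]`. -/
def gradedScale (q : L) : Module.End L (ℤ →₀ V) :=
  Finsupp.lsum L fun z => q ^ z • Finsupp.lsingle z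

theorem gradedScale_single (q : L) (z : ℤ) (v : V) :
    gradedScale V q (Finsupp.single z v) = Finsupp.single z (q ^ z • v) := by
  simp [gradedScale]

theorem gradedScale_mul_gradedOp {q : L} (hq : q ≠ 0) (T : Module.End L V) (d : ℤ) :
    gradedScale V q * gradedOp T d = q ^ d • (gradedOp T d * gradedScale V q) := by
  refine Finsupp.lhom_ext fun z v => ?_
  simp only [Module.End.mul_apply, LinearMap.smul_apply, gradedOp_single, gradedScale_single,
    map_smul, Finsupp.smul_single, smul_smul]
  rw [← zpow_add₀ hq, add_comm]

theorem gradedScale_mul_inv {q : L} (hq : q ≠ 0) : gradedScale V q * gradedScale V q⁻¹ = 1 := by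
  refine Finsupp.lhom_ext fun z v => ?_
  simp only [Module.End.mul_apply, Module.End.one_apply, gradedScale_single, smul_smul]
  rw [inv_zpow, mul_inv_cancel₀ (zpow_ne_zero _ hq), one_smul]

theorem mul_mul_of_mul_eq_smul {D D' X : Module.End L V} {c : L}
    (hD : D * D' = 1) (h : D * X = c • (X * D)) : D * X * D' = c • X := by
  rw [h, smul_mul_assoc, mul_assoc, hD, mul_one]

end Graded

/-! ### Compatibility with algebra homomorphisms and change of scalars -/

section Transport

variable {K : Type*} [Field K]

theorem map_qInt {L : Type*} [Field L] (f : K →+* L) (q : K) (k : ℤ) :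
    f (qInt q k) = qInt (f q) k := by
  simp [qInt]

theorem map_serreSum {A B : Type*} [Ring A] [Algebra K A] [Ring B] [Algebra K B] (f : A →ₐ[K] B)
    (q : K) (m : ℕ) (x : ℤ → A) (y : A) (k : Fin m → ℤ) :
    f (serreSum q m x y k) = serreSum q m (fun r => f (x r)) (f y) k := by
  simp only [serreSum, map_sum, map_smul, map_mul, map_list_prod, List.map_take, List.map_drop,
    List.map_ofFn]
  rfl

theorem serreSum_one {A : Type*} [Ring A] [Algebra K A] {q : K} (x : ℤ → A) (y : A)
    (hxy : ∀ k, x k * y = y * x k) (k : Fin 1 → ℤ) (hq : q - q⁻¹ ≠ 0) : serreSum q 1 x y k = 0 := by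
  have h1 : qInt q 1 = 1 := by simp [qInt, hq]
  simp [serreSum, Finset.sum_range_succ, qBinomial, qFactorial, h1, hxy]

theorem serreSum_two {A : Type*} [Ring A] [Algebra K A] {q : K} (x : ℤ → A) (y : A)
    (k : Fin 2 → ℤ) (hq : q - q⁻¹ ≠ 0) (hq2 : qInt q 2 ≠ 0) : serreSum q 2 x y k =
      (x (k 0) * x (k 1) * y - qInt q 2 • (x (k 0) * y * x (k 1)) + y * x (k 0) * x (k 1)) +
      (x (k 1) * x (k 0) * y - qInt q 2 • (x (k 1) * y * x (k 0)) + y * x (k 1) * x (k 0)) := by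
  have h1 : qInt q 1 = 1 := by simp [qInt, hq]
  have h2 : (Finset.univ : Finset (Equiv.Perm (Fin 2))) = {1, Equiv.swap 0 1} := by decide
  have h3 : (1 : Equiv.Perm (Fin 2)) ≠ Equiv.swap 0 1 := by decide
  rw [serreSum, h2, Finset.sum_pair h3]
  simp [Finset.sum_range_succ, qBinomial, qFactorial, Finset.prod_range_succ, h1, hq2, List.ofFn_succ,
    one_add_one_eq_two, mul_assoc]
  abel

variable {L : Type*} [Field L] [Algebra K L] {A : Type*} [Ring A] [Algebra K A] [Algebra L A]
  [IsScalarTower K L A]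

variable (K L) in
-- The algebra is defined over K while the operators are L-linear; the inverse factorials agree in
-- both fields.
theorem expCoeff_restrictScalars (x : ℕ → A) (m : ℕ) : expCoeff K x m = expCoeff L x m := by
  refine Finset.sum_congr rfl fun N _ => ?_
  rw [← algebraMap_smul L, map_inv₀, map_natCast]

theorem kPlusMode_restrictScalars (q : K) (x : A) (h h' : ℕ → A) (k : ℤ)
    (hh : ∀ r, r ≠ 0 → h r = h' r) :
    kPlusMode q x h k = kPlusMode (algebraMap K L q) x h' k := by
  unfold kPlusMode
  rw [expCoeff_restrictScalars K L]
  congr 2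
  refine expCoeff_congr L (fun r hr => ?_) _
  rw [hh r hr, ← algebraMap_smul L, map_sub, map_inv₀]

theorem kMinusMode_restrictScalars (q : K) (x : A) (h h' : ℕ → A) (k : ℤ)
    (hh : ∀ r, r ≠ 0 → h r = h' r) :
    kMinusMode q x h k = kMinusMode (algebraMap K L q) x h' k := by
  unfold kMinusMode
  rw [expCoeff_restrictScalars K L]
  congr 2
  refine expCoeff_congr L (fun r hr => ?_) _
  rw [hh r hr, ← algebraMap_smul L, map_neg, map_sub, map_inv₀]

theorem map_kPlusMode {B : Type*} [Ring B] [Algebra K B] (f : A →ₐ[K] B) (q : K) (x : A)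
    (h : ℕ → A) (k : ℤ) : f (kPlusMode q x h k) = kPlusMode q (f x) (fun r => f (h r)) k := by
  unfold kPlusMode
  split_ifs
  · rw [map_mul, map_expCoeff]
    simp only [map_smul]
  · exact map_zero f

theorem map_kMinusMode {B : Type*} [Ring B] [Algebra K B] (f : A →ₐ[K] B) (q : K) (x : A)
    (h : ℕ → A) (k : ℤ) : f (kMinusMode q x h k) = kMinusMode q (f x) (fun r => f (h r)) k := by
  unfold kMinusMode
  split_ifs
  · rw [map_mul, map_expCoeff]
    simp only [map_smul]
  · exact map_zero f

end Transport

/-! ### Modes of the currents K_i^± -/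

section KModes

variable {n : ℕ} {L : Type*} [Field L] [CharZero L] (p : Fin (n + 1)) (s t : L)
  (M : Matrix (Fin (n + 1)) (Fin (n + 1)) ℤ)

theorem kPlusMode_wQPartial (i : Fin (n + 1)) (k : ℤ) :
    kPlusMode (s ^ 2) (wQPartial p s i 1) (fun r => wH p s t M i (r : ℤ)) k =
      wKPlus p s t M i k := by
  unfold kPlusMode wKPlus
  split_ifs
  · exact commute_expCoeff_right L (fun r => Commute.smul_right (wQPartial_mul_wH i i 1 r) _) _
  · rfl

theorem kMinusMode_wQPartial (i : Fin (n + 1)) (k : ℤ) :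
    kMinusMode (s ^ 2) (wQPartial p s i (-1)) (fun r => wH p s t M i (-(r : ℤ))) k =
      wKMinus p s t M i k := by
  unfold kMinusMode wKMinus
  split_ifs
  · exact commute_expCoeff_right L (fun r => Commute.smul_right (wQPartial_mul_wH i i (-1) (-r)) _) _
  · rfl

end KModes
end

noncomputable section

/-! ### From relations on V to a representation with the Laurent variable -/

section ToroidalRepresentation

open TorGen

variable {K L V : Type*} [Field K] [Field L] [Algebra K L] [AddCommGroup V] [Module L V]
  [Module K V] [IsScalarTower K L V] {n : ℕ}

/-- The relations between operators on `V` that make `V` a module over the algebra without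
`q^{± d₂}`, with `q^{c/2}` acting by the scalar `s`; the values of `op` at `q^{± d₂}` do not
matter. -/
structure TorAction (s t : L) (M : Matrix (Fin (n + 1)) (Fin (n + 1)) ℤ)
    (op : TorGen n → Module.End L V) : Prop where
  cp : op Cp = s • 1
  cm : op Cm = s⁻¹ • 1
  d1p_d1m : op D1p * op D1m = 1
  d1m_d1p : op D1m * op D1p = 1
  kp_km (i) : op (Kp i) * op (Km i) = 1
  kp_kp (i j) : op (Kp i) * op (Kp j) = op (Kp j) * op (Kp i)
  kp_km_comm (i j) : op (Kp i) * op (Km j) = op (Km j) * op (Kp i)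
  km_km (i j) : op (Km i) * op (Km j) = op (Km j) * op (Km i)
  kp_h (i j l) (hl : l ≠ 0) : op (Kp i) * op (H j l hl) = op (H j l hl) * op (Kp i)
  km_h (i j l) (hl : l ≠ 0) : op (Km i) * op (H j l hl) = op (H j l hl) * op (Km i)
  h_h (i j k l) (hk : k ≠ 0) (hl : l ≠ 0) :
    op (H i k hk) * op (H j l hl) - op (H j l hl) * op (H i k hk) =
      if k + l = 0 then ((k : L)⁻¹ * qInt (s ^ 2) (k * affCartan n i j) * qInt (s ^ 2) k *
        (t ^ 2) ^ (-k * M i j)) • 1 else 0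
  d1p_kp (j) : op D1p * op (Kp j) = op (Kp j) * op D1p
  d1p_km (j) : op D1p * op (Km j) = op (Km j) * op D1p
  d1m_kp (j) : op D1m * op (Kp j) = op (Kp j) * op D1m
  d1m_km (j) : op D1m * op (Km j) = op (Km j) * op D1m
  d1_h (j l) (hl : l ≠ 0) : op D1p * op (H j l hl) = (s ^ 2) ^ l • (op (H j l hl) * op D1p)
  d1_e (j k) : op D1p * op (E j k) = (s ^ 2) ^ k • (op (E j k) * op D1p)
  d1_f (j k) : op D1p * op (F j k) = (s ^ 2) ^ k • (op (F j k) * op D1p)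
  k_e (i j k) : op (Kp i) * op (E j k) = (s ^ 2) ^ affCartan n i j • (op (E j k) * op (Kp i))
  k_f (i j k) : op (Kp i) * op (F j k) = (s ^ 2) ^ (-affCartan n i j) • (op (F j k) * op (Kp i))
  h_e (i j k l) (hk : k ≠ 0) : op (H i k hk) * op (E j l) - op (E j l) * op (H i k hk) =
    ((k : L)⁻¹ * qInt (s ^ 2) (k * affCartan n i j) * (t ^ 2) ^ (-k * M i j) * s ^ (-|k|)) •
      op (E j (k + l))
  h_f (i j k l) (hk : k ≠ 0) : op (H i k hk) * op (F j l) - op (F j l) * op (H i k hk) =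
    (-((k : L)⁻¹ * qInt (s ^ 2) (k * affCartan n i j) * (t ^ 2) ^ (-k * M i j)) * s ^ |k|) •
      op (F j (k + l))
  e_e (i j k l) : (t ^ 2) ^ M i j • (op (E i (k + 1)) * op (E j l)) -
      ((s ^ 2) ^ affCartan n i j * (t ^ 2) ^ M i j) • (op (E j l) * op (E i (k + 1))) =
    (s ^ 2) ^ affCartan n i j • (op (E i k) * op (E j (l + 1))) - op (E j (l + 1)) * op (E i k)
  f_f (i j k l) : (t ^ 2) ^ M i j • (op (F i (k + 1)) * op (F j l)) -
      ((s ^ 2) ^ (-affCartan n i j) * (t ^ 2) ^ M i j) • (op (F j l) * op (F i (k + 1))) =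
    (s ^ 2) ^ (-affCartan n i j) • (op (F i k) * op (F j (l + 1))) - op (F j (l + 1)) * op (F i k)
  e_f (i j k l) : op (E i k) * op (F j l) - op (F j l) * op (E i k) =
    if i = j then (s ^ 2 - (s ^ 2)⁻¹)⁻¹ •
      (s ^ (k - l) • kPlusMode (s ^ 2) (op (Kp i))
          (fun r => if hr : (r : ℤ) ≠ 0 then op (H i r hr) else 0) (k + l) -
        s ^ (l - k) • kMinusMode (s ^ 2) (op (Km i))
          (fun r => if hr : -(r : ℤ) ≠ 0 then op (H i (-r) hr) else 0) (k + l)) else 0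
  serre_e (i j) (hij : i ≠ j) (k : Fin (1 - affCartan n i j).toNat → ℤ) (l) :
    serreSum (s ^ 2) (1 - affCartan n i j).toNat (fun r => op (E i r)) (op (E j l)) k = 0
  serre_f (i j) (hij : i ≠ j) (k : Fin (1 - affCartan n i j).toNat → ℤ) (l) :
    serreSum (s ^ 2) (1 - affCartan n i j).toNat (fun r => op (F i r)) (op (F j l)) k = 0

/-- The degree of a generator with respect to `d₂`. -/
def torDeg : TorGen n → ℤ
  | .E i _ => if i = 0 then 1 else 0
  | .F i _ => if i = 0 then -1 else 0
  | _ => 0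

/-- The action of a generator on `V ⊗ L[u, u⁻¹]`, where `q^{d₂}` acts by `q ^ (u ∂_u)`. -/
def torGradedOp (s : L) (op : TorGen n → Module.End L V) : TorGen n → Module.End L (ℤ →₀ V)
  | .D2p => gradedScale _ (s ^ 2)
  | .D2m => gradedScale _ (s ^ 2)⁻¹
  | g => gradedOp (op g) (torDeg g)

theorem torGradedOp_of_notD2 (s : L) (op : TorGen n → Module.End L V) {g : TorGen n}
    (hg : g.NotD2) : torGradedOp s op g = gradedOp (op g) (torDeg g) := by
  cases g <;> first | rfl | exact hg.elim

variable (K) in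
/-- The homomorphism from the free algebra to the operators on `V ⊗ L[u, u⁻¹]`. -/
def torLift (s : L) (op : TorGen n → Module.End L V) :
    FreeAlgebra K (TorGen n) →ₐ[K] Module.End L (ℤ →₀ V) :=
  FreeAlgebra.lift K (torGradedOp s op)

variable {s t : L} {M : Matrix (Fin (n + 1)) (Fin (n + 1)) ℤ} {op : TorGen n → Module.End L V}

theorem torLift_free (g : TorGen n) : torLift K s op (free K g) = torGradedOp s op g :=
  FreeAlgebra.lift_ι_apply _ _

theorem torLift_sub (x y : FreeAlgebra K (TorGen n)) :
    torLift K s op (x - y) = torLift K s op x - torLift K s op y := by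
  exact map_sub (torLift K s op) x y

theorem torLift_serreSum (q : K) (m : ℕ) (x : ℤ → FreeAlgebra K (TorGen n))
    (y : FreeAlgebra K (TorGen n)) (k : Fin m → ℤ) :
    torLift K s op (serreSum q m x y k) =
      serreSum q m (fun r => torLift K s op (x r)) (torLift K s op y) k := by
  exact map_serreSum (A := FreeAlgebra K (TorGen n)) (B := Module.End L (ℤ →₀ V))
    (torLift K s op) q m x y k

theorem torLift_kPlusMode (q : K) (x : FreeAlgebra K (TorGen n))
    (h : ℕ → FreeAlgebra K (TorGen n)) (k : ℤ) :
    torLift K s op (kPlusMode q x h k) =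
      kPlusMode q (torLift K s op x) (fun r => torLift K s op (h r)) k := by
  exact map_kPlusMode (A := FreeAlgebra K (TorGen n)) (B := Module.End L (ℤ →₀ V))
    (torLift K s op) q x h k

theorem torLift_kMinusMode (q : K) (x : FreeAlgebra K (TorGen n))
    (h : ℕ → FreeAlgebra K (TorGen n)) (k : ℤ) :
    torLift K s op (kMinusMode q x h k) =
      kMinusMode q (torLift K s op x) (fun r => torLift K s op (h r)) k := by
  exact map_kMinusMode (A := FreeAlgebra K (TorGen n)) (B := Module.End L (ℤ →₀ V))
    (torLift K s op) q x h k

theorem gradedOp_kPlusMode (q : L) (x : Module.End L V) (h : ℕ → Module.End L V) (k : ℤ) :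
    gradedOp (kPlusMode q x h k) 0 =
      kPlusMode q (gradedOp x 0) (fun r => gradedOp (h r) 0) k := by
  exact map_kPlusMode (A := Module.End L V) (B := Module.End L (ℤ →₀ V)) (gradedHom L L V) q x h k

theorem gradedOp_kMinusMode (q : L) (x : Module.End L V) (h : ℕ → Module.End L V) (k : ℤ) :
    gradedOp (kMinusMode q x h k) 0 =
      kMinusMode q (gradedOp x 0) (fun r => gradedOp (h r) 0) k := by
  exact map_kMinusMode (A := Module.End L V) (B := Module.End L (ℤ →₀ V)) (gradedHom L L V) q x h k

theorem torLift_cPow (h : TorAction s t M op) (m : ℤ) :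
    torLift K s op (cPow K m) = s ^ m • 1 := by
  have h1 : torGradedOp s op .Cp = s • 1 :=
    (congrArg (fun T => gradedOp T 0) h.cp).trans
      ((gradedOp_smul _ _ _).trans (congrArg _ gradedOp_one))
  have h2 : torGradedOp s op .Cm = s⁻¹ • 1 :=
    (congrArg (fun T => gradedOp T 0) h.cm).trans
      ((gradedOp_smul _ _ _).trans (congrArg _ gradedOp_one))
  rw [cPow, map_mul, map_pow, map_pow, torLift_free, torLift_free, h1, h2, smul_pow, smul_pow,
    one_pow, one_pow, smul_mul_smul_comm, one_mul]
  congr 1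
  rcases Int.eq_nat_or_neg m with ⟨r, rfl | rfl⟩
  · simp
  · simp

theorem torLift_kPlus {q : K} (hq : s ^ 2 = algebraMap K L q) (i : Fin (n + 1)) (k : ℤ) :
    torLift K s op (kPlus K q i k) = gradedOp (kPlusMode (s ^ 2) (op (Kp i))
      (fun r => if hr : (r : ℤ) ≠ 0 then op (H i r hr) else 0) k) 0 := by
  rw [kPlus, torLift_kPlusMode, torLift_free, gradedOp_kPlusMode, hq]
  refine kPlusMode_restrictScalars _ _ _ _ _ fun r hr => ?_
  have hr' : (r : ℤ) ≠ 0 := by exact_mod_cast hr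
  rw [dif_pos hr', dif_pos hr', torLift_free]
  rfl

theorem torLift_kMinus {q : K} (hq : s ^ 2 = algebraMap K L q) (i : Fin (n + 1)) (k : ℤ) :
    torLift K s op (kMinus K q i k) = gradedOp (kMinusMode (s ^ 2) (op (Km i))
      (fun r => if hr : -(r : ℤ) ≠ 0 then op (H i (-r) hr) else 0) k) 0 := by
  rw [kMinus, torLift_kMinusMode, torLift_free, gradedOp_kMinusMode, hq]
  refine kMinusMode_restrictScalars _ _ _ _ _ fun r hr => ?_
  have hr' : -(r : ℤ) ≠ 0 := by simpa using hr
  rw [dif_pos hr', dif_pos hr', torLift_free]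
  rfl

theorem list_prod_gradedOp (l : List (Module.End L V)) (d : ℤ) :
    (l.map fun T => gradedOp T d).prod = gradedOp l.prod (l.length * d) := by
  induction l with
  | nil => simp [gradedOp_one]
  | cons T l ih =>
    rw [List.map_cons, List.prod_cons, List.prod_cons, ih, gradedOp_mul, List.length_cons]
    congr 1
    push_cast
    ring

theorem gradedOp_sum {ι : Type*} (u : Finset ι) (T : ι → Module.End L V) (d : ℤ) :
    gradedOp (∑ x ∈ u, T x) d = ∑ x ∈ u, gradedOp (T x) d :=
  map_sum (AddMonoidHom.mk' (fun T : Module.End L V => gradedOp T d)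
    fun S T => gradedOp_add S T d) T u

/-- Every word of the Serre sum contains m factors x and one factor y, so the sum is homogeneous. -/
theorem gradedOp_serreSum (q : L) (m : ℕ) (x : ℤ → Module.End L V) (y : Module.End L V)
    (k : Fin m → ℤ) (d d' : ℤ) :
    serreSum q m (fun r => gradedOp (x r) d) (gradedOp y d') k =
      gradedOp (serreSum q m x y k) (m * d + d') := by
  unfold serreSum
  rw [gradedOp_sum]
  refine Finset.sum_congr rfl fun σ _ => ?_
  rw [gradedOp_sum]
  refine Finset.sum_congr rfl fun r hr => ?_
  rw [Finset.mem_range] at hr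
  have h1 : (List.ofFn fun t => gradedOp (x (k (σ t))) d) =
      (List.ofFn fun t => x (k (σ t))).map fun T => gradedOp T d := by
    rw [List.map_ofFn]
    rfl
  rw [gradedOp_smul, h1, ← List.map_take, ← List.map_drop, list_prod_gradedOp, list_prod_gradedOp,
    gradedOp_mul, gradedOp_mul, List.length_take, List.length_drop, List.length_ofFn,
    min_eq_left (by omega), Nat.cast_sub (by omega)]
  congr 2
  ring

theorem serreSum_restrictScalars {A : Type*} [Ring A] [Algebra K A] [Algebra L A]
    [IsScalarTower K L A] (q : K) (m : ℕ) (x : ℤ → A) (y : A) (k : Fin m → ℤ) :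
    serreSum q m x y k = serreSum (algebraMap K L q) m x y k := by
  refine Finset.sum_congr rfl fun σ _ => Finset.sum_congr rfl fun r _ => ?_
  rw [← algebraMap_smul L]
  simp [qBinomial, qFactorial, map_qInt]

/-- All relations are homogeneous for the d₂-degree, so those on V lift to V ⊗ L[u, u⁻¹]; those with
q^(±d₂) express this grading. -/
theorem torLift_rel {q κ : K} (hqs : s ^ 2 = algebraMap K L q)
    (hκ : t ^ 2 = algebraMap K L κ) (hs : s ≠ 0) (hop : TorAction s t M op)
    {x y : FreeAlgebra K (TorGen n)} (h : TorRel q κ n M x y) :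
    torLift K s op x = torLift K s op y := by
  have hq0 : s ^ 2 ≠ 0 := pow_ne_zero 2 hs
  have hsm : ∀ (c : K) (T : Module.End L (ℤ →₀ V)), c • T = algebraMap K L c • T :=
    fun c T => (algebraMap_smul L c T).symm
  have hc : ∀ c : L, (gradedOp (c • (1 : Module.End L V)) 0) = c • 1 := fun c => by
    rw [gradedOp_smul, gradedOp_one]
  cases h with
  | cp_cm =>
    simp only [map_mul, map_one, torLift_free, torGradedOp, torDeg, hop.cp, hop.cm, hc]
    rw [smul_mul_smul_comm, mul_inv_cancel₀ hs, one_smul, one_mul]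
  | cm_cp =>
    simp only [map_mul, map_one, torLift_free, torGradedOp, torDeg, hop.cp, hop.cm, hc]
    rw [smul_mul_smul_comm, inv_mul_cancel₀ hs, one_smul, one_mul]
  | d1p_d1m =>
    simp only [map_mul, map_one, torLift_free, torGradedOp, torDeg, gradedOp_mul]
    rw [hop.d1p_d1m, add_zero, gradedOp_one]
  | d1m_d1p =>
    simp only [map_mul, map_one, torLift_free, torGradedOp, torDeg, gradedOp_mul]
    rw [hop.d1m_d1p, add_zero, gradedOp_one]
  | d2p_d2m =>
    simp only [map_mul, map_one, torLift_free, torGradedOp]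
    rw [gradedScale_mul_inv hq0]
  | d2m_d2p =>
    simp only [map_mul, map_one, torLift_free, torGradedOp]
    have := gradedScale_mul_inv (V := V) (inv_ne_zero hq0)
    rwa [inv_inv] at this
  | cp_central g =>
    have h1 : torGradedOp s op .Cp = s • 1 := (congrArg (fun T => gradedOp T 0) hop.cp).trans (hc s)
    rw [map_mul, map_mul, torLift_free, torLift_free, h1, smul_one_mul, mul_smul_one]
  | cm_central g =>
    have h1 : torGradedOp s op .Cm = s⁻¹ • 1 :=
      (congrArg (fun T => gradedOp T 0) hop.cm).trans (hc s⁻¹)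
    rw [map_mul, map_mul, torLift_free, torLift_free, h1, smul_one_mul, mul_smul_one]
  | kp_km i =>
    simp only [map_mul, map_one, torLift_free, torGradedOp, torDeg, gradedOp_mul]
    rw [hop.kp_km, add_zero, gradedOp_one]
  | km_kp i =>
    simp only [map_mul, map_one, torLift_free, torGradedOp, torDeg, gradedOp_mul]
    rw [← hop.kp_km_comm, hop.kp_km, add_zero, gradedOp_one]
  | kp_kp i j =>
    simp only [map_mul, torLift_free, torGradedOp, torDeg, gradedOp_mul]
    rw [hop.kp_kp]
  | kp_km_comm i j =>
    simp only [map_mul, torLift_free, torGradedOp, torDeg, gradedOp_mul]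
    rw [hop.kp_km_comm]
  | km_km i j =>
    simp only [map_mul, torLift_free, torGradedOp, torDeg, gradedOp_mul]
    rw [hop.km_km]
  | kp_h i j l hl =>
    simp only [map_mul, torLift_free, torGradedOp, torDeg, gradedOp_mul]
    rw [hop.kp_h]
  | km_h i j l hl =>
    simp only [map_mul, torLift_free, torGradedOp, torDeg, gradedOp_mul]
    rw [hop.km_h]
  | h_h i j k l hk hl =>
    rw [torLift_sub]
    simp only [map_mul, torLift_free, torGradedOp, torDeg, gradedOp_mul]
    rw [← gradedOp_sub, hop.h_h]
    split_ifs with h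
    · have h1 : ∀ k : ℤ, s ^ (2 * k) = (s ^ 2) ^ k := fun k => by rw [zpow_mul, zpow_ofNat]
      have h2 : ∀ x y : L, x • (1 : Module.End L (ℤ →₀ V)) - y • 1 = (x - y) • 1 :=
        fun x y => (sub_smul x y 1).symm
      rw [map_smul, torLift_sub, torLift_cPow hop, torLift_cPow hop, h2, hsm,
        smul_smul, add_zero, hc, ← mul_neg, h1, h1]
      simp only [map_mul, map_inv₀, map_zpow₀, map_sub, map_intCast, map_qInt, ← hqs, ← hκ]
      congr 1
      have h3 : qInt (s ^ 2) k = ((s ^ 2) ^ k - (s ^ 2) ^ (-k)) * (s ^ 2 - (s ^ 2)⁻¹)⁻¹ :=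
        div_eq_mul_inv _ _
      rw [h3]
      ring
    · rw [map_zero, gradedOp_zero]
  | d1p_kp j =>
    simp only [map_mul, torLift_free, torGradedOp, torDeg, gradedOp_mul]
    rw [hop.d1p_kp]
  | d1p_km j =>
    simp only [map_mul, torLift_free, torGradedOp, torDeg, gradedOp_mul]
    rw [hop.d1p_km]
  | d1m_kp j =>
    simp only [map_mul, torLift_free, torGradedOp, torDeg, gradedOp_mul]
    rw [hop.d1m_kp]
  | d1m_km j =>
    simp only [map_mul, torLift_free, torGradedOp, torDeg, gradedOp_mul]
    rw [hop.d1m_km]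
  | d2p_kp j =>
    simp only [map_mul, torLift_free, torGradedOp, torDeg]
    rw [gradedScale_mul_gradedOp hq0, zpow_zero, one_smul]
  | d2p_km j =>
    simp only [map_mul, torLift_free, torGradedOp, torDeg]
    rw [gradedScale_mul_gradedOp hq0, zpow_zero, one_smul]
  | d2m_kp j =>
    simp only [map_mul, torLift_free, torGradedOp, torDeg]
    rw [gradedScale_mul_gradedOp (inv_ne_zero hq0), zpow_zero, one_smul]
  | d2m_km j =>
    simp only [map_mul, torLift_free, torGradedOp, torDeg]
    rw [gradedScale_mul_gradedOp (inv_ne_zero hq0), zpow_zero, one_smul]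
  | d1_h j l hl =>
    simp only [map_mul, map_smul, torLift_free, torGradedOp, torDeg, gradedOp_mul]
    rw [mul_mul_of_mul_eq_smul hop.d1p_d1m (hop.d1_h j l hl), hsm, map_zpow₀, ← hqs,
      gradedOp_smul, add_zero, add_zero]
  | d2p_h j l hl =>
    simp only [map_mul, torLift_free, torGradedOp, torDeg]
    rw [gradedScale_mul_gradedOp hq0, zpow_zero, one_smul]
  | d2m_h j l hl =>
    simp only [map_mul, torLift_free, torGradedOp, torDeg]
    rw [gradedScale_mul_gradedOp (inv_ne_zero hq0), zpow_zero, one_smul]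
  | d1_e j k =>
    simp only [map_mul, map_smul, torLift_free, torGradedOp, torDeg, gradedOp_mul]
    rw [mul_mul_of_mul_eq_smul hop.d1p_d1m (hop.d1_e j k), hsm, map_zpow₀, ← hqs,
      gradedOp_smul, add_zero, zero_add]
  | d1_f j k =>
    simp only [map_mul, map_smul, torLift_free, torGradedOp, torDeg, gradedOp_mul]
    rw [mul_mul_of_mul_eq_smul hop.d1p_d1m (hop.d1_f j k), hsm, map_zpow₀, ← hqs,
      gradedOp_smul, add_zero, zero_add]
  | d2_e j k =>
    simp only [map_mul, map_smul, torLift_free, torGradedOp, torDeg]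
    rw [mul_mul_of_mul_eq_smul (gradedScale_mul_inv hq0) (gradedScale_mul_gradedOp hq0 _ _), hsm,
      map_zpow₀, ← hqs]
  | d2_f j k =>
    simp only [map_mul, map_smul, torLift_free, torGradedOp, torDeg]
    rw [mul_mul_of_mul_eq_smul (gradedScale_mul_inv hq0) (gradedScale_mul_gradedOp hq0 _ _), hsm,
      map_zpow₀, ← hqs]
  | k_e i j k =>
    simp only [map_mul, map_smul, torLift_free, torGradedOp, torDeg, gradedOp_mul]
    rw [mul_mul_of_mul_eq_smul (hop.kp_km i) (hop.k_e i j k), hsm, map_zpow₀, ← hqs,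
      gradedOp_smul, add_zero, zero_add]
  | k_f i j k =>
    simp only [map_mul, map_smul, torLift_free, torGradedOp, torDeg, gradedOp_mul]
    rw [mul_mul_of_mul_eq_smul (hop.kp_km i) (hop.k_f i j k), hsm, map_zpow₀, ← hqs,
      gradedOp_smul, add_zero, zero_add]
  | h_e i j k l hk =>
    rw [torLift_sub]
    simp only [map_mul, map_smul, torLift_free, torGradedOp, torDeg, gradedOp_mul,
      torLift_cPow hop, zero_add, add_zero]
    rw [← gradedOp_sub, hop.h_e, hsm, gradedOp_smul, smul_one_mul, smul_smul]
    simp only [map_mul, map_inv₀, map_zpow₀, map_intCast, map_qInt, ← hqs, ← hκ]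
  | h_f i j k l hk =>
    rw [torLift_sub]
    simp only [map_mul, map_smul, torLift_free, torGradedOp, torDeg, gradedOp_mul,
      torLift_cPow hop, zero_add, add_zero]
    rw [← gradedOp_sub, hop.h_f, hsm, gradedOp_smul, smul_one_mul, smul_smul]
    simp only [map_neg, map_mul, map_inv₀, map_zpow₀, map_intCast, map_qInt, ← hqs, ← hκ]
  | e_e i j k l =>
    simp only [torLift_sub, map_mul, map_smul, torLift_free, torGradedOp, torDeg, gradedOp_mul,
      hsm, map_zpow₀, ← hqs, ← hκ]
    rw [add_comm (if j = 0 then (1 : ℤ) else 0)]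
    simp only [← gradedOp_smul, ← gradedOp_sub]
    rw [hop.e_e]
  | f_f i j k l =>
    simp only [torLift_sub, map_mul, map_smul, torLift_free, torGradedOp, torDeg, gradedOp_mul,
      hsm, map_zpow₀, ← hqs, ← hκ]
    rw [add_comm (if j = 0 then (-1 : ℤ) else 0)]
    simp only [← gradedOp_smul, ← gradedOp_sub]
    rw [hop.f_f]
  | e_f i j k l =>
    simp only [torLift_sub, map_mul, torLift_free, torGradedOp, torDeg, gradedOp_mul]
    rw [add_comm (if j = 0 then (-1 : ℤ) else 0), ← gradedOp_sub, hop.e_f]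
    by_cases hij : i = j
    · subst hij
      -- The degrees of E_i and F_i cancel, matching the degree 0 of K_i^±.
      have h0 : (if i = 0 then (1 : ℤ) else 0) + (if i = 0 then -1 else 0) = 0 := by
        split_ifs <;> rfl
      rw [if_pos rfl, if_pos rfl, h0, map_smul, torLift_sub, map_mul, map_mul, torLift_cPow hop, torLift_cPow hop,
        torLift_kPlus hqs, torLift_kMinus hqs, smul_one_mul, smul_one_mul, hsm, map_inv₀, map_sub,
        map_inv₀, ← hqs, gradedOp_smul, gradedOp_sub, gradedOp_smul, gradedOp_smul]
    · rw [if_neg hij, if_neg hij, map_zero, gradedOp_zero]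
  | serre_e i j hij k l =>
    rw [torLift_serreSum, map_zero]
    simp only [torLift_free, torGradedOp]
    rw [serreSum_restrictScalars (L := L), ← hqs]
    exact (gradedOp_serreSum _ _ _ _ _ _ _).trans
      ((congrArg (fun T => gradedOp T _) (hop.serre_e i j hij k l)).trans (gradedOp_zero _))
  | serre_f i j hij k l =>
    rw [torLift_serreSum, map_zero]
    simp only [torLift_free, torGradedOp]
    rw [serreSum_restrictScalars (L := L), ← hqs]
    exact (gradedOp_serreSum _ _ _ _ _ _ _).trans
      ((congrArg (fun T => gradedOp T _) (hop.serre_f i j hij k l)).trans (gradedOp_zero _))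

end ToroidalRepresentation
end

noncomputable section

/-! ### Specialization u = 1 and the action of the subalgebra -/

section Descent

variable {K L V : Type*} [Field K] [Field L] [Algebra K L] [AddCommGroup V] [Module L V]
  [Module K V] [IsScalarTower K L V] {n : ℕ} {q κ : K} {s t : L}
  {M : Matrix (Fin (n + 1)) (Fin (n + 1)) ℤ} {op : TorGen n → Module.End L V}

/-- The representation of the quantum toroidal algebra on `V ⊗ L[u, u⁻¹]`. -/
def torGradedRep (hqs : s ^ 2 = algebraMap K L q) (hκ : t ^ 2 = algebraMap K L κ) (hs : s ≠ 0)
    (hop : TorAction s t M op) : QTor q κ n M →ₐ[K] Module.End L (ℤ →₀ V) :=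
  RingQuot.liftAlgHom K ⟨torLift K s op, fun _ _ h => torLift_rel hqs hκ hs hop h⟩

theorem torGradedRep_gen (hqs : s ^ 2 = algebraMap K L q) (hκ : t ^ 2 = algebraMap K L κ)
    (hs : s ≠ 0) (hop : TorAction s t M op) (g : TorGen n) :
    torGradedRep hqs hκ hs hop (QTor.gen q κ n M g) = torGradedOp s op g := by
  rw [torGradedRep, QTor.gen, RingQuot.liftAlgHom_mkAlgHom_apply]
  exact torLift_free g

variable (L V) in
/-- The specialization `u = 1`. -/
def gradedSum : (ℤ →₀ V) →ₗ[L] V := Finsupp.lsum L fun _ => LinearMap.id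

theorem gradedSum_single (z : ℤ) (v : V) : gradedSum L V (Finsupp.single z v) = v := by
  simp [gradedSum]

theorem gradedSum_gradedOp (T : Module.End L V) (d : ℤ) (f : ℤ →₀ V) :
    gradedSum L V (gradedOp T d f) = T (gradedSum L V f) := by
  induction f using Finsupp.induction_linear with
  | zero => simp
  | add f g hf hg => rw [map_add, map_add, map_add, map_add, hf, hg]
  | single z v => rw [gradedOp_single, gradedSum_single, gradedSum_single]

/-- The result after u = 1 depends only on the input after u = 1. Each generator other than q^(±d₂)
multiplies u by a pure power and so has this property, which sums and products inherit. -/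
theorem gradedSum_torGradedRep (hqs : s ^ 2 = algebraMap K L q) (hκ : t ^ 2 = algebraMap K L κ)
    (hs : s ≠ 0) (hop : TorAction s t M op) (x : QTor.phi q κ n M) (f : ℤ →₀ V) :
    gradedSum L V (torGradedRep hqs hκ hs hop x f) =
      gradedSum L V (torGradedRep hqs hκ hs hop x (Finsupp.single 0 (gradedSum L V f))) := by
  obtain ⟨x, hx⟩ := x
  simp only
  rw [QTor.phi] at hx
  induction hx using Algebra.adjoin_induction generalizing f with
  | mem x hx =>
    obtain ⟨g, hg, rfl⟩ := hx
    rw [torGradedRep_gen, torGradedOp_of_notD2 s op hg, gradedSum_gradedOp, gradedSum_gradedOp,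
      gradedSum_single]
  | algebraMap r =>
    rw [AlgHom.commutes]
    simp only [Module.algebraMap_end_apply]
    rw [← algebraMap_smul L, ← algebraMap_smul L r (Finsupp.single _ _), map_smul, map_smul,
      gradedSum_single]
  | add x y _ _ hx hy =>
    rw [map_add, LinearMap.add_apply, LinearMap.add_apply, map_add, map_add, hx f, hy f]
  | mul x y _ _ hx hy =>
    rw [map_mul, Module.End.mul_apply, Module.End.mul_apply, hx, hy, ← hx]

/-- The representation of the subalgebra `phi` on `V`. -/
def torRep (hqs : s ^ 2 = algebraMap K L q) (hκ : t ^ 2 = algebraMap K L κ) (hs : s ≠ 0)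
    (hop : TorAction s t M op) : QTor.phi q κ n M →ₐ[K] Module.End L V :=
  AlgHom.ofLinearMap
    { toFun := fun x => gradedSum L V ∘ₗ torGradedRep hqs hκ hs hop x ∘ₗ Finsupp.lsingle 0
      map_add' := fun x y => by
        refine LinearMap.ext fun v => ?_
        simp
      map_smul' := fun c x => by
        refine LinearMap.ext fun v => ?_
        simp only [RingHom.id_apply, Subalgebra.coe_smul, map_smul, LinearMap.comp_apply,
          LinearMap.smul_apply]
        rw [← algebraMap_smul L, map_smul, algebraMap_smul] }
    (LinearMap.ext fun v => by simp [gradedSum_single])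
    (fun x y => LinearMap.ext fun v => by
      simp only [LinearMap.coe_mk, AddHom.coe_mk, Module.End.mul_apply, LinearMap.comp_apply,
        Finsupp.lsingle_apply, MulMemClass.coe_mul, map_mul]
      rw [gradedSum_torGradedRep hqs hκ hs hop x])

theorem torRep_phiGen (hqs : s ^ 2 = algebraMap K L q) (hκ : t ^ 2 = algebraMap K L κ)
    (hs : s ≠ 0) (hop : TorAction s t M op) (g : TorGen n) (hg : g.NotD2) :
    torRep hqs hκ hs hop (QTor.phiGen q κ M g hg) = op g := by
  refine LinearMap.ext fun v => ?_
  change gradedSum L V (torGradedRep hqs hκ hs hop (QTor.gen q κ n M g) (Finsupp.single 0 v)) = _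
  rw [torGradedRep_gen, torGradedOp_of_notD2 s op hg, gradedSum_gradedOp, gradedSum_single]

theorem phi_hom_ext {B : Type*} [Semiring B] [Algebra K B] {ρ ρ' : QTor.phi q κ n M →ₐ[K] B}
    (h : ∀ g hg, ρ (QTor.phiGen q κ M g hg) = ρ' (QTor.phiGen q κ M g hg)) : ρ = ρ' := by
  refine AlgHom.ext fun x => ?_
  obtain ⟨x, hx⟩ := x
  have hx' := hx
  rw [QTor.phi] at hx'
  induction hx' using Algebra.adjoin_induction with
  | mem x hx' =>
    obtain ⟨g, hg, rfl⟩ := hx'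
    exact h g hg
  | algebraMap r => exact (ρ.commutes r).trans (ρ'.commutes r).symm
  | add x y hx₁ hy₁ hx₂ hy₂ =>
    exact (map_add ρ ⟨x, hx₁⟩ ⟨y, hy₁⟩).trans ((congrArg₂ _ (hx₂ hx₁) (hy₂ hy₁)).trans
      (map_add ρ' ⟨x, hx₁⟩ ⟨y, hy₁⟩).symm)
  | mul x y hx₁ hy₁ hx₂ hy₂ =>
    exact (map_mul ρ ⟨x, hx₁⟩ ⟨y, hy₁⟩).trans ((congrArg₂ _ (hx₂ hx₁) (hy₂ hy₁)).trans
      (map_mul ρ' ⟨x, hx₁⟩ ⟨y, hy₁⟩).symm)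

end Descent

/-! ### Verification of the relations on W(p)_n -/

section MainTheorem

variable {n : ℕ} {L : Type*} [Field L] [CharZero L]

/-- The action of a generator on `W(p)_n`; the value at `q^{± d₂}` is not used. -/
def torOp (p : Fin (n + 1)) (s t : L) (M : Matrix (Fin (n + 1)) (Fin (n + 1)) ℤ) :
    TorGen n → Module.End L (WSpace n p L)
  | .E i k => wVertex p s t M (i, 1) k
  | .F i k => wVertex p s t M (i, -1) k
  | .H i l _ => wH p s t M i l
  | .Kp i => wQPartial p s i 1
  | .Km i => wQPartial p s i (-1)
  | .Cp => s • 1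
  | .Cm => s⁻¹ • 1
  | .D1p => wQD p s
  | .D1m => wQD p s⁻¹
  | .D2p => 1
  | .D2m => 1

variable {p : Fin (n + 1)} {s t : L}

theorem wVertex_serreSum {a : ℤ} (hs : s ≠ 0) (ht : t ≠ 0)
    (hq : ∀ k : ℕ, k ≠ 0 → qInt (s ^ 2) k ≠ 0) (hn : 1 < n) {i j : Fin (n + 1)}
    (hij : i ≠ j) (e : ℤˣ) (k : Fin (1 - affCartan n i j).toNat → ℤ) (l : ℤ) :
    serreSum (s ^ 2) (1 - affCartan n i j).toNat
      (fun r => wVertex p s t (torMatrix n a) (i, e) r)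
      (wVertex p s t (torMatrix n a) (j, e) l) k = 0 := by
  have hq1 : s ^ 2 - (s ^ 2)⁻¹ ≠ 0 := by
    intro h
    have := hq 1 one_ne_zero
    rw [qInt, h, div_zero] at this
    exact this rfl
  rcases affCartan_eq_zero_or hn hij with h0 | h0
  · have hm : (1 - affCartan n i j).toNat = 1 := by
      rw [h0]
      rfl
    -- The type of `k` depends on this number, so it must become a variable before its value is
    -- substituted.
    generalize (1 - affCartan n i j).toNat = m at hm k
    subst hm
    exact serreSum_one _ _ (fun r => wVertex_comm_of_zero hs ht hq hn h0 e r l) k hq1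
  · have hm : (1 - affCartan n i j).toNat = 2 := by
      rw [h0]
      rfl
    generalize (1 - affCartan n i j).toNat = m at hm k
    subst hm
    have h2 : qInt (s ^ 2) 2 = s ^ 2 + (s ^ 2)⁻¹ := by
      rw [qInt, div_eq_iff hq1, zpow_neg, zpow_ofNat]
      ring
    rw [serreSum_two _ _ _ hq1 (by exact_mod_cast hq 2 two_ne_zero), h2]
    exact wVertex_serre hs ht hq hn h0 e (k 0) (k 1) l

theorem torAction_torOp {a : ℤ} (hs : s ≠ 0) (ht : t ≠ 0)
    (hq : ∀ k : ℕ, k ≠ 0 → qInt (s ^ 2) k ≠ 0) (hn : 1 < n) :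
    TorAction s t (torMatrix n a) (torOp p s t (torMatrix n a)) where
  cp := rfl
  cm := rfl
  d1p_d1m := wQD_mul_inv hs
  d1m_d1p := by
    have := wQD_mul_inv (p := p) (inv_ne_zero hs)
    rwa [inv_inv] at this
  kp_km i := by
    change wQPartial p s i 1 * wQPartial p s i (-1) = 1
    rw [wQPartial_mul hs, add_neg_cancel, wQPartial_zero]
  kp_kp i j := wQPartial_comm i j 1 1
  kp_km_comm i j := wQPartial_comm i j 1 (-1)
  km_km i j := wQPartial_comm i j (-1) (-1)
  kp_h i j l _ := wQPartial_mul_wH i j 1 l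
  km_h i j l _ := wQPartial_mul_wH i j (-1) l
  h_h i j k l hk _ := wH_comm (torMatrix_skew a) i j k l hk
  d1p_kp j := wQD_mul_wQPartial hs j 1
  d1p_km j := wQD_mul_wQPartial hs j (-1)
  d1m_kp j := wQD_mul_wQPartial (inv_ne_zero hs) j 1
  d1m_km j := wQD_mul_wQPartial (inv_ne_zero hs) j (-1)
  d1_h j l _ := wQD_mul_wH hs j l
  d1_e j k := wQD_mul_wVertex hn hs (j, 1) k
  d1_f j k := wQD_mul_wVertex hn hs (j, -1) k
  k_e i j k := by
    have := wQPartial_mul_wVertex (p := p) (t := t) (M := torMatrix n a) hs i j 1 1 k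
    rwa [Units.val_one, one_mul, one_mul] at this
  k_f i j k := by
    have := wQPartial_mul_wVertex (p := p) (t := t) (M := torMatrix n a) hs i j (-1) 1 k
    rwa [Units.val_neg, Units.val_one, one_mul, neg_one_mul] at this
  h_e i j k l hk := by
    have := wH_mul_wVertex (p := p) (t := t) (a := a) hs hq i j 1 k l hk
    rwa [Units.val_one, Int.cast_one, one_mul, neg_one_mul] at this
  h_f i j k l hk := by
    have := wH_mul_wVertex (p := p) (t := t) (a := a) hs hq i j (-1) k l hk
    rwa [Units.val_neg, Units.val_one, Int.cast_neg, Int.cast_one, neg_one_mul, neg_neg,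
      one_mul] at this
  e_e i j k l := by
    have := wVertex_quadratic (p := p) (a := a) hs ht hq hn i j 1 k l
    rwa [Units.val_one, one_mul] at this
  f_f i j k l := by
    have := wVertex_quadratic (p := p) (a := a) hs ht hq hn i j (-1) k l
    rwa [Units.val_neg, Units.val_one, neg_one_mul] at this
  e_f i j k l := by
    have h := wVertex_commutator (p := p) (a := a) hs ht hq hn i j k l
    rw [← kPlusMode_wQPartial, ← kMinusMode_wQPartial] at h
    refine h.trans ?_
    -- There is no generator H_{i,0}; the default value at r = 0 does not matter, since the
    -- exponential ignores that entry.
    have h1 : kPlusMode (s ^ 2) (wQPartial p s i 1)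
        (fun r => wH p s t (torMatrix n a) i (r : ℤ)) (k + l) = kPlusMode (s ^ 2) (wQPartial p s i 1)
        (fun r => if hr : (r : ℤ) ≠ 0 then wH p s t (torMatrix n a) i r else 0) (k + l) :=
      kPlusMode_restrictScalars (K := L) (L := L) _ _ _ _ _ fun r hr => by
        rw [dif_pos (by exact_mod_cast hr)]
    have h2 : kMinusMode (s ^ 2) (wQPartial p s i (-1))
        (fun r => wH p s t (torMatrix n a) i (-(r : ℤ))) (k + l) =
        kMinusMode (s ^ 2) (wQPartial p s i (-1))
        (fun r => if hr : -(r : ℤ) ≠ 0 then wH p s t (torMatrix n a) i (-r) else 0) (k + l) :=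
      kMinusMode_restrictScalars (K := L) (L := L) _ _ _ _ _ fun r hr => by
        rw [dif_pos (by simpa using hr)]
    rw [h1, h2]
    rfl
  serre_e i j hij k l := wVertex_serreSum hs ht hq hn hij 1 k l
  serre_f i j hij k l := wVertex_serreSum hs ht hq hn hij (-1) k l

end MainTheorem

/-! ### Nonvanishing of quantum integers in ℚ(q) -/

section RationalFunctions

theorem ratFunc_X_pow_ne_one {m : ℕ} (hm : m ≠ 0) : (RatFunc.X : RatFunc ℚ) ^ m ≠ 1 := by
  intro h
  have h1 : algebraMap (Polynomial ℚ) (RatFunc ℚ) (Polynomial.X ^ m) =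
      algebraMap (Polynomial ℚ) (RatFunc ℚ) 1 := by
    rw [map_pow, map_one, RatFunc.algebraMap_X, h]
  have h2 := congrArg Polynomial.natDegree (RatFunc.algebraMap_injective ℚ h1)
  rw [Polynomial.natDegree_X_pow, Polynomial.natDegree_one] at h2
  exact hm h2

theorem qInt_ne_zero_of_pow_ne_one {K : Type*} [Field K] {q : K} (hq : q ≠ 0)
    (h : ∀ m : ℕ, m ≠ 0 → q ^ m ≠ 1) {k : ℕ} (hk : k ≠ 0) : qInt q k ≠ 0 := by
  have h1 : ∀ k : ℕ, k ≠ 0 → q ^ (k : ℤ) - q ^ (-(k : ℤ)) ≠ 0 := by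
    intro k hk h0
    refine h (k + k) (by omega) ?_
    rw [sub_eq_zero, zpow_neg, zpow_natCast, ← mul_eq_one_iff_eq_inv₀ (pow_ne_zero k hq)] at h0
    rw [pow_add, h0]
  have h2 := h1 1 one_ne_zero
  rw [Nat.cast_one, zpow_one, zpow_neg_one] at h2
  exact div_ne_zero (h1 k hk) h2

end RationalFunctions

/-! ### Uniqueness and the proposition -/

section Uniqueness

variable {K L : Type*} [Field K] [Field L] [CharZero L] [Algebra K L] {q κ : K} {n : ℕ}
  {M : Matrix (Fin (n + 1)) (Fin (n + 1)) ℤ} {p : Fin (n + 1)} {s t : L}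

theorem phiGen_mul_eq_one {g g' : TorGen n} (hg : g.NotD2) (hg' : g'.NotD2)
    (h : TorRel q κ n M (TorGen.free K g * TorGen.free K g') 1) :
    QTor.phiGen q κ M g hg * QTor.phiGen q κ M g' hg' = 1 := by
  refine Subtype.ext ?_
  change QTor.gen q κ n M g * QTor.gen q κ n M g' = 1
  rw [QTor.gen, QTor.gen, ← map_mul, RingQuot.mkAlgHom_rel K h, map_one]

theorem kPlusMode_zero {A : Type*} [Ring A] [Algebra K A] (q : K) (x : A) (h : ℕ → A) :
    kPlusMode q x h 0 = x := by
  rw [kPlusMode, if_pos le_rfl, Int.toNat_zero, expCoeff_zero, mul_one]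

theorem phi_map_kPlusMode (ρ : QTor.phi q κ n M →ₐ[K] Module.End L (WSpace n p L))
    (x : QTor.phi q κ n M) (h : ℕ → QTor.phi q κ n M) (k : ℤ) :
    ρ (kPlusMode q x h k) = kPlusMode q (ρ x) (fun r => ρ (h r)) k := by
  exact map_kPlusMode (A := QTor.phi q κ n M) (B := Module.End L (WSpace n p L)) ρ q x h k

theorem phi_map_kMinusMode (ρ : QTor.phi q κ n M →ₐ[K] Module.End L (WSpace n p L))
    (x : QTor.phi q κ n M) (h : ℕ → QTor.phi q κ n M) (k : ℤ) :
    ρ (kMinusMode q x h k) = kMinusMode q (ρ x) (fun r => ρ (h r)) k := by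
  exact map_kMinusMode (A := QTor.phi q κ n M) (B := Module.End L (WSpace n p L)) ρ q x h k

/-- A vertex action is determined on the generators. -/
theorem IsVertexAction.phiGen_eq {ρ : QTor.phi q κ n M →ₐ[K] Module.End L (WSpace n p L)}
    (hρ : IsVertexAction q κ M p s t ρ) (hs : s ≠ 0) (g : TorGen n) (hg : g.NotD2) :
    ρ (QTor.phiGen q κ M g hg) = torOp p s t M g := by
  have hinv : ∀ {g g' : TorGen n} (hg : g.NotD2) (hg' : g'.NotD2),
      TorRel q κ n M (TorGen.free K g * TorGen.free K g') 1 →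
      ∀ T T' : Module.End L (WSpace n p L), ρ (QTor.phiGen q κ M g' hg') = T' → T' * T = 1 →
      ρ (QTor.phiGen q κ M g hg) = T := by
    intro g g' hg hg' h T T' hT' hT
    have h1 := congrArg ρ (phiGen_mul_eq_one hg hg' h)
    rw [map_mul, map_one, hT'] at h1
    exact left_inv_eq_right_inv h1 hT
  -- K_i^+ is the zeroth mode of K_i^+(z), so the prescription determines it. K_i^-, q^(-c/2) and
  -- q^(-d₁) are then forced as inverses.
  have hkp : ∀ i, ρ (QTor.phiGen q κ M (.Kp i) trivial) = wQPartial p s i 1 := by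
    intro i
    have h := hρ.map_kPlus i 0
    rw [QTor.phiKPlus, kPlusMode_zero, ← kPlusMode_wQPartial, kPlusMode_zero] at h
    exact h
  cases g with
  | E i k => exact (hρ.map_e i k).trans (wE_eq_wVertex i k)
  | F i k => exact (hρ.map_f i k).trans (wF_eq_wVertex i k)
  | H i l hl => exact hρ.map_h i l hl
  | Kp i => exact hkp i
  | Km i =>
    refine hinv (g' := .Kp i) _ trivial (.km_kp i) _ _ (hkp i) ?_
    change wQPartial p s i 1 * wQPartial p s i (-1) = 1
    rw [wQPartial_mul hs, add_neg_cancel, wQPartial_zero]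
  | Cp => exact hρ.map_c
  | Cm =>
    refine hinv (g' := .Cp) _ trivial .cm_cp _ _ hρ.map_c ?_
    change s • (1 : Module.End L (WSpace n p L)) * s⁻¹ • 1 = 1
    rw [smul_mul_smul_comm, mul_inv_cancel₀ hs, one_smul, one_mul]
  | D1p => exact hρ.map_d1
  | D1m => exact hinv (g' := .D1p) _ trivial .d1m_d1p _ _ hρ.map_d1 (wQD_mul_inv hs)
  | D2p => exact hg.elim
  | D2m => exact hg.elim

end Uniqueness

theorem proposition3p2p2 (n : ℕ) (hn : 1 < n) (a : ℤ) (p : Fin (n + 1)) (κ : RatFunc ℚ)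
    (hκ : κ ≠ 0) (L : Type*) [Field L] [Algebra (RatFunc ℚ) L] (s t : L)
    (hs : s ^ 2 = algebraMap (RatFunc ℚ) L RatFunc.X) (ht : t ^ 2 = algebraMap (RatFunc ℚ) L κ) :
    ∃ ρ : QTor.phi (RatFunc.X : RatFunc ℚ) κ n (torMatrix n a) →ₐ[RatFunc ℚ]
        Module.End L (WSpace n p L),
      IsVertexAction RatFunc.X κ (torMatrix n a) p s t ρ ∧
      (∀ ρ', IsVertexAction RatFunc.X κ (torMatrix n a) p s t ρ' → ρ' = ρ) ∧
      QTor.HasLevel RatFunc.X κ (torMatrix n a) ρ 1 0 := by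
  have : CharZero L := charZero_of_injective_algebraMap (algebraMap (RatFunc ℚ) L).injective
  have hs0 : s ≠ 0 := by
    rintro rfl
    rw [zero_pow two_ne_zero, eq_comm, map_eq_zero] at hs
    exact RatFunc.X_ne_zero hs
  have ht0 : t ≠ 0 := by
    rintro rfl
    rw [zero_pow two_ne_zero, eq_comm, map_eq_zero] at ht
    exact hκ ht
  have hq : ∀ k : ℕ, k ≠ 0 → qInt (s ^ 2) k ≠ 0 := by
    intro k hk
    rw [hs, ← map_qInt]
    exact (map_ne_zero _).mpr
      (qInt_ne_zero_of_pow_ne_one RatFunc.X_ne_zero (fun m hm => ratFunc_X_pow_ne_one hm) hk)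
  have hop := torAction_torOp (p := p) (a := a) hs0 ht0 hq hn
  set ρ := torRep hs ht hs0 hop with hρ
  have hgen : ∀ g hg, ρ (QTor.phiGen RatFunc.X κ (torMatrix n a) g hg) =
      torOp p s t (torMatrix n a) g := torRep_phiGen hs ht hs0 hop
  have hkp : ∀ i, ρ (QTor.phiKp RatFunc.X κ (torMatrix n a) i) = wQPartial p s i 1 :=
    fun i => hgen _ _
  have hact : IsVertexAction RatFunc.X κ (torMatrix n a) p s t ρ :=
    { map_c := hgen _ _
      map_d1 := hgen _ _
      map_e := fun i k => (hgen _ _).trans (wE_eq_wVertex i k).symm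
      map_f := fun i k => (hgen _ _).trans (wF_eq_wVertex i k).symm
      map_h := fun i l hl => hgen _ _
      map_kPlus := fun i k => by
        rw [QTor.phiKPlus, phi_map_kPlusMode, hkp, ← kPlusMode_wQPartial, hs]
        refine kPlusMode_restrictScalars _ _ _ _ _ fun r hr => ?_
        rw [dif_pos (by exact_mod_cast hr)]
        exact hgen _ _
      map_kMinus := fun i k => by
        have h := hgen (.Km i) trivial
        rw [QTor.phiKMinus, phi_map_kMinusMode, QTor.phiKm, h, ← kMinusMode_wQPartial, hs]
        refine kMinusMode_restrictScalars _ _ _ _ _ fun r hr => ?_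
        rw [dif_pos (by simpa using hr)]
        exact hgen _ _ }
  refine ⟨ρ, hact, fun ρ' hρ' => ?_, ?_, ?_⟩
  · exact phi_hom_ext fun g hg => (hρ'.phiGen_eq hs0 g hg).trans (hgen g hg).symm
  · rw [map_pow, hact.map_c, smul_pow, one_pow, hs, zpow_one, algebraMap_smul,
      Algebra.algebraMap_eq_smul_one]
  -- K_δ^+ acts on v ⊗ e^β by q to the power ∑_i ⟨h̄_i, β⟩ = 0.
  · rw [QTor.phiKDelta, map_list_prod, List.map_ofFn, zpow_zero, map_one,
      ← list_prod_wQPartial (p := p) hs0]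
    congr 2
    funext i
    exact hkp i

end
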